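/- Let $\rho,\gamma>1/2$ and let $w:[0,\infty)\to\mathbb R$ be continuous and $(\rho,\gamma)$-irregular, i.e. for every $T>0$ $$\sup_{a\in\mathbb R}\ \sup_{0\le s<t\le T}(1+|a|)^{\rho}\,\frac{\bigl|\int_s^t e^{iaw_r}\,dr\bigr|}{|t-s|^{\gamma}}<\infty .$$ Let $D$ be $\mathbb T=\mathbb R/2\pi\mathbb Z$ or $\mathbb R$, let $\alpha\ge 0$, and let $H^\alpha=H^\alpha(D)$ be the complex Sobolev space with norm $\|(1+|\xi|^2)^{\alpha/2}\hat f\|_{L^2}$. Put $U^w_t=e^{i w_t\partial_x^2}$ and $\mathcal N(f)=i|f|^2f$; let $\Pi_N$ be the projector on the frequencies $|\xi|\le N$ and $\mathcal N_N(f)=\Pi_N\mathcal N(\Pi_Nf)$. For a path $\varphi$ write $\varphi^w_t=(U^w_t)^{-1}\varphi_t$. For $T>0$ let $\mathcal D^w_T(H^\alpha)$ be the space of $\varphi\in C([0,T],H^\alpha)$ such that $\varphi^w$ is $1/2$-Hölder in $H^\alpha$, with norm $$\|\varphi\|_{\mathcal D^w_T}=\sup_{0\le t\le T}\|\varphi^w_t\|_{H^\alpha}+\sup_{0\le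 s<t\le T}\frac{\|\varphi^w_t-\varphi^w_s\|_{H^\alpha}}{|t-s|^{1/2}} .$$ A path $\varphi\in C([0,T],H^\alpha)$ is a mild solution on $[0,T]$ of the modulated cubic NLS equation $\partial_t\varphi=i\partial_x^2\varphi\,\dot w_t+i|\varphi|^2\varphi$ with initial condition $\phi\in H^\alpha$ if for every $t\in[0,T]$ the limit $Q_t=\lim_{N\to\infty}\int_0^t(U^w_s)^{-1}\mathcal N_N(\varphi_s)\,ds$ exists in $H^\alpha$ and $\varphi_t=U^w_t(\phi+Q_t)$. Then: 1. For $f\in H^\alpha$ and $0\le s\le t$ the limit $X_{st}(f)=\lim_{N\to\infty}\int_s^t(U^w_r)^{-1}\mathcal N_N(U^w_rf)\,dr$ exists in $H^\alpha$. We say that $\varphi$ solves the Young equation on $[0,T]$ with initial condition $\phi$ if, for all $t\in[0,T]$, $\varphi^w_t=\phi+\int_0^tX_{d\sigma}(\varphi^w_\sigma)$, where the integral is the limit in $H^\alpha$ of the Riemann sums $\sum_iX_{t_it_{i+1}}(\varphi^w_{t_i})$ over partitions of $[0,t]$ as the mesh tends to $0$. 2. (Global existence) For every $\phi\in H^\alpha$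 there is a path $S\phi:[0,\infty)\to H^\alpha$ which for every $T>0$ belongs on $[0,T]$ to $\mathcal D^w_T(H^\alpha)$, is a mild solution, and solves the Young equation, with initial condition $\phi$. 3. (Uniqueness) For every $T>0$, every $\varphi\in\mathcal D^w_T(H^\alpha)$ which is a mild solution or solves the Young equation on $[0,T]$ with initial condition $\phi\in H^\alpha$ coincides with $S\phi$ on $[0,T]$. 4. (Locally Lipschitz flow) For all $T>0$ and $R\ge 0$ there is $K<\infty$ such that $\|S\phi-S\phi'\|_{\mathcal D^w_T}\le K\|\phi-\phi'\|_{H^\alpha}$ whenever $\|\phi\|_{H^\alpha},\|\phi'\|_{H^\alpha}\le R$. -/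

import Mathlib

open MeasureTheory Filter Topology Set
open scoped ENNReal FourierTransform

/-- `w : [0, ∞) → ℝ` is continuous and `(ρ, γ)`-irregular: for every `T > 0`,
`sup_a sup_{0 ≤ s < t ≤ T} (1 + |a|)^ρ |∫_s^t e^{i a w_r} dr| / |t - s|^γ < ∞`.
(Only the values of `w` on `[0, ∞)` matter.) -/
structure IsIrregular (ρ γ : ℝ) (w : ℝ → ℝ) : Prop where
  rho_pos : 0 < ρ
  gamma_pos : 0 < γ
  continuousOn : ContinuousOn w (Ici 0)
  bound : ∀ T : ℝ, 0 < T → ∃ C : ℝ, ∀ a s t : ℝ, 0 ≤ s → s < t → t ≤ T →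
    (1 + |a|) ^ ρ * ‖∫ r in s..t, Complex.exp (Complex.I * a * w r)‖ ≤ C * |t - s| ^ γ

/-- The cubic nonlinearity `𝒩(f) = i |f|² f` for `f ∈ L²(μ)`, as an element of `L²(μ)` when it
lies there (the value `0` otherwise). It is only ever applied to functions with compactly supported
Fourier transform, which are bounded. -/
noncomputable def cubicNL {X : Type*} [MeasurableSpace X] (μ : Measure X) (f : Lp ℂ 2 μ) :
    Lp ℂ 2 μ :=
  open Classical in
  if h : MemLp (fun x => Complex.I * (‖f x‖ : ℂ) ^ 2 * f x) 2 μ then h.toLp _ else 0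

/-- The data needed to write down the modulated cubic NLS equation on a given domain. Only the two
concrete values `torusNLS` and `lineNLS` below are used; `L` is the space `L²` of the domain. -/
structure NLSModel (L : Type*) where
  /-- The `H^α` norm of an element of `L²`, with the value `∞` if it does not lie in `H^α`. -/
  hNorm : ℝ → L → ℝ≥0∞
  /-- The Fourier multiplier with symbol `m(ξ)`, where `∂_x` has symbol `i ξ`. -/
  mult : (ℝ → ℂ) → L → L
  /-- The nonlinearity `𝒩(f) = i |f|² f`. -/
  nonlin : L → L

/-! ### The torus `𝕋 = ℝ / 2πℤ` -/

instance fact_two_pi_pos : Fact ((0 : ℝ) < 2 * Real.pi) := ⟨Real.two_pi_pos⟩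

/-- `L²(𝕋; ℂ)`, for the normalised Haar measure. -/
abbrev TorusL2 : Type := Lp ℂ 2 (AddCircle.haarAddCircle (T := 2 * Real.pi))

/-- Fourier multiplier on `𝕋`: `f ↦ ∑ₖ m(k) f̂(k) e^{ikx}` (defined whenever the result is in
`L²`, in particular for all `f` if `m` is bounded). -/
noncomputable def torusMult (m : ℝ → ℂ) (f : TorusL2) : TorusL2 :=
  open Classical in
  if h : Memℓp (fun k : ℤ => m k * fourierCoeff (f : AddCircle (2 * Real.pi) → ℂ) k) 2 then
    fourierBasis.repr.symm ⟨_, h⟩ else 0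

/-- `H^α(𝕋)` norm, `(∑ₖ (1 + k²)^α |f̂(k)|²)^{1/2}`. -/
noncomputable def torusHNorm (α : ℝ) (f : TorusL2) : ℝ≥0∞ :=
  eLpNorm (fun k : ℤ => (((1 + (k : ℝ) ^ 2) ^ (α / 2) : ℝ) : ℂ) *
    fourierCoeff (f : AddCircle (2 * Real.pi) → ℂ) k) 2 Measure.count

/-- Cubic NLS on `𝕋`. -/
noncomputable def torusNLS : NLSModel TorusL2 where
  hNorm := torusHNorm
  mult := torusMult
  nonlin := cubicNL _

/-! ### The real line -/

/-- `L²(ℝ; ℂ)`. -/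
abbrev LineL2 : Type := Lp ℂ 2 (volume : Measure ℝ)

/-- Fourier multiplier on `ℝ` (defined whenever the result is in `L²`, in particular for all `f`
if `m` is bounded and measurable). Mathlib's Fourier transform uses the characters `e^{2πi x ξ}`, so
that the frequency dual to `∂_x` is `2πξ`. -/
noncomputable def lineMult (m : ℝ → ℂ) (f : LineL2) : LineL2 :=
  open Classical in
  if h : MemLp (fun ξ : ℝ => m (2 * Real.pi * ξ) * (𝓕 f : LineL2) ξ) 2 volume then
    𝓕⁻ (h.toLp _ : LineL2) else 0

/-- `H^α(ℝ)` norm, `‖(1 + |2πξ|²)^{α/2} f̂‖_{L²}`. -/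
noncomputable def lineHNorm (α : ℝ) (f : LineL2) : ℝ≥0∞ :=
  eLpNorm (fun ξ : ℝ => (((1 + (2 * Real.pi * ξ) ^ 2) ^ (α / 2) : ℝ) : ℂ) * (𝓕 f : LineL2) ξ) 2
    volume

/-- Cubic NLS on `ℝ`. -/
noncomputable def lineNLS : NLSModel LineL2 where
  hNorm := lineHNorm
  mult := lineMult
  nonlin := cubicNL _

/-! ### Solutions of the modulated equation -/

namespace NLSModel

variable {L : Type*} [NormedAddCommGroup L] [NormedSpace ℝ L]

/-- The free Schrödinger group `e^{tA}`, `A = i ∂²`, with symbol `e^{-i t ξ²}`. The modulated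
evolution is `U^w_t = M.U (w t)` and its inverse is `M.U (-w t)`. -/
noncomputable def U (M : NLSModel L) (t : ℝ) (f : L) : L :=
  M.mult (fun ξ => Complex.exp (-Complex.I * t * ξ ^ 2)) f

/-- The projector `Π_N` on the frequencies `|ξ| ≤ N`. -/
noncomputable def proj (M : NLSModel L) (N : ℕ) (f : L) : L :=
  M.mult (indicator {ξ : ℝ | |ξ| ≤ N} 1) f

/-- The Galerkin nonlinearity `𝒩_N(f) = Π_N 𝒩(Π_N f)`. -/
noncomputable def galerkin (M : NLSModel L) (N : ℕ) (f : L) : L :=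
  M.proj N (M.nonlin (M.proj N f))

/-- `∫_s^t (U^w_r)⁻¹ 𝒩_N(φ_r) dr`. -/
noncomputable def duhamel (M : NLSModel L) (w : ℝ → ℝ) (N : ℕ) (φ : ℝ → L) (s t : ℝ) : L :=
  ∫ r in s..t, M.U (-w r) (M.galerkin N (φ r))

/-- `φ ∈ C([0,T]; H^α)`. -/
def IsPathOn (M : NLSModel L) (α T : ℝ) (φ : ℝ → L) : Prop :=
  ∀ t ∈ Icc 0 T, M.hNorm α (φ t) < ⊤ ∧
    Tendsto (fun s => M.hNorm α (φ s - φ t)) (𝓝[Icc 0 T] t) (𝓝 0)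

/-- `φ` is a mild solution on `[0,T]` in `H^α` with initial condition `φ₀`: for all `t ∈ [0,T]` the
limit `Q_t = lim_N ∫_0^t (U^w_s)⁻¹ 𝒩_N(φ_s) ds` exists in `H^α` and `φ_t = U^w_t (φ₀ + Q_t)`. -/
def IsMildSolutionOn (M : NLSModel L) (α : ℝ) (w : ℝ → ℝ) (T : ℝ) (φ₀ : L) (φ : ℝ → L) : Prop :=
  M.IsPathOn α T φ ∧
    ∀ t ∈ Icc 0 T, ∃ Q : L, M.hNorm α Q < ⊤ ∧
      Tendsto (fun N : ℕ => M.hNorm α (M.duhamel w N φ 0 t - Q)) atTop (𝓝 0) ∧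
      φ t = M.U (w t) (φ₀ + Q)

/-- The path `φ^w_t = (U^w_t)⁻¹ φ_t`. -/
noncomputable def pullback (M : NLSModel L) (w : ℝ → ℝ) (φ : ℝ → L) (t : ℝ) : L :=
  M.U (-w t) (φ t)

/-- The `1/2`-Hölder seminorm of a path in `C([0,T]; H^α)`. -/
noncomputable def holderSeminorm (M : NLSModel L) (α T : ℝ) (v : ℝ → L) : ℝ≥0∞ :=
  ⨆ s ∈ Icc 0 T, ⨆ t ∈ Ioc s T, M.hNorm α (v t - v s) / ENNReal.ofReal (|t - s| ^ (1 / 2 : ℝ))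

/-- `φ` restricted to `[0,T]` belongs to the space `𝒟^w(H^α)` of controlled paths. -/
def IsControlledOn (M : NLSModel L) (α : ℝ) (w : ℝ → ℝ) (T : ℝ) (φ : ℝ → L) : Prop :=
  M.IsPathOn α T φ ∧ M.holderSeminorm α T (M.pullback w φ) < ⊤

/-- The norm of `𝒟^w(H^α)` on `[0,T]`:
`sup_t ‖φ^w_t‖_{H^α} + sup_{s<t} ‖φ^w_t - φ^w_s‖_{H^α} / |t-s|^{1/2}`. -/
noncomputable def controlledNorm (M : NLSModel L) (α : ℝ) (w : ℝ → ℝ) (T : ℝ) (φ : ℝ → L) :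
    ℝ≥0∞ :=
  (⨆ t ∈ Icc 0 T, M.hNorm α (M.pullback w φ t)) + M.holderSeminorm α T (M.pullback w φ)

/-- The modulated operator `X_{st}(f) = ∫_s^t (U^w_r)⁻¹ 𝒩(U^w_r f) dr`, the integral being the limit
of its Galerkin approximations (in `L²`). -/
noncomputable def X (M : NLSModel L) (w : ℝ → ℝ) (s t : ℝ) (f : L) : L :=
  haveI : Nonempty L := ⟨0⟩
  limUnder atTop (fun N : ℕ => M.duhamel w N (fun r => M.U (w r) f) s t)

/-- The nonlinear Young integral `∫_0^t X_{dσ}(v_σ)` exists in `H^α` and equals `I`: the Riemann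
sums `∑_i X_{t_i t_{i+1}}(v_{t_i})` over partitions of `[0,t]` converge to `I` as the mesh goes to
`0`. -/
def HasYoungIntegral (M : NLSModel L) (α : ℝ) (w : ℝ → ℝ) (v : ℝ → L) (t : ℝ) (I : L) : Prop :=
  M.hNorm α I < ⊤ ∧
  ∀ ε : ℝ≥0∞, 0 < ε → ∃ δ : ℝ, 0 < δ ∧ ∀ (n : ℕ) (τ : ℕ → ℝ), Monotone τ → τ 0 = 0 → τ n = t →
    (∀ i < n, τ (i + 1) - τ i ≤ δ) →
    M.hNorm α ((∑ i ∈ Finset.range n, M.X w (τ i) (τ (i + 1)) (v (τ i))) - I) ≤ ε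

/-- `φ^w` solves the Young equation `φ^w_t = φ₀ + ∫_0^t X_{dσ}(φ^w_σ)` on `[0,T]` in `H^α`. -/
def IsYoungSolutionOn (M : NLSModel L) (α : ℝ) (w : ℝ → ℝ) (T : ℝ) (φ₀ : L) (φ : ℝ → L) : Prop :=
  ∀ t ∈ Icc 0 T, ∃ I : L, M.HasYoungIntegral α w (M.pullback w φ) t I ∧
    M.pullback w φ t = φ₀ + I

/-- Global well-posedness in `H^α` of the modulated equation, within the controlled paths. -/
def GloballyWellPosed (M : NLSModel L) (α : ℝ) (w : ℝ → ℝ) : Prop :=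
  -- the Galerkin integrals defining `X_{st}` on `H^α` converge in `H^α`
  (∀ f : L, M.hNorm α f < ⊤ → ∀ s t : ℝ, 0 ≤ s → s ≤ t →
    Tendsto (fun N : ℕ => M.hNorm α (M.duhamel w N (fun r => M.U (w r) f) s t - M.X w s t f))
      atTop (𝓝 0)) ∧
  ∃ S : L → ℝ → L,
    -- existence: `S φ₀` is a global controlled solution, both in the mild and in the Young sense
    (∀ φ₀ : L, M.hNorm α φ₀ < ⊤ → ∀ T : ℝ, 0 < T →
      M.IsControlledOn α w T (S φ₀) ∧ M.IsMildSolutionOn α w T φ₀ (S φ₀) ∧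
        M.IsYoungSolutionOn α w T φ₀ (S φ₀)) ∧
    -- uniqueness among controlled paths, on every time interval and for both notions of solution
    (∀ φ₀ : L, M.hNorm α φ₀ < ⊤ → ∀ T : ℝ, 0 < T → ∀ φ : ℝ → L, M.IsControlledOn α w T φ →
      (M.IsMildSolutionOn α w T φ₀ φ ∨ M.IsYoungSolutionOn α w T φ₀ φ) →
        ∀ t ∈ Icc 0 T, φ t = S φ₀ t) ∧
    -- the flow is Lipschitz on bounded sets of `H^α`, with values in the controlled paths
    (∀ T : ℝ, 0 < T → ∀ R : NNReal, ∃ K : NNReal, ∀ φ₀ φ₁ : L,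
      M.hNorm α φ₀ ≤ R → M.hNorm α φ₁ ≤ R →
        M.controlledNorm α w T (S φ₀ - S φ₁) ≤ K * M.hNorm α (φ₀ - φ₁))

end NLSModel

/-!
Well-posedness of the modulated cubic Schrödinger equation, on the torus and on the line, by
reduction to a nonlinear Young equation.

In the interaction representation `φ^w_t = (U^w_t)⁻¹ φ_t` the equation reads
`dφ^w_t = X_{dt}(φ^w_t)`. In Fourier variables `X_{st}` is the convolution with kernel
`i ∫_s^t e^{i Φ w_r} dr`, where `Φ = ξ² - ξ₁² + ξ₂² - ξ₃² = 2 (ξ - ξ₁) (ξ - ξ₃)` is the resonance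
function of `ξ = ξ₁ - ξ₂ + ξ₃`. Irregularity of `w` bounds the kernel by
`C |t - s|^γ (1 + |Φ|)^{-ρ}`. Where `|ξ - ξ₁| ≤ 1` or `|ξ - ξ₃| ≤ 1` this weight is at most `1`, and
elsewhere it is at most `|ξ - ξ₁|^{-ρ} |ξ - ξ₃|^{-ρ}`, a product of square integrable functions
because `ρ > 1/2`. In each region Cauchy–Schwarz bounds the quadrilinear form of the nonlinearity by
a product of four `L²` norms (`IsFrequencyMap.exists_quad_bound`). The weight `(1 + |ξ|²)^{α/2}` is
controlled by the sum of the weights of `ξ₁`, `ξ₂`, `ξ₃`, so that on `H^α` one obtains tame bounds: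
`X_{st}` is of size `|t - s|^γ`, trilinear, and linear in the `H^α` norms with coefficients that
depend on `L²` norms only (`modulatedKernel_eq_balanced`,
`IsFrequencyMap.exists_triOp_modulated_bound`).

The rest is an abstract theory. A solution is a `1/2`-Hölder path `v` with
`v_t - v_s = X_{st}(v_s) + O(|t - s|^{γ + 1/2})`. As `γ + 1/2 > 1`, a remainder of this kind is
determined by its defect under bisection (`sewing_bound`); this gives the contraction on short
intervals, Lipschitz dependence on the initial value, and uniqueness
(`IsYoungFamily.exists_lipschitz`). The nonlinearity is orthogonal to its argument in `L²`, hence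
`‖v_t‖²` has increments of order `> 1` and is constant (`HasYoungIncrements.norm_conserved`). For
the norms `p + ε ‖·‖`, with `p` the `L²` norm, the constant of a tame family does not depend on `ε`;
choosing `ε` small makes the length of the local existence interval depend on the conserved `L²`
norm alone, so that solutions are global in `H^α` (`IsTameYoungFamily.exists_solution`).

For each `N`, the Galerkin integrals along a Hölder path are Young integrals of the truncated
operators, whose bounds are uniform in `N`. They therefore converge to the Young integral of `X`
(`NLSModel.Lift.exists_hasYoungIncrements`), and mild solutions are the same as solutions of the
Young equation.

The two domains differ only in their Fourier transforms: the dual group is `ℤ` or `ℝ` with frequency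
map `κ = k` or `κ = 2πξ`, which enters through `IsFrequencyMap` and `NLSModel.IsSpectral`
(`NLSModel.IsSpectral.globallyWellPosed`). The cubic nonlinearity is identified with its form in
Fourier variables through the inversion formula and Parseval's identity
(`IsInversion.inner_cubicNL`).
-/

open scoped ComplexConjugate

/-! ### Nonlinear Young equations in a Banach space -/

section Young

/-- The constant of the sewing estimate with exponent `θ > 1`. -/
noncomputable def sewingConst (θ : ℝ) : ℝ := (1 - 2 ^ (1 - θ))⁻¹

theorem two_rpow_one_sub_lt_one {θ : ℝ} (hθ : 1 < θ) : (2 : ℝ) ^ (1 - θ) < 1 :=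
  Real.rpow_lt_one_of_one_lt_of_neg (by norm_num) (by linarith)

theorem sewingConst_pos {θ : ℝ} (hθ : 1 < θ) : 0 < sewingConst θ :=
  inv_pos.2 (by linarith [two_rpow_one_sub_lt_one hθ])

/-- Midpoint form of the sewing lemma: a remainder that is `O(|t - s|^θ)` with some constant and is
almost subadditive under bisection is `O(|t - s|^θ)` with a constant depending only on the defect
`M`. Each bisection replaces the constant `K` by `2^{1-θ} K + M`. -/
theorem sewing_bound {θ a b K M : ℝ} (hθ : 1 < θ) (hM : 0 ≤ M) {r : ℝ → ℝ → ℝ}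
    (hK : ∀ s t, a ≤ s → s ≤ t → t ≤ b → r s t ≤ K * (t - s) ^ θ)
    (hm : ∀ s t, a ≤ s → s ≤ t → t ≤ b →
      r s t ≤ r s ((s + t) / 2) + r ((s + t) / 2) t + M * (t - s) ^ θ)
    {s t : ℝ} (hs : a ≤ s) (hst : s ≤ t) (ht : t ≤ b) :
    r s t ≤ sewingConst θ * M * (t - s) ^ θ := by
  set q : ℝ := 2 ^ (1 - θ) with hq
  have hq1 : q < 1 := two_rpow_one_sub_lt_one hθ
  have hq0 : 0 < q := Real.rpow_pos_of_pos (by norm_num) _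
  have hc : q * sewingConst θ + 1 = sewingConst θ := by
    have : 1 - q ≠ 0 := by linarith
    rw [sewingConst, ← hq]; field_simp; ring
  have hhalf : ∀ x : ℝ, 0 ≤ x → 2 * (x / 2) ^ θ = q * x ^ θ := by
    intro x hx
    rw [Real.div_rpow hx (by norm_num), hq, Real.rpow_sub (by norm_num), Real.rpow_one]
    ring
  have key : ∀ n : ℕ, ∀ s t, a ≤ s → s ≤ t → t ≤ b →
      r s t ≤ (q ^ n * K + sewingConst θ * M) * (t - s) ^ θ := by
    intro n
    induction n with
    | zero =>
      intro s t hs hst ht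
      refine (hK s t hs hst ht).trans ?_
      have h1 : 0 ≤ (t - s) ^ θ := Real.rpow_nonneg (by linarith) _
      have h2 := mul_nonneg (mul_nonneg (sewingConst_pos hθ).le hM) h1
      simp only [pow_zero, one_mul]; nlinarith
    | succ n ih =>
      intro s t hs hst ht
      have e1 := ih s ((s + t) / 2) hs (by linarith) (by linarith)
      have e2 := ih ((s + t) / 2) t (by linarith) (by linarith) ht
      have e3 := hm s t hs hst ht
      rw [show (s + t) / 2 - s = (t - s) / 2 by ring] at e1
      rw [show t - (s + t) / 2 = (t - s) / 2 by ring] at e2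
      have e4 := hhalf (t - s) (by linarith)
      calc r s t ≤ (q ^ n * K + sewingConst θ * M) * (2 * ((t - s) / 2) ^ θ)
            + M * (t - s) ^ θ := by linarith
        _ = (q ^ (n + 1) * K + (q * sewingConst θ + 1) * M) * (t - s) ^ θ := by rw [e4]; ring
        _ = _ := by rw [hc]
  have hlim : Tendsto (fun n : ℕ => (q ^ n * K + sewingConst θ * M) * (t - s) ^ θ) atTop
      (𝓝 ((0 * K + sewingConst θ * M) * (t - s) ^ θ)) :=
    (((tendsto_pow_atTop_nhds_zero_of_lt_one hq0.le hq1).mul_const K).add_const _).mul_const _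
  rw [zero_mul, zero_add] at hlim
  exact ge_of_tendsto' hlim (fun n => key n s t hs hst ht)

variable {E : Type*} [NormedAddCommGroup E]

/-- `x_t - x_s = X_{st}(v_s) + O(|t - s|^{γ + 1/2})` on `[a, b]`, i.e. the increments of `x` are
those of the nonlinear Young integral of `X` along `v`. The solutions of the Young equation are the
paths with `HasYoungIncrements X γ a b v v`. -/
def HasYoungIncrements (X : ℝ → ℝ → E → E → E → E) (γ a b : ℝ) (v x : ℝ → E) : Prop :=
  ∃ K : ℝ, 0 ≤ K ∧ ∀ s t, a ≤ s → s ≤ t → t ≤ b →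
    ‖x t - x s - X s t (v s) (v s) (v s)‖ ≤ K * (t - s) ^ (γ + 1 / 2)

theorem HasYoungIncrements.mono {X : ℝ → ℝ → E → E → E → E} {γ a b a' b' : ℝ} {v x : ℝ → E}
    (h : HasYoungIncrements X γ a b v x) (ha : a ≤ a') (hb : b' ≤ b) :
    HasYoungIncrements X γ a' b' v x := by
  obtain ⟨K, hK, h⟩ := h
  exact ⟨K, hK, fun s t h1 h2 h3 => h s t (ha.trans h1) h2 (h3.trans hb)⟩

/-- A function of three variables that is additive in each of them. -/
structure IsTriadditive (B : E → E → E → E) : Prop where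
  sub₁ : ∀ f f' g h, B (f - f') g h = B f g h - B f' g h
  sub₂ : ∀ f g g' h, B f (g - g') h = B f g h - B f g' h
  sub₃ : ∀ f g h h', B f g (h - h') = B f g h - B f g h'

namespace IsTriadditive

variable {B : E → E → E → E}

theorem diag_zero (hB : IsTriadditive B) : B 0 0 0 = 0 := by
  have := hB.sub₁ 0 0 0 0; simpa using this

theorem diag_sub (hB : IsTriadditive B) (f g : E) :
    B f f f - B g g g = B (f - g) f f + B g (f - g) f + B g g (f - g) := by
  rw [hB.sub₁, hB.sub₂, hB.sub₃]; abel

theorem sub_eq (hB : IsTriadditive B) (f g h f' g' h' : E) :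
    B f g h - B f' g' h' = B (f - f') g h + B f' (g - g') h + B f' g' (h - h') := by
  rw [hB.sub₁, hB.sub₂, hB.sub₃]; abel

/-- The second difference of a cubic form over a quadrilateral `f, f', g, g'`. -/
theorem second_difference_le [NormedSpace ℝ E] (hB : IsTriadditive B) {N : Seminorm ℝ E}
    {c R D η : ℝ} (hc : 0 ≤ c)
    (hbd : ∀ f g h, N (B f g h) ≤ c * N f * N g * N h) {f f' g g' : E}
    (hf : N f ≤ R) (hf' : N f' ≤ R) (hg : N g ≤ R) (hg' : N g' ≤ R)
    (hd : N (f - g) ≤ D) (hd' : N (f' - g') ≤ D)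
    (hff : N (f - f') ≤ R * η) (hgg : N (g - g') ≤ R * η)
    (hdd : N ((f - g) - (f' - g')) ≤ D * η) :
    N ((B f f f - B f' f' f') - (B g g g - B g' g' g')) ≤ 9 * c * R ^ 2 * D * η := by
  have hR : 0 ≤ R := (apply_nonneg N f).trans hf
  have hD : 0 ≤ D := (apply_nonneg N _).trans hd
  have tri : ∀ {x y z : E} {A₁ A₂ A₃ : ℝ}, N x ≤ A₁ → N y ≤ A₂ → N z ≤ A₃ →
      N (B x y z) ≤ c * A₁ * A₂ * A₃ := by
    intro x y z A₁ A₂ A₃ h1 h2 h3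
    have := apply_nonneg N x
    have := apply_nonneg N y
    have := apply_nonneg N z
    have : 0 ≤ A₁ := by linarith
    have : 0 ≤ A₂ := by linarith
    refine (hbd x y z).trans ?_
    gcongr
  have e : (B f f f - B f' f' f') - (B g g g - B g' g' g') =
      (B ((f - g) - (f' - g')) f f + B (f' - g') (f - f') f + B (f' - g') f' (f - f')) +
      (B (g - g') (f - g) f + B g' ((f - g) - (f' - g')) f + B g' (f' - g') (f - f')) +
      (B (g - g') g (f - g) + B g' (g - g') (f - g) + B g' g' ((f - g) - (f' - g'))) := by
    rw [← hB.sub_eq, ← hB.sub_eq, ← hB.sub_eq]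
    have h1 := hB.diag_sub f g
    have h2 := hB.diag_sub f' g'
    calc _ = (B f f f - B g g g) - (B f' f' f' - B g' g' g') := by abel
      _ = _ := by rw [h1, h2]; abel
  rw [e]
  have a1 := tri hdd hf hf
  have a2 := tri hd' hff hf
  have a3 := tri hd' hf' hff
  have a4 := tri hgg hd hf
  have a5 := tri hg' hdd hf
  have a6 := tri hg' hd' hff
  have a7 := tri hgg hg hd
  have a8 := tri hg' hgg hd
  have a9 := tri hg' hg' hdd
  refine (map_add_le_add N _ _).trans ?_
  refine (add_le_add ((map_add_le_add N _ _).trans (add_le_add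
    ((map_add_le_add N _ _).trans (add_le_add_left (map_add_le_add N _ _) _))
    ((map_add_le_add N _ _).trans (add_le_add_left (map_add_le_add N _ _) _))))
    ((map_add_le_add N _ _).trans (add_le_add_left (map_add_le_add N _ _) _))).trans ?_
  nlinarith [a1, a2, a3, a4, a5, a6, a7, a8, a9]

/-- The cubic form `f ↦ B f f f` is Lipschitz on bounded sets. -/
theorem diag_sub_le [NormedSpace ℝ E] (hB : IsTriadditive B) {N : Seminorm ℝ E}
    {c R D : ℝ} (hc : 0 ≤ c)
    (hbd : ∀ f g h, N (B f g h) ≤ c * N f * N g * N h) {f g : E}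
    (hf : N f ≤ R) (hg : N g ≤ R) (hd : N (f - g) ≤ D) :
    N (B f f f - B g g g) ≤ 3 * c * R ^ 2 * D := by
  have hR : 0 ≤ R := (apply_nonneg N f).trans hf
  have hD : 0 ≤ D := (apply_nonneg N _).trans hd
  have tri : ∀ {x y z : E} {A₁ A₂ A₃ : ℝ}, N x ≤ A₁ → N y ≤ A₂ → N z ≤ A₃ →
      N (B x y z) ≤ c * A₁ * A₂ * A₃ := by
    intro x y z A₁ A₂ A₃ h1 h2 h3
    have := apply_nonneg N x
    have := apply_nonneg N y
    have := apply_nonneg N z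
    have : 0 ≤ A₁ := by linarith
    have : 0 ≤ A₂ := by linarith
    refine (hbd x y z).trans ?_
    gcongr
  rw [hB.diag_sub]
  have a1 := tri hd hf hf
  have a2 := tri hg hd hf
  have a3 := tri hg hg hd
  refine (map_add_le_add N _ _).trans ?_
  refine (add_le_add_left (map_add_le_add N _ _) _).trans ?_
  nlinarith

/-- A bounded trilinear map is continuous. -/
theorem tendsto (hB : IsTriadditive B) {c : ℝ}
    (hbd : ∀ f g h, ‖B f g h‖ ≤ c * ‖f‖ * ‖g‖ * ‖h‖) {ι : Type*} {l : Filter ι}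
    {f g h : ι → E} {f' g' h' : E} (hf : Tendsto f l (𝓝 f')) (hg : Tendsto g l (𝓝 g'))
    (hh : Tendsto h l (𝓝 h')) :
    Tendsto (fun i => B (f i) (g i) (h i)) l (𝓝 (B f' g' h')) := by
  rw [tendsto_iff_norm_sub_tendsto_zero]
  have hlim : Tendsto (fun i => c * ‖f i - f'‖ * ‖g i‖ * ‖h i‖ + c * ‖f'‖ * ‖g i - g'‖ * ‖h i‖
      + c * ‖f'‖ * ‖g'‖ * ‖h i - h'‖) l
      (𝓝 (c * 0 * ‖g'‖ * ‖h'‖ + c * ‖f'‖ * 0 * ‖h'‖ + c * ‖f'‖ * ‖g'‖ * 0)) := by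
    rw [tendsto_iff_norm_sub_tendsto_zero] at hf hg hh
    have hg' := (tendsto_iff_norm_sub_tendsto_zero.2 hg).norm
    have hh' := (tendsto_iff_norm_sub_tendsto_zero.2 hh).norm
    exact ((((hf.const_mul c).mul hg').mul hh').add ((hg.const_mul _).mul hh')).add
      (hh.const_mul _)
  simp only [mul_zero, zero_mul, add_zero] at hlim
  refine squeeze_zero (fun _ => norm_nonneg _) (fun i => ?_) hlim
  rw [hB.sub_eq]
  exact (norm_add_le _ _).trans (add_le_add ((norm_add_le _ _).trans
    (add_le_add (hbd _ _ _) (hbd _ _ _))) (hbd _ _ _))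

end IsTriadditive

variable [NormedSpace ℝ E]

/-- A family `X_{st}` of trilinear maps, additive in time, which is of size `C |t - s|^γ` on `[0,T]`
with respect to the seminorm `N`. -/
structure IsYoungFamily (X : ℝ → ℝ → E → E → E → E) (N : Seminorm ℝ E) (γ C T : ℝ) : Prop where
  triadditive : ∀ s t, IsTriadditive (X s t)
  add_time : ∀ s u t, 0 ≤ s → s ≤ u → u ≤ t → t ≤ T → ∀ f g h,
    X s u f g h + X u t f g h = X s t f g h
  bound : ∀ s t, 0 ≤ s → s ≤ t → t ≤ T → ∀ f g h,
    N (X s t f g h) ≤ C * (t - s) ^ γ * N f * N g * N h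

/-- `v` is bounded by `R` and `1/2`-Hölder with constant `R` on `[a, b]`, with respect to `N`. -/
structure HolderBound (N : Seminorm ℝ E) (a b R : ℝ) (v : ℝ → E) : Prop where
  sup : ∀ t, a ≤ t → t ≤ b → N (v t) ≤ R
  holder : ∀ s t, a ≤ s → s ≤ t → t ≤ b → N (v t - v s) ≤ R * (t - s) ^ (1 / 2 : ℝ)

theorem HolderBound.mono {N : Seminorm ℝ E} {a b a' b' R R' : ℝ} {v : ℝ → E}
    (h : HolderBound N a b R v) (ha : a ≤ a') (hb : b' ≤ b) (hR : R ≤ R') :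
    HolderBound N a' b' R' v where
  sup t h1 h2 := (h.sup t (ha.trans h1) (h2.trans hb)).trans hR
  holder s t h1 h2 h3 := (h.holder s t (ha.trans h1) h2 (h3.trans hb)).trans
    (mul_le_mul_of_nonneg_right hR (Real.rpow_nonneg (by linarith) _))

/-- Stability of the nonlinear Young integral in its integrand. -/
theorem IsYoungFamily.sewing_sub_le {X : ℝ → ℝ → E → E → E → E} {N : Seminorm ℝ E}
    {γ C T : ℝ} (hX : IsYoungFamily X N γ C T) (hγ : 1 / 2 < γ) (hC : 0 ≤ C)
    {κ : ℝ} (hN : ∀ x, N x ≤ κ * ‖x‖) {a b R D : ℝ} (ha : 0 ≤ a) (hb : b ≤ T)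
    (hD : 0 ≤ D) (hκ : 0 ≤ κ)
    {v u x y : ℝ → E} (hv : HolderBound N a b R v) (hu : HolderBound N a b R u)
    (hd : HolderBound N a b D (v - u))
    (hx : HasYoungIncrements X γ a b v x) (hy : HasYoungIncrements X γ a b u y)
    {s t : ℝ} (hs : a ≤ s) (hst : s ≤ t) (ht : t ≤ b) :
    N ((x t - x s - X s t (v s) (v s) (v s)) - (y t - y s - X s t (u s) (u s) (u s))) ≤
      sewingConst (γ + 1 / 2) * (9 * C * R ^ 2 * D) * (t - s) ^ (γ + 1 / 2) := by
  obtain ⟨K, hK, hx⟩ := hx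
  obtain ⟨K', hK', hy⟩ := hy
  refine sewing_bound (a := a) (b := b) (K := κ * (K + K')) (by linarith) (by positivity)
    (r := fun s t => N ((x t - x s - X s t (v s) (v s) (v s)) -
      (y t - y s - X s t (u s) (u s) (u s)))) ?_ ?_ hs hst ht
  · intro s t hs hst ht
    refine (hN _).trans ?_
    rw [mul_assoc]
    refine mul_le_mul_of_nonneg_left ?_ hκ
    refine (norm_sub_le _ _).trans ?_
    linarith [hx s t hs hst ht, hy s t hs hst ht]
  · intro s t hs hst ht
    set m := (s + t) / 2 with hm
    have h1 : s ≤ m := by linarith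
    have h2 : m ≤ t := by linarith
    have ev := hX.add_time s m t (ha.trans hs) h1 h2 (ht.trans hb) (v s) (v s) (v s)
    have eu := hX.add_time s m t (ha.trans hs) h1 h2 (ht.trans hb) (u s) (u s) (u s)
    have e : (x t - x s - X s t (v s) (v s) (v s)) - (y t - y s - X s t (u s) (u s) (u s)) =
        ((x m - x s - X s m (v s) (v s) (v s)) - (y m - y s - X s m (u s) (u s) (u s))) +
        ((x t - x m - X m t (v m) (v m) (v m)) - (y t - y m - X m t (u m) (u m) (u m))) +
        ((X m t (v m) (v m) (v m) - X m t (v s) (v s) (v s)) -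
          (X m t (u m) (u m) (u m) - X m t (u s) (u s) (u s))) := by
      rw [← ev, ← eu]; abel
    have hp : 0 ≤ (t - m) ^ γ := Real.rpow_nonneg (by linarith) _
    have hp' : 0 ≤ (m - s) ^ (1 / 2 : ℝ) := Real.rpow_nonneg (by linarith) _
    have hsec := (hX.triadditive m t).second_difference_le (N := N) (c := C * (t - m) ^ γ)
      (by positivity) (hX.bound m t (by linarith) h2 (by linarith))
      (hv.sup m (by linarith) (by linarith)) (hv.sup s hs (by linarith))
      (hu.sup m (by linarith) (by linarith)) (hu.sup s hs (by linarith))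
      (hd.sup m (by linarith) (by linarith)) (hd.sup s hs (by linarith))
      (hv.holder s m hs h1 (by linarith)) (hu.holder s m hs h1 (by linarith))
      (hd.holder s m hs h1 (by linarith))
    have hpow : (t - m) ^ γ * (m - s) ^ (1 / 2 : ℝ) ≤ (t - s) ^ (γ + 1 / 2) := by
      rw [Real.rpow_add_of_nonneg (by linarith) (by linarith) (by norm_num)]
      exact mul_le_mul (Real.rpow_le_rpow (by linarith) (by linarith) (by linarith))
        (Real.rpow_le_rpow (by linarith) (by linarith) (by norm_num)) hp'
        (Real.rpow_nonneg (by linarith) _)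
    rw [e]
    refine (map_add_le_add N _ _).trans (add_le_add (map_add_le_add N _ _) (hsec.trans ?_))
    calc 9 * (C * (t - m) ^ γ) * R ^ 2 * D * (m - s) ^ (1 / 2 : ℝ)
        = 9 * C * R ^ 2 * D * ((t - m) ^ γ * (m - s) ^ (1 / 2 : ℝ)) := by ring
      _ ≤ _ := mul_le_mul_of_nonneg_left hpow (by positivity)

/-- The constant of the local theory: on intervals of length at most `1`, the increments of the
difference of two Young integrals are at most `youngConst γ C * R² D |t - s|^γ`. -/
noncomputable def youngConst (γ C : ℝ) : ℝ := C * (3 + 9 * sewingConst (γ + 1 / 2))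

theorem youngConst_nonneg {γ C : ℝ} (hγ : 1 / 2 < γ) (hC : 0 ≤ C) : 0 ≤ youngConst γ C := by
  have := sewingConst_pos (θ := γ + 1 / 2) (by linarith)
  unfold youngConst; positivity

/-- The nonlinear Young integral is locally Lipschitz in its integrand, on intervals of length at
most `1`. -/
theorem IsYoungFamily.increment_sub_le {X : ℝ → ℝ → E → E → E → E} {N : Seminorm ℝ E}
    {γ C T : ℝ} (hX : IsYoungFamily X N γ C T) (hγ : 1 / 2 < γ) (hC : 0 ≤ C)
    {κ : ℝ} (hN : ∀ x, N x ≤ κ * ‖x‖) {a b R D : ℝ} (ha : 0 ≤ a) (hb : b ≤ T)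
    (hab : b ≤ a + 1)
    (hD : 0 ≤ D) (hκ : 0 ≤ κ)
    {v u x y : ℝ → E} (hv : HolderBound N a b R v) (hu : HolderBound N a b R u)
    (hd : HolderBound N a b D (v - u))
    (hx : HasYoungIncrements X γ a b v x) (hy : HasYoungIncrements X γ a b u y)
    {s t : ℝ} (hs : a ≤ s) (hst : s ≤ t) (ht : t ≤ b) :
    N ((x - y) t - (x - y) s) ≤ youngConst γ C * R ^ 2 * D * (t - s) ^ γ := by
  have h1 := hX.sewing_sub_le hγ hC hN ha hb hD hκ hv hu hd hx hy hs hst ht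
  have hp : 0 ≤ (t - s) ^ γ := Real.rpow_nonneg (by linarith) _
  have h2 := (hX.triadditive s t).diag_sub_le (N := N) (c := C * (t - s) ^ γ)
      (by positivity) (hX.bound s t (by linarith) hst (by linarith))
      (hv.sup s hs (by linarith)) (hu.sup s hs (by linarith)) (hd.sup s hs (by linarith))
  have h3 : (t - s) ^ (γ + 1 / 2) ≤ (t - s) ^ γ := by
    rcases hst.eq_or_lt with rfl | hlt
    · rw [sub_self, Real.zero_rpow (by linarith), Real.zero_rpow (by linarith)]
    · exact Real.rpow_le_rpow_of_exponent_ge (by linarith) (by linarith) (by linarith)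
  have hc := sewingConst_pos (θ := γ + 1 / 2) (by linarith)
  have e : (x - y) t - (x - y) s = ((x t - x s - X s t (v s) (v s) (v s)) -
      (y t - y s - X s t (u s) (u s) (u s))) +
      (X s t (v s) (v s) (v s) - X s t (u s) (u s) (u s)) := by
    simp only [Pi.sub_apply]; abel
  rw [e]
  refine (map_add_le_add N _ _).trans ((add_le_add h1 h2).trans ?_)
  have h4 : sewingConst (γ + 1 / 2) * (9 * C * R ^ 2 * D) * (t - s) ^ (γ + 1 / 2) ≤
    sewingConst (γ + 1 / 2) * (9 * C * R ^ 2 * D) * (t - s) ^ γ :=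
    mul_le_mul_of_nonneg_left h3 (by positivity)
  unfold youngConst
  nlinarith

end Young

/-! ### Local existence for the Young equation -/

section YoungLocal

variable {E : Type*} [NormedAddCommGroup E] [NormedSpace ℝ E]

/-- On a short interval the nonlinear Young integral contracts the `1/2`-Hölder seminorm of
differences, with factor `1/2`. -/
theorem IsYoungFamily.increment_sub_le_half {X : ℝ → ℝ → E → E → E → E} {N : Seminorm ℝ E}
    {γ C T : ℝ} (hX : IsYoungFamily X N γ C T) (hγ : 1 / 2 < γ) (hC : 0 ≤ C)
    {κ : ℝ} (hN : ∀ x, N x ≤ κ * ‖x‖) {a b R D τ : ℝ} (ha : 0 ≤ a) (hb : b ≤ T)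
    (hab : b ≤ a + τ) (hτ : τ ≤ 1) (hsmall : youngConst γ C * R ^ 2 * τ ^ (γ - 1 / 2) ≤ 1 / 2)
    (hD : 0 ≤ D) (hκ : 0 ≤ κ)
    {v u x y : ℝ → E} (hv : HolderBound N a b R v) (hu : HolderBound N a b R u)
    (hd : HolderBound N a b D (v - u))
    (hx : HasYoungIncrements X γ a b v x) (hy : HasYoungIncrements X γ a b u y)
    {s t : ℝ} (hs : a ≤ s) (hst : s ≤ t) (ht : t ≤ b) :
    N ((x - y) t - (x - y) s) ≤ D / 2 * (t - s) ^ (1 / 2 : ℝ) := by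
  refine (hX.increment_sub_le hγ hC hN ha hb (by linarith) hD hκ hv hu hd hx hy hs hst ht).trans ?_
  have hQ := youngConst_nonneg hγ hC
  have h0 : 0 ≤ (t - s) ^ (1 / 2 : ℝ) := Real.rpow_nonneg (by linarith) _
  have h1 : (t - s) ^ γ ≤ τ ^ (γ - 1 / 2) * (t - s) ^ (1 / 2 : ℝ) := by
    have : (t - s) ^ γ = (t - s) ^ (γ - 1 / 2) * (t - s) ^ (1 / 2 : ℝ) := by
      rw [← Real.rpow_add_of_nonneg (by linarith) (by linarith) (by norm_num)]
      congr 1; ring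
    rw [this]
    exact mul_le_mul_of_nonneg_right
      (Real.rpow_le_rpow (by linarith) (by linarith) (by linarith)) h0
  calc youngConst γ C * R ^ 2 * D * (t - s) ^ γ
      ≤ youngConst γ C * R ^ 2 * D * (τ ^ (γ - 1 / 2) * (t - s) ^ (1 / 2 : ℝ)) :=
        mul_le_mul_of_nonneg_left h1 (by positivity)
    _ = (youngConst γ C * R ^ 2 * τ ^ (γ - 1 / 2)) * (D * (t - s) ^ (1 / 2 : ℝ)) := by ring
    _ ≤ 1 / 2 * (D * (t - s) ^ (1 / 2 : ℝ)) :=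
        mul_le_mul_of_nonneg_right hsmall (by positivity)
    _ = _ := by ring

theorem IsYoungFamily.hasYoungIncrements_zero {X : ℝ → ℝ → E → E → E → E} {N : Seminorm ℝ E}
    {γ C T : ℝ} (hX : IsYoungFamily X N γ C T) (a b : ℝ) :
    HasYoungIncrements X γ a b 0 0 :=
  ⟨0, le_rfl, fun s t _ _ _ => by simp [(hX.triadditive s t).diag_zero]⟩

theorem HolderBound.zero {N : Seminorm ℝ E} {a b R : ℝ} (hR : 0 ≤ R) :
    HolderBound N a b R 0 where
  sup t _ _ := by simpa using hR
  holder s t _ h _ := by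
    have : 0 ≤ (t - s) ^ (1 / 2 : ℝ) := Real.rpow_nonneg (by linarith) _
    simpa using by positivity

theorem HolderBound.nonneg {N : Seminorm ℝ E} {a b R : ℝ} {v : ℝ → E}
    (h : HolderBound N a b R v) (hab : a ≤ b) : 0 ≤ R :=
  (apply_nonneg N _).trans (h.sup a le_rfl hab)

theorem HolderBound.sub {N : Seminorm ℝ E} {a b R R' : ℝ} {v u : ℝ → E}
    (hv : HolderBound N a b R v) (hu : HolderBound N a b R' u) :
    HolderBound N a b (R + R') (v - u) where
  sup t h1 h2 := (map_sub_le_add N _ _).trans (add_le_add (hv.sup t h1 h2) (hu.sup t h1 h2))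
  holder s t h1 h2 h3 := by
    have e : (v - u) t - (v - u) s = (v t - v s) - (u t - u s) := by
      simp only [Pi.sub_apply]; abel
    rw [e, add_mul]
    exact (map_sub_le_add N _ _).trans
      (add_le_add (hv.holder s t h1 h2 h3) (hu.holder s t h1 h2 h3))

/-- A path whose increments are Hölder and which is small at the left end point is small. -/
theorem HolderBound.of_increments {N : Seminorm ℝ E} {a b A H R : ℝ} {v : ℝ → E} (hab : b ≤ a + 1)
    (hH : 0 ≤ H) (ha : N (v a) ≤ A) (hR : A + H ≤ R)
    (h : ∀ s t, a ≤ s → s ≤ t → t ≤ b → N (v t - v s) ≤ H * (t - s) ^ (1 / 2 : ℝ)) :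
    HolderBound N a b R v where
  sup t h1 h2 := by
    have e : v t = v a + (v t - v a) := by abel
    have e2 : (t - a) ^ (1 / 2 : ℝ) ≤ 1 :=
      Real.rpow_le_one (by linarith) (by linarith) (by norm_num)
    rw [e]
    have := h a t le_rfl h1 h2
    refine (map_add_le_add N _ _).trans ?_
    nlinarith
  holder s t h1 h2 h3 := (h s t h1 h2 h3).trans
    (mul_le_mul_of_nonneg_right (by linarith [apply_nonneg N (v a)])
      (Real.rpow_nonneg (by linarith) _))

/-- Local existence for the Young equation by Picard iteration. The seminorm `N` is equivalent to
the norm of `E`, but only the constant of `X` with respect to `N` enters the length of the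
interval. -/
theorem IsYoungFamily.exists_local_solution [CompleteSpace E] {X : ℝ → ℝ → E → E → E → E}
    {N : Seminorm ℝ E} {γ C T : ℝ} (hX : IsYoungFamily X N γ C T) (hγ : 1 / 2 < γ) (hC : 0 ≤ C)
    {κ κ' : ℝ} (hκ : 0 ≤ κ) (hκ' : 0 ≤ κ') (hN : ∀ x, N x ≤ κ * ‖x‖) (hN' : ∀ x, ‖x‖ ≤ κ' * N x)
    {a b R τ : ℝ} (ha : 0 ≤ a) (hle : a ≤ b) (hb : b ≤ T)
    (hab : b ≤ a + τ) (hτ : τ ≤ 1)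
    (hsmall : youngConst γ C * (2 * R) ^ 2 * τ ^ (γ - 1 / 2) ≤ 1 / 2)
    (hint : ∀ v R', HolderBound N a b R' v → ∃ x, HasYoungIncrements X γ a b v x)
    {φ : E} (hφ : N φ ≤ R) :
    ∃ v, v a = φ ∧ HasYoungIncrements X γ a b v v ∧ HolderBound N a b (2 * R) v := by
  have hR : 0 ≤ R := (apply_nonneg N φ).trans hφ
  -- one Picard step
  have step : ∀ v : {v : ℝ → E // v a = φ ∧ HolderBound N a b (2 * R) v},
      ∃ x : {v : ℝ → E // v a = φ ∧ HolderBound N a b (2 * R) v},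
        HasYoungIncrements X γ a b v.1 x.1 := by
    rintro ⟨v, hva, hv⟩
    obtain ⟨x, hx⟩ := hint v _ hv
    have hy : HasYoungIncrements X γ a b v (fun t => φ + (x t - x a)) := by
      obtain ⟨K, hK, h⟩ := hx
      refine ⟨K, hK, fun s t h1 h2 h3 => ?_⟩
      have e : φ + (x t - x a) - (φ + (x s - x a)) = x t - x s := by abel
      rw [e]; exact h s t h1 h2 h3
    refine ⟨⟨_, by simp, ?_⟩, hy⟩
    refine HolderBound.of_increments (A := R) (H := R) (by linarith) hR (by simpa using hφ)
      (by linarith) fun s t h1 h2 h3 => ?_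
    have := hX.increment_sub_le_half (D := 2 * R) hγ hC hN ha hb hab hτ hsmall (by positivity) hκ hv
      (HolderBound.zero (by positivity)) (by rw [sub_zero]; exact hv) hy
      (hX.hasYoungIncrements_zero a b) h1 h2 h3
    simpa using this
  choose Γ hΓ using step
  have h0 : HolderBound N a b (2 * R) (fun _ => φ) :=
    HolderBound.of_increments (A := R) (H := R) (by linarith) hR hφ (by linarith)
      (fun s t _ h2 _ => by
        have : 0 ≤ (t - s) ^ (1 / 2 : ℝ) := Real.rpow_nonneg (by linarith) _
        simp; positivity)
  let V : ℕ → {v : ℝ → E // v a = φ ∧ HolderBound N a b (2 * R) v} :=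
    fun n => Γ^[n] ⟨fun _ => φ, rfl, h0⟩
  have hV : ∀ n, HasYoungIncrements X γ a b (V n).1 (V (n + 1)).1 := by
    intro n
    simp only [V, Function.iterate_succ_apply']
    exact hΓ _
  have hdiff : ∀ n, HolderBound N a b (4 * R * (1 / 2) ^ n) ((V (n + 1)).1 - (V n).1) := by
    intro n
    induction n with
    | zero => exact ((V 1).2.2.sub (V 0).2.2).mono le_rfl le_rfl (by linarith)
    | succ n ih =>
      refine HolderBound.of_increments (A := 0) (H := 4 * R * (1 / 2) ^ n / 2) (by linarith)
        (by positivity) (by simp [(V (n + 1)).2.1, (V (n + 2)).2.1]) (by rw [pow_succ]; linarith)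
        fun s t h1 h2 h3 => ?_
      exact hX.increment_sub_le_half hγ hC hN ha hb hab hτ hsmall (by positivity) hκ
        (V (n + 1)).2.2 (V n).2.2 ih (hV _) (hV _) h1 h2 h3
  have hlim : ∀ t, t ∈ Icc a b → ∃ l, Tendsto (fun n => (V n).1 t) atTop (𝓝 l) := by
    intro t ht
    refine cauchySeq_tendsto_of_complete (cauchySeq_of_le_geometric (1 / 2) (κ' * (4 * R))
      (by norm_num) fun n => ?_)
    rw [dist_eq_norm, norm_sub_rev, mul_assoc]
    exact (hN' _).trans (mul_le_mul_of_nonneg_left ((hdiff n).sup t ht.1 ht.2) hκ')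
  choose! w hw using hlim
  have hNc : Continuous N := by
    refine Seminorm.continuous_of_le (q := κ.toNNReal • normSeminorm ℝ E) ?_ ?_
    · exact (continuous_const.mul continuous_norm)
    · intro x
      simpa [NNReal.smul_def, hκ] using hN x
  refine ⟨w, ?_, ?_, ?_, ?_⟩
  · refine tendsto_nhds_unique (hw a ⟨le_rfl, hle⟩) ?_
    simp only [(V _).2.1]; exact tendsto_const_nhds
  · refine ⟨κ' * (sewingConst (γ + 1 / 2) * (9 * C * (2 * R) ^ 2 * (2 * R))), ?_,
      fun s t h1 h2 h3 => ?_⟩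
    · have := sewingConst_pos (θ := γ + 1 / 2) (by linarith)
      positivity
    · have l1 := hw t ⟨h1.trans h2, h3⟩
      have l2 := hw s ⟨h1, h2.trans h3⟩
      have hp : 0 ≤ (t - s) ^ γ := Real.rpow_nonneg (by linarith) _
      have l3 : Tendsto (fun n => X s t ((V n).1 s) ((V n).1 s) ((V n).1 s)) atTop
          (𝓝 (X s t (w s) (w s) (w s))) := by
        refine (hX.triadditive s t).tendsto (c := κ' * (C * (t - s) ^ γ * κ * κ * κ)) ?_ l2 l2 l2
        intro f g h
        refine (hN' _).trans ?_
        have := hX.bound s t (by linarith) h2 (by linarith) f g h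
        have h4 : C * (t - s) ^ γ * N f * N g * N h ≤
            C * (t - s) ^ γ * (κ * ‖f‖) * (κ * ‖g‖) * (κ * ‖h‖) := by
          gcongr <;> apply hN
        calc κ' * N (X s t f g h) ≤ κ' * (C * (t - s) ^ γ * (κ * ‖f‖) * (κ * ‖g‖) * (κ * ‖h‖)) :=
              mul_le_mul_of_nonneg_left (this.trans h4) hκ'
          _ = _ := by ring
      have l4 := ((((tendsto_add_atTop_iff_nat 1).2 l1).sub
        ((tendsto_add_atTop_iff_nat 1).2 l2)).sub l3).norm
      refine le_of_tendsto' l4 fun n => (hN' _).trans ?_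
      have := hX.sewing_sub_le hγ hC hN ha hb (by positivity : 0 ≤ 2 * R) hκ (V n).2.2
        (HolderBound.zero (by positivity)) (by rw [sub_zero]; exact (V n).2.2) (hV n)
        (hX.hasYoungIncrements_zero a b) h1 h2 h3
      simp only [Pi.zero_apply, (hX.triadditive s t).diag_zero, sub_zero] at this
      rw [mul_assoc]
      exact mul_le_mul_of_nonneg_left this hκ'
  · intro t h1 h2
    exact le_of_tendsto' ((hNc.tendsto _).comp (hw t ⟨h1, h2⟩)) fun n => (V n).2.2.sup t h1 h2
  · intro s t h1 h2 h3
    exact le_of_tendsto' ((hNc.tendsto _).comp ((hw t ⟨h1.trans h2, h3⟩).sub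
      (hw s ⟨h1, h2.trans h3⟩))) fun n => (V n).2.2.holder s t h1 h2 h3

end YoungLocal

/-! ### Lipschitz dependence and global existence -/

section YoungGlobal

variable {E : Type*} [NormedAddCommGroup E]

theorem HasYoungIncrements.congr {X : ℝ → ℝ → E → E → E → E} {γ a b : ℝ} {v x v' x' : ℝ → E}
    (h : HasYoungIncrements X γ a b v x) (hv : EqOn v v' (Icc a b)) (hx : EqOn x x' (Icc a b)) :
    HasYoungIncrements X γ a b v' x' := by
  obtain ⟨K, hK, h⟩ := h
  refine ⟨K, hK, fun s t h1 h2 h3 => ?_⟩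
  rw [← hv ⟨h1, h2.trans h3⟩, ← hx ⟨h1, h2.trans h3⟩, ← hx ⟨h1.trans h2, h3⟩]
  exact h s t h1 h2 h3

variable [NormedSpace ℝ E]

/-- An interval `[0, T]` can be cut into equal pieces so short that the local theory applies. -/
theorem exists_step_size {γ : ℝ} (hγ : 1 / 2 < γ) (Q T : ℝ) :
    ∃ n : ℕ, 0 < n ∧ T / n ≤ 1 ∧ Q * (T / n) ^ (γ - 1 / 2) ≤ 1 / 2 := by
  have h1 : Tendsto (fun n : ℕ => T / n) atTop (𝓝 0) := tendsto_const_div_atTop_nhds_zero_nat T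
  have h2 : Tendsto (fun n : ℕ => Q * (T / n) ^ (γ - 1 / 2)) atTop (𝓝 0) := by
    have := (h1.rpow_const (p := γ - 1 / 2) (Or.inr (by linarith))).const_mul Q
    rwa [Real.zero_rpow (by linarith), mul_zero] at this
  have e := (eventually_gt_atTop 0).and ((h1.eventually (ge_mem_nhds (zero_lt_one' ℝ))).and
    (h2.eventually (ge_mem_nhds (by norm_num : (0 : ℝ) < 1 / 2))))
  obtain ⟨n, h⟩ := e.exists
  exact ⟨n, h.1, h.2.1, h.2.2⟩

theorem HolderBound.glue {N : Seminorm ℝ E} {a b c R R' : ℝ} {v : ℝ → E} (hab : a ≤ b)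
    (hbc : b ≤ c) (h : HolderBound N a b R v) (h' : HolderBound N b c R' v) :
    HolderBound N a c (R + R') v where
  sup t h1 h2 := by
    rcases le_total t b with hb | hb
    · linarith [h.sup t h1 hb, h'.nonneg hbc]
    · linarith [h'.sup t hb h2, h.nonneg hab]
  holder s t h1 h2 h3 := by
    have hR := h.nonneg hab
    have hR' := h'.nonneg hbc
    have hp : 0 ≤ (t - s) ^ (1 / 2 : ℝ) := Real.rpow_nonneg (by linarith) _
    rcases le_total t b with hb | hb
    · have := h.holder s t h1 h2 hb
      nlinarith
    · rcases le_total b s with hs | hs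
      · have := h'.holder s t hs h2 h3
        nlinarith
      · have e : v t - v s = (v b - v s) + (v t - v b) := by abel
        rw [e, add_mul]
        refine (map_add_le_add N _ _).trans (add_le_add ?_ ?_)
        · exact (h.holder s b h1 hs le_rfl).trans (mul_le_mul_of_nonneg_left
            (Real.rpow_le_rpow (by linarith) (by linarith) (by norm_num)) hR)
        · exact (h'.holder b t le_rfl hb h3).trans (mul_le_mul_of_nonneg_left
            (Real.rpow_le_rpow (by linarith) (by linarith) (by norm_num)) hR')

theorem HolderBound.congr {N : Seminorm ℝ E} {a b R : ℝ} {v u : ℝ → E}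
    (h : HolderBound N a b R v) (huv : EqOn v u (Icc a b)) : HolderBound N a b R u where
  sup t h1 h2 := huv ⟨h1, h2⟩ ▸ h.sup t h1 h2
  holder s t h1 h2 h3 := huv ⟨h1, h2.trans h3⟩ ▸ huv ⟨h1.trans h2, h3⟩ ▸ h.holder s t h1 h2 h3

/-- Solutions of the Young equation on adjacent intervals fit together to a solution. -/
theorem HasYoungIncrements.glue {X : ℝ → ℝ → E → E → E → E} {γ C T : ℝ}
    (hX : IsYoungFamily X (normSeminorm ℝ E) γ C T) (hγ : 1 / 2 < γ) (hC : 0 ≤ C) {a b c R : ℝ}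
    (ha : 0 ≤ a) (hab : a ≤ b) (hc : c ≤ T) {v : ℝ → E}
    (h : HasYoungIncrements X γ a b v v) (h' : HasYoungIncrements X γ b c v v)
    (hv : HolderBound (normSeminorm ℝ E) a b R v) : HasYoungIncrements X γ a c v v := by
  obtain ⟨K, hK, h⟩ := h
  obtain ⟨K', hK', h'⟩ := h'
  have hR := hv.nonneg hab
  refine ⟨K + K' + 3 * C * R ^ 2 * R, by positivity, fun s t h1 h2 h3 => ?_⟩
  have hp : 0 ≤ (t - s) ^ (γ + 1 / 2) := Real.rpow_nonneg (by linarith) _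
  have hA : 0 ≤ 3 * C * R ^ 2 * R * (t - s) ^ (γ + 1 / 2) := by positivity
  have hB : 0 ≤ K * (t - s) ^ (γ + 1 / 2) := by positivity
  have hB' : 0 ≤ K' * (t - s) ^ (γ + 1 / 2) := by positivity
  rw [add_mul, add_mul]
  rcases le_total t b with hb | hb
  · have := h s t h1 h2 hb
    linarith
  · rcases le_total b s with hs | hs
    · have := h' s t hs h2 h3
      linarith
    · have ev := hX.add_time s b t (ha.trans h1) hs hb (h3.trans hc) (v s) (v s) (v s)
      have e : v t - v s - X s t (v s) (v s) (v s) = (v b - v s - X s b (v s) (v s) (v s)) +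
          (v t - v b - X b t (v b) (v b) (v b)) +
          (X b t (v b) (v b) (v b) - X b t (v s) (v s) (v s)) := by
        rw [← ev]; abel
      have hq : 0 ≤ (t - b) ^ γ := Real.rpow_nonneg (by linarith) _
      have h4 := (hX.triadditive b t).diag_sub_le (c := C * (t - b) ^ γ) (by positivity)
        (hX.bound b t (by linarith) hb (by linarith)) (hv.sup b hab le_rfl) (hv.sup s h1 hs)
        (hv.holder s b h1 hs le_rfl)
      have hpow : (t - b) ^ γ * (b - s) ^ (1 / 2 : ℝ) ≤ (t - s) ^ (γ + 1 / 2) := by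
        rw [Real.rpow_add_of_nonneg (by linarith) (by linarith) (by norm_num)]
        exact mul_le_mul (Real.rpow_le_rpow (by linarith) (by linarith) (by linarith))
          (Real.rpow_le_rpow (by linarith) (by linarith) (by norm_num))
          (Real.rpow_nonneg (by linarith) _) (Real.rpow_nonneg (by linarith) _)
      rw [e]
      refine (norm_add_le _ _).trans (add_le_add ((norm_add_le _ _).trans (add_le_add ?_ ?_)) ?_)
      · exact (h s b h1 hs le_rfl).trans (mul_le_mul_of_nonneg_left
          (Real.rpow_le_rpow (by linarith) (by linarith) (by linarith)) hK)
      · exact (h' b t le_rfl hb h3).trans (mul_le_mul_of_nonneg_left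
          (Real.rpow_le_rpow (by linarith) (by linarith) (by linarith)) hK')
      · refine le_trans h4 ?_
        calc 3 * (C * (t - b) ^ γ) * R ^ 2 * (R * (b - s) ^ (1 / 2 : ℝ))
            = 3 * C * R ^ 2 * R * ((t - b) ^ γ * (b - s) ^ (1 / 2 : ℝ)) := by ring
          _ ≤ _ := mul_le_mul_of_nonneg_left hpow (by positivity)

/-- Solutions of the Young equation depend on the initial value in a Lipschitz way, for the
`1/2`-Hölder norm, as long as they stay in a bounded set. In particular they are unique. -/
theorem IsYoungFamily.exists_lipschitz {X : ℝ → ℝ → E → E → E → E} {γ C T : ℝ}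
    (hX : IsYoungFamily X (normSeminorm ℝ E) γ C T) (hγ : 1 / 2 < γ) (hC : 0 ≤ C) (hT : 0 ≤ T)
    (R : ℝ) :
    ∃ K : ℝ, 0 ≤ K ∧ ∀ v u, HasYoungIncrements X γ 0 T v v → HasYoungIncrements X γ 0 T u u →
      HolderBound (normSeminorm ℝ E) 0 T R v → HolderBound (normSeminorm ℝ E) 0 T R u →
      HolderBound (normSeminorm ℝ E) 0 T (K * ‖v 0 - u 0‖) (v - u) := by
  obtain ⟨n, hn, hn1, hn2⟩ := exists_step_size hγ (youngConst γ C * R ^ 2) T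
  refine ⟨3 ^ n, by positivity, fun v u hvv huu hv hu => ?_⟩
  have hR := hv.nonneg hT
  set τ := T / n with hτ
  have hn' : (n : ℝ) ≠ 0 := by positivity
  have hτ0 : 0 ≤ τ := by positivity
  have hτT : n * τ = T := by rw [hτ]; field_simp
  have key : ∀ k : ℕ, k ≤ n →
      HolderBound (normSeminorm ℝ E) 0 (k * τ) (3 ^ k * ‖v 0 - u 0‖) (v - u) := by
    intro k
    induction k with
    | zero =>
      intro _
      refine HolderBound.of_increments (A := ‖v 0 - u 0‖) (H := 0) (by simp) le_rfl le_rfl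
        (by simp) fun s t h1 h2 h3 => ?_
      simp only [Nat.cast_zero, zero_mul] at h3
      have h4 : t = 0 := by linarith
      have h5 : s = 0 := by linarith
      simp [h4, h5]
    | succ k ih =>
      intro hk
      have ih := ih (by omega)
      have hk' : ((k + 1 : ℕ) : ℝ) * τ ≤ T := by
        rw [← hτT]
        exact mul_le_mul_of_nonneg_right (by exact_mod_cast hk) hτ0
      push_cast at hk' ⊢
      have ha : 0 ≤ k * τ := by positivity
      set δ := 3 ^ k * ‖v 0 - u 0‖ with hδ
      have hδ0 : 0 ≤ δ := by positivity
      have hv' := hv.mono ha hk' le_rfl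
      have hu' := hu.mono ha hk' le_rfl
      have hd0 : ‖(v - u) (k * τ)‖ ≤ δ := ih.sup _ ha le_rfl
      -- each application of the contraction estimate halves the distance to the bound `2 * δ`
      have hit : ∀ m : ℕ, HolderBound (normSeminorm ℝ E) (k * τ) ((k + 1) * τ)
          (2 * δ + 2 * R * (1 / 2) ^ m) (v - u) := by
        intro m
        induction m with
        | zero => exact (hv'.sub hu').mono le_rfl le_rfl (by simp; linarith)
        | succ m ihm =>
          refine HolderBound.of_increments (A := δ) (H := (2 * δ + 2 * R * (1 / 2) ^ m) / 2)
            (by linarith) (by positivity) hd0 (by rw [pow_succ]; linarith)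
            fun s t h1 h2 h3 => ?_
          exact hX.increment_sub_le_half (κ := 1) hγ hC (by simp) ha hk' (by linarith) hn1 hn2
            (by positivity) zero_le_one hv' hu' ihm (hvv.mono ha hk') (huu.mono ha hk') h1 h2 h3
      have hl : Tendsto (fun m : ℕ => 2 * δ + 2 * R * (1 / 2) ^ m) atTop (𝓝 (2 * δ)) := by
        have := ((tendsto_pow_atTop_nhds_zero_of_lt_one (r := (1 / 2 : ℝ)) (by norm_num)
          (by norm_num)).const_mul (2 * R)).const_add (2 * δ)
        simpa using this
      have hfin : HolderBound (normSeminorm ℝ E) (k * τ) ((k + 1) * τ) (2 * δ) (v - u) :=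
        ⟨fun t h1 h2 => ge_of_tendsto' hl fun m => (hit m).sup t h1 h2,
          fun s t h1 h2 h3 => ge_of_tendsto' (hl.mul_const _) fun m => (hit m).holder s t h1 h2 h3⟩
      refine (ih.glue ha (by linarith) hfin).mono le_rfl le_rfl ?_
      rw [hδ, pow_succ]; linarith
  have := key n le_rfl
  rwa [hτT] at this

/-- A Young family obeying tame estimates: it is bounded for the weaker seminorm `p`, and for the
norm of `E` it is linear in the norm, with coefficients depending on `p` only. -/
structure IsTameYoungFamily (X : ℝ → ℝ → E → E → E → E) (p : Seminorm ℝ E) (γ C T : ℝ) :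
    Prop where
  triadditive : ∀ s t, IsTriadditive (X s t)
  add_time : ∀ s u t, 0 ≤ s → s ≤ u → u ≤ t → t ≤ T → ∀ f g h,
    X s u f g h + X u t f g h = X s t f g h
  p_le : ∀ f, p f ≤ ‖f‖
  bound_p : ∀ s t, 0 ≤ s → s ≤ t → t ≤ T → ∀ f g h,
    p (X s t f g h) ≤ C * (t - s) ^ γ * (p f * p g * p h)
  bound : ∀ s t, 0 ≤ s → s ≤ t → t ≤ T → ∀ f g h,
    ‖X s t f g h‖ ≤ C * (t - s) ^ γ *
      (‖f‖ * p g * p h + p f * ‖g‖ * p h + p f * p g * ‖h‖)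

/-- For the equivalent norms `p + ε ‖·‖` the constant of a tame family does not depend on `ε`. -/
theorem IsTameYoungFamily.isYoungFamily_add {X : ℝ → ℝ → E → E → E → E} {p : Seminorm ℝ E}
    {γ C T : ℝ} (hX : IsTameYoungFamily X p γ C T) (hC : 0 ≤ C) (ε : NNReal) :
    IsYoungFamily X (p + ε • normSeminorm ℝ E) γ C T where
  triadditive := hX.triadditive
  add_time := hX.add_time
  bound s t h1 h2 h3 f g h := by
    have e1 := hX.bound_p s t h1 h2 h3 f g h
    have e2 := mul_le_mul_of_nonneg_left (hX.bound s t h1 h2 h3 f g h) ε.coe_nonneg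
    have hp : 0 ≤ (t - s) ^ γ := Real.rpow_nonneg (by linarith) _
    have hf := apply_nonneg p f
    have hg := apply_nonneg p g
    have hh := apply_nonneg p h
    have hε := ε.coe_nonneg
    simp only [add_apply, smul_apply, coe_normSeminorm, NNReal.smul_def,
      smul_eq_mul]
    set A := (ε : ℝ) * ‖f‖ with hA
    set B := (ε : ℝ) * ‖g‖ with hB
    set D := (ε : ℝ) * ‖h‖ with hD
    have hA0 : 0 ≤ A := by positivity
    have hB0 : 0 ≤ B := by positivity
    have hD0 : 0 ≤ D := by positivity
    have e3 : p f * p g * p h + (A * p g * p h + p f * B * p h + p f * p g * D) ≤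
        (p f + A) * (p g + B) * (p h + D) := by
      have : 0 ≤ A * B * p h + A * p g * D + p f * B * D + A * B * D := by positivity
      nlinarith
    calc _ ≤ C * (t - s) ^ γ *
          (p f * p g * p h + (A * p g * p h + p f * B * p h + p f * p g * D)) := by
          rw [mul_add]
          refine add_le_add e1 (e2.trans (le_of_eq ?_))
          rw [hA, hB, hD]; ring
      _ ≤ C * (t - s) ^ γ * ((p f + A) * (p g + B) * (p h + D)) :=
          mul_le_mul_of_nonneg_left e3 (by positivity)
      _ = _ := by ring

/-- The tame bound implies the plain trilinear bound for the norm of `E`. -/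
theorem IsTameYoungFamily.isYoungFamily_norm {X : ℝ → ℝ → E → E → E → E} {p : Seminorm ℝ E}
    {γ C T : ℝ} (hX : IsTameYoungFamily X p γ C T) (hC : 0 ≤ C) :
    IsYoungFamily X (normSeminorm ℝ E) γ (3 * C) T where
  triadditive := hX.triadditive
  add_time := hX.add_time
  bound s t h1 h2 h3 f g h := by
    have hp : 0 ≤ (t - s) ^ γ := Real.rpow_nonneg (by linarith) _
    have hf := apply_nonneg p f
    have hg := apply_nonneg p g
    have hh := apply_nonneg p h
    have hf' := hX.p_le f
    have hg' := hX.p_le g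
    have hh' := hX.p_le h
    refine (hX.bound s t h1 h2 h3 f g h).trans ?_
    simp only [coe_normSeminorm]
    have : ‖f‖ * p g * p h + p f * ‖g‖ * p h + p f * p g * ‖h‖ ≤
        ‖f‖ * ‖g‖ * ‖h‖ + ‖f‖ * ‖g‖ * ‖h‖ + ‖f‖ * ‖g‖ * ‖h‖ := by gcongr
    calc _ ≤ C * (t - s) ^ γ * (‖f‖ * ‖g‖ * ‖h‖ + ‖f‖ * ‖g‖ * ‖h‖ + ‖f‖ * ‖g‖ * ‖h‖) :=
          mul_le_mul_of_nonneg_left this (by positivity)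
      _ = _ := by ring

/-- Global existence for a tame Young equation that conserves `p`. Measured in `p + ε ‖·‖` with
`ε` so small that the second term is at most `1`, the data at every step have size at most `R + 1`,
so that all steps have the same length. -/
theorem IsTameYoungFamily.exists_solution [CompleteSpace E] {X : ℝ → ℝ → E → E → E → E}
    {p : Seminorm ℝ E} {γ C T : ℝ} (hX : IsTameYoungFamily X p γ C T) (hγ : 1 / 2 < γ)
    (hC : 0 ≤ C) (hT : 0 ≤ T)
    (hint : ∀ a b v R, 0 ≤ a → a ≤ b → b ≤ T → HolderBound (normSeminorm ℝ E) a b R v →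
      ∃ x, HasYoungIncrements X γ a b v x)
    (hcons : ∀ b v R, 0 ≤ b → b ≤ T → HolderBound (normSeminorm ℝ E) 0 b R v →
      HasYoungIncrements X γ 0 b v v → p (v b) = p (v 0))
    {R : ℝ} (hR : 0 ≤ R) :
    ∃ R' : ℝ, ∀ φ : E, ‖φ‖ ≤ R → ∃ v, v 0 = φ ∧ HasYoungIncrements X γ 0 T v v ∧
      HolderBound (normSeminorm ℝ E) 0 T R' v := by
  obtain ⟨n, hn, hn1, hn2⟩ := exists_step_size hγ (youngConst γ C * (2 * (R + 1)) ^ 2) T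
  set τ := T / n with hτ
  have hn' : (n : ℝ) ≠ 0 := by positivity
  have hτ0 : 0 ≤ τ := by positivity
  have hτT : n * τ = T := by rw [hτ]; field_simp
  have key : ∀ k : ℕ, k ≤ n → ∃ R' : ℝ, ∀ φ : E, ‖φ‖ ≤ R → ∃ v, v 0 = φ ∧
      HasYoungIncrements X γ 0 (k * τ) v v ∧
      HolderBound (normSeminorm ℝ E) 0 (k * τ) R' v := by
    intro k
    induction k with
    | zero =>
      intro _
      refine ⟨R, fun φ hφ => ⟨fun _ => φ, rfl, ⟨0, le_rfl, fun s t h1 h2 h3 => ?_⟩, ?_⟩⟩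
      · simp only [Nat.cast_zero, zero_mul] at h3
        have h4 : t = 0 := by linarith
        have h5 : s = 0 := by linarith
        have := hX.add_time 0 0 0 le_rfl le_rfl le_rfl hT φ φ φ
        have h6 : X 0 0 φ φ φ = 0 := by simpa using this
        simp [h4, h5, h6]
      · exact HolderBound.of_increments (A := R) (H := 0) (by simp) le_rfl hφ (by simp)
          (fun _ _ _ _ _ => by simp)
    | succ k ih =>
      intro hk
      obtain ⟨M, ih⟩ := ih (by omega)
      have hk' : ((k + 1 : ℕ) : ℝ) * τ ≤ T := by
        rw [← hτT]
        exact mul_le_mul_of_nonneg_right (by exact_mod_cast hk) hτ0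
      push_cast at hk' ⊢
      have ha : 0 ≤ k * τ := by positivity
      have hM : 0 ≤ M := by
        obtain ⟨v, -, -, hv⟩ := ih 0 (by simpa using hR)
        exact hv.nonneg ha
      -- `M` bounds the norm on the interval already covered, so `ε * M ≤ 1`
      let ε : NNReal := ⟨(1 + M)⁻¹, by positivity⟩
      have hεM : (ε : ℝ) * (1 + M) = 1 := inv_mul_cancel₀ (by positivity)
      have hε0 : 0 ≤ (ε : ℝ) := ε.coe_nonneg
      have hε1 : (ε : ℝ) * M ≤ 1 := by linarith
      have hNapp : ∀ x, (p + ε • normSeminorm ℝ E) x = p x + ε * ‖x‖ := fun x => by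
        simp [NNReal.smul_def]
      have hlow : ∀ x, ‖x‖ ≤ (1 + M) * (p + ε • normSeminorm ℝ E) x := by
        intro x
        rw [hNapp]
        have := apply_nonneg p x
        have h1 : (1 + M) * (p x + ε * ‖x‖) = (1 + M) * p x + (ε * (1 + M)) * ‖x‖ := by ring
        rw [h1, hεM, one_mul]
        nlinarith
      have hup : ∀ x, (p + ε • normSeminorm ℝ E) x ≤ (1 + ε) * ‖x‖ := by
        intro x
        rw [hNapp]
        linarith [hX.p_le x]
      refine ⟨M + (1 + M) * (2 * (R + 1)), fun φ hφ => ?_⟩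
      obtain ⟨v, hv0, hvv, hv⟩ := ih φ hφ
      have hpv : p (v (k * τ)) ≤ R := by
        rw [hcons _ v M ha (by linarith) hv hvv, hv0]
        exact (hX.p_le _).trans hφ
      have hNv : (p + ε • normSeminorm ℝ E) (v (k * τ)) ≤ R + 1 := by
        rw [hNapp]
        have := hv.sup (k * τ) ha le_rfl
        simp only [coe_normSeminorm] at this
        nlinarith
      obtain ⟨u, hu0, huu, hu⟩ := (hX.isYoungFamily_add hC ε).exists_local_solution hγ hC
        (by positivity) (by positivity) hup hlow ha (by linarith : k * τ ≤ (k + 1) * τ)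
        hk' (by linarith) hn1 hn2
        (fun w R' hw => hint _ _ w ((1 + M) * R') ha (by linarith) hk'
          ⟨fun t h1 h2 => (hlow _).trans
            (mul_le_mul_of_nonneg_left (hw.sup t h1 h2) (by positivity)),
          fun s t h1 h2 h3 => (hlow _).trans (by
            rw [mul_assoc]
            exact mul_le_mul_of_nonneg_left (hw.holder s t h1 h2 h3) (by positivity))⟩) hNv
      have hu' : HolderBound (normSeminorm ℝ E) (k * τ) ((k + 1) * τ) ((1 + M) * (2 * (R + 1))) u :=
        ⟨fun t h1 h2 => (hlow _).trans
            (mul_le_mul_of_nonneg_left (hu.sup t h1 h2) (by positivity)),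
          fun s t h1 h2 h3 => (hlow _).trans (by
            rw [mul_assoc]
            exact mul_le_mul_of_nonneg_left (hu.holder s t h1 h2 h3) (by positivity))⟩
      let w : ℝ → E := fun t => if t ≤ k * τ then v t else u t
      have hwv : EqOn v w (Icc 0 (k * τ)) := fun t ht => by simp [w, ht.2]
      have hwu : EqOn u w (Icc (k * τ) ((k + 1) * τ)) := fun t ht => by
        rcases ht.1.eq_or_lt with h | h
        · simp [w, ← h, hu0]
        · simp [w, not_le.2 h]
      have hwb := hv.congr hwv
      refine ⟨w, ?_, ?_, ?_⟩
      · rw [← hwv ⟨le_rfl, ha⟩, hv0]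
      · exact HasYoungIncrements.glue (hX.isYoungFamily_norm hC) hγ (by positivity) le_rfl ha
          hk' (hvv.congr hwv hwv) (huu.congr hwu hwu) hwb
      · exact hwb.glue ha (by linarith) (hu'.congr hwu)
  have := key n le_rfl
  rwa [hτT] at this

end YoungGlobal

/-! ### Riemann sums, limits of germs and conservation laws -/

section YoungLimits

variable {E : Type*} [NormedAddCommGroup E]

/-- Riemann sums of a nonlinear Young integral converge, at a rate depending on the mesh only. -/
theorem riemannSum_sub_le {X : ℝ → ℝ → E → E → E → E} {γ a b K : ℝ} (hγ : 1 / 2 < γ) (hK : 0 ≤ K)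
    {v x : ℝ → E} (h : ∀ s t, a ≤ s → s ≤ t → t ≤ b →
      ‖x t - x s - X s t (v s) (v s) (v s)‖ ≤ K * (t - s) ^ (γ + 1 / 2))
    {n : ℕ} {τ : ℕ → ℝ} (hτ : Monotone τ) (h0 : τ 0 = a) (hn : τ n = b) {δ : ℝ}
    (hδ : ∀ i < n, τ (i + 1) - τ i ≤ δ) :
    ‖(∑ i ∈ Finset.range n, X (τ i) (τ (i + 1)) (v (τ i)) (v (τ i)) (v (τ i))) - (x b - x a)‖ ≤
      K * δ ^ (γ - 1 / 2) * (b - a) := by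
  have e1 : x b - x a = ∑ i ∈ Finset.range n, (x (τ (i + 1)) - x (τ i)) := by
    rw [Finset.sum_range_sub (fun i => x (τ i)), h0, hn]
  have e2 : b - a = ∑ i ∈ Finset.range n, (τ (i + 1) - τ i) := by
    rw [Finset.sum_range_sub, h0, hn]
  rw [e1, e2, ← Finset.sum_sub_distrib, Finset.mul_sum]
  refine (norm_sum_le _ _).trans (Finset.sum_le_sum fun i hi => ?_)
  have hi := Finset.mem_range.1 hi
  have hle : τ i ≤ τ (i + 1) := hτ (Nat.le_succ i)
  rw [norm_sub_rev]
  refine (h _ _ (h0 ▸ hτ (Nat.zero_le i)) hle (hn ▸ hτ hi)).trans ?_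
  have e3 : (τ (i + 1) - τ i) ^ (γ + 1 / 2) =
      (τ (i + 1) - τ i) ^ (γ - 1 / 2) * (τ (i + 1) - τ i) := by
    rcases hle.eq_or_lt with h | h
    · rw [← h, sub_self, mul_zero, Real.zero_rpow (by linarith)]
    · rw [← Real.rpow_add_one (by linarith)]; congr 1; ring
  rw [e3, mul_assoc]
  refine mul_le_mul_of_nonneg_left (mul_le_mul_of_nonneg_right ?_ (by linarith)) hK
  exact Real.rpow_le_rpow (by linarith) (hδ i hi) (by linarith)

/-- The increments of the nonlinear Young integral are determined by the integrand. -/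
theorem HasYoungIncrements.sub_eq {X : ℝ → ℝ → E → E → E → E} {γ a b : ℝ} (hγ : 1 / 2 < γ)
    {v x y : ℝ → E} (hx : HasYoungIncrements X γ a b v x) (hy : HasYoungIncrements X γ a b v y)
    {t : ℝ} (h1 : a ≤ t) (h2 : t ≤ b) : x t - x a = y t - y a := by
  obtain ⟨K, hK, hx⟩ := hx
  obtain ⟨K', hK', hy⟩ := hy
  have := sewing_bound (a := a) (b := b) (K := K + K') (M := 0) (θ := γ + 1 / 2) (by linarith)
    le_rfl
    (r := fun s t => ‖(x t - x s) - (y t - y s)‖) (fun s t h1 h2 h3 => ?_) (fun s t h1 h2 h3 => ?_)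
    le_rfl h1 h2
  · simp only [mul_zero, zero_mul] at this
    exact sub_eq_zero.1 (norm_le_zero_iff.1 this)
  · have e : (x t - x s) - (y t - y s) = (x t - x s - X s t (v s) (v s) (v s)) -
        (y t - y s - X s t (v s) (v s) (v s)) := by abel
    simp only [e]
    refine (norm_sub_le _ _).trans ?_
    linarith [hx s t h1 h2 h3, hy s t h1 h2 h3]
  · have e : (x t - x s) - (y t - y s) = ((x ((s + t) / 2) - x s) - (y ((s + t) / 2) - y s)) +
        ((x t - x ((s + t) / 2)) - (y t - y ((s + t) / 2))) := by abel
    simp only [e, zero_mul, add_zero]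
    exact norm_add_le _ _

/-- A sequence converges if it is approximated, uniformly and arbitrarily well, by convergent
sequences. -/
theorem exists_tendsto_of_approx [CompleteSpace E] {y : ℕ → E} {S : ℕ → ℕ → E} {S' : ℕ → E}
    {e : ℕ → ℝ} (he : Tendsto e atTop (𝓝 0)) (hS : ∀ n, Tendsto (S n) atTop (𝓝 (S' n)))
    (h : ∀ n N, ‖y N - S n N‖ ≤ e n) : ∃ l, Tendsto y atTop (𝓝 l) := by
  refine cauchySeq_tendsto_of_complete (Metric.cauchySeq_iff'.2 fun ε hε => ?_)
  obtain ⟨n, hn⟩ := (he.eventually (gt_mem_nhds (show (0 : ℝ) < ε / 3 by positivity))).exists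
  obtain ⟨N₀, hN₀⟩ := Metric.cauchySeq_iff'.1 (hS n).cauchySeq (ε / 3) (by positivity)
  refine ⟨N₀, fun N hN => ?_⟩
  have h1 := hN₀ N hN
  rw [dist_eq_norm] at h1 ⊢
  have e' : y N - y N₀ = (y N - S n N) + (S n N - S n N₀) - (y N₀ - S n N₀) := by abel
  rw [e']
  refine (norm_sub_le _ _).trans_lt ?_
  have := norm_add_le (y N - S n N) (S n N - S n N₀)
  linarith [h n N, h n N₀]

/-- If approximate integrals have the increments of the approximate germs `Y N` up to an error that
is uniform in `N`, and the germs converge pointwise to `X`, then the integrals converge to the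
nonlinear Young integral of `X`. -/
theorem exists_hasYoungIncrements_of_tendsto [CompleteSpace E] {X : ℝ → ℝ → E → E → E → E}
    {Y : ℕ → ℝ → ℝ → E → E → E → E}
    {γ a b K : ℝ} (hγ : 1 / 2 < γ) (hK : 0 ≤ K) {v : ℝ → E} {y : ℕ → ℝ → E}
    (hlim : ∀ s t f, a ≤ s → s ≤ t → t ≤ b →
      Tendsto (fun N => Y N s t f f f) atTop (𝓝 (X s t f f f)))
    (hy : ∀ N s t, a ≤ s → s ≤ t → t ≤ b →
      ‖y N t - y N s - Y N s t (v s) (v s) (v s)‖ ≤ K * (t - s) ^ (γ + 1 / 2)) :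
    ∃ x, HasYoungIncrements X γ a b v x ∧
      ∀ t, a ≤ t → t ≤ b → Tendsto (fun N => y N t - y N a) atTop (𝓝 (x t - x a)) := by
  have hex : ∀ t, t ∈ Icc a b → ∃ l, Tendsto (fun N => y N t - y N a) atTop (𝓝 l) := by
    intro t ht
    -- the partition of `[a, t]` into `n + 1` equal pieces
    let τ : ℕ → ℕ → ℝ := fun n i => a + i * ((t - a) / (n + 1))
    have hd : ∀ n : ℕ, 0 ≤ (t - a) / ((n : ℝ) + 1) := fun n =>
      div_nonneg (by linarith [ht.1]) (by positivity)
    have hmono : ∀ n, Monotone (τ n) := fun n i j hij => by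
      simp only [τ]
      have := mul_le_mul_of_nonneg_right (show (i : ℝ) ≤ j by exact_mod_cast hij) (hd n)
      linarith
    have hend : ∀ n, τ n (n + 1) = t := fun n => by
      simp only [τ]; push_cast
      have : (n : ℝ) + 1 ≠ 0 := by positivity
      field_simp; ring
    have h0 : ∀ n, τ n 0 = a := fun n => by simp [τ]
    refine exists_tendsto_of_approx
      (S := fun n N => ∑ i ∈ Finset.range (n + 1),
        Y N (τ n i) (τ n (i + 1)) (v (τ n i)) (v (τ n i)) (v (τ n i)))
      (e := fun n => K * ((t - a) / (n + 1)) ^ (γ - 1 / 2) * (t - a)) ?_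
      (fun n => tendsto_finsetSum _ fun i hi => hlim _ _ _ ?_ ?_ ?_) (fun n N => ?_)
    · have h1 : Tendsto (fun n : ℕ => (t - a) / ((n : ℝ) + 1)) atTop (𝓝 0) := by
        have := (tendsto_add_atTop_iff_nat 1).2 (tendsto_const_div_atTop_nhds_zero_nat (t - a))
        simpa using this
      have := ((h1.rpow_const (p := γ - 1 / 2) (Or.inr (by linarith))).const_mul K).mul_const
        (t - a)
      rwa [Real.zero_rpow (by linarith), mul_zero, zero_mul] at this
    · exact (h0 n).symm.le.trans (hmono n (Nat.zero_le i))
    · exact hmono n (Nat.le_succ i)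
    · exact (hmono n (Finset.mem_range.1 hi)).trans ((hend n).le.trans ht.2)
    · rw [norm_sub_rev]
      refine riemannSum_sub_le (X := Y N) hγ hK (fun s r h1 h2 h3 => hy N s r h1 h2 (h3.trans ht.2))
        (hmono n) (h0 n) (hend n) fun i _ => ?_
      simp only [τ]; push_cast; linarith
  choose! x hx using hex
  have hinc : ∀ s t, a ≤ s → s ≤ t → t ≤ b →
      Tendsto (fun N => y N t - y N s) atTop (𝓝 (x t - x s)) := by
    intro s t h1 h2 h3
    have := (hx t ⟨h1.trans h2, h3⟩).sub (hx s ⟨h1, h2.trans h3⟩)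
    simpa using this
  refine ⟨x, ⟨K, hK, fun s t h1 h2 h3 => ?_⟩, fun t h1 h2 => hinc a t le_rfl h1 h2⟩
  exact le_of_tendsto' ((hinc s t h1 h2 h3).sub (hlim s t (v s) h1 h2 h3)).norm
    fun N => hy N s t h1 h2 h3

variable [NormedSpace ℝ E]

/-- Conservation law: if the germ `X_{st}(f)` is orthogonal to `f` for a weaker Hilbert norm, then
that norm is constant along solutions, because its square has increments of order `> 1`. -/
theorem HasYoungIncrements.norm_conserved {X : ℝ → ℝ → E → E → E → E} {γ C T : ℝ}
    (hX : IsYoungFamily X (normSeminorm ℝ E) γ C T) (hγ : 1 / 2 < γ) (hC : 0 ≤ C)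
    {L : Type*} [NormedAddCommGroup L] [InnerProductSpace ℂ L] [NormedSpace ℝ L] (ι : E →L[ℝ] L)
    (horth : ∀ s t f, 0 ≤ s → s ≤ t → t ≤ T → (inner ℂ (ι f) (ι (X s t f f f))).re = 0)
    {b R : ℝ} (hb0 : 0 ≤ b) (hb : b ≤ T) {v : ℝ → E}
    (hv : HolderBound (normSeminorm ℝ E) 0 b R v)
    (h : HasYoungIncrements X γ 0 b v v) : ‖ι (v b)‖ = ‖ι (v 0)‖ := by
  obtain ⟨K, hK, h⟩ := h
  have hR := hv.nonneg hb0
  have hinc : ∀ s t, 0 ≤ s → s ≤ t → t ≤ b → |‖ι (v t)‖ ^ 2 - ‖ι (v s)‖ ^ 2| ≤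
      (2 * ‖ι‖ ^ 2 * R * K + ‖ι‖ ^ 2 * (R * (C * R ^ 3) + 2 * R * K)) * (t - s) ^ (γ + 1 / 2) := by
    intro s t h1 h2 h3
    set ρ := v t - v s - X s t (v s) (v s) (v s) with hρ
    have hρb : ‖ρ‖ ≤ K * (t - s) ^ (γ + 1 / 2) := h s t h1 h2 h3
    have hp : 0 ≤ (t - s) ^ γ := Real.rpow_nonneg (by linarith) _
    have hp' : 0 ≤ (t - s) ^ (1 / 2 : ℝ) := Real.rpow_nonneg (by linarith) _
    have hpp : (t - s) ^ (γ + 1 / 2) = (t - s) ^ γ * (t - s) ^ (1 / 2 : ℝ) :=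
      Real.rpow_add_of_nonneg (by linarith) (by linarith) (by norm_num)
    have hs := hv.sup s h1 (h2.trans h3)
    have ht := hv.sup t (h1.trans h2) h3
    have hts := hv.holder s t h1 h2 h3
    simp only [coe_normSeminorm] at hs ht hts
    have hXb : ‖X s t (v s) (v s) (v s)‖ ≤ C * R ^ 3 * (t - s) ^ γ := by
      have := hX.bound s t h1 h2 (h3.trans hb) (v s) (v s) (v s)
      simp only [coe_normSeminorm] at this
      calc _ ≤ C * (t - s) ^ γ * ‖v s‖ * ‖v s‖ * ‖v s‖ := this
        _ ≤ C * (t - s) ^ γ * R * R * R := by gcongr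
        _ = _ := by ring
    have e1 : ι (v t) = ι (v s) + ι (v t - v s) := by rw [map_sub]; abel
    have e2 : ι (v t - v s) = ι (X s t (v s) (v s) (v s)) + ι ρ := by
      rw [← map_add]; congr 1; rw [hρ]; abel
    have e3 : ‖ι (v t)‖ ^ 2 - ‖ι (v s)‖ ^ 2 =
        2 * (inner ℂ (ι (v s)) (ι ρ)).re + ‖ι (v t - v s)‖ ^ 2 := by
      have h4 := norm_add_sq (𝕜 := ℂ) (ι (v s)) (ι (v t - v s))
      rw [← e1] at h4
      have h5 : RCLike.re (inner ℂ (ι (v s)) (ι (v t - v s))) = (inner ℂ (ι (v s)) (ι ρ)).re := by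
        rw [e2, inner_add_right, map_add]
        simp [horth s t (v s) h1 h2 (h3.trans hb)]
      rw [h4, h5]; ring
    have hin : |(inner ℂ (ι (v s)) (ι ρ)).re| ≤
        ‖ι‖ ^ 2 * R * K * (t - s) ^ (γ + 1 / 2) := by
      refine (Complex.abs_re_le_norm _).trans ((norm_inner_le_norm _ _).trans ?_)
      calc ‖ι (v s)‖ * ‖ι ρ‖ ≤ (‖ι‖ * R) * (‖ι‖ * (K * (t - s) ^ (γ + 1 / 2))) := by
            gcongr
            · exact (ι.le_opNorm _).trans (by gcongr)
            · exact (ι.le_opNorm _).trans (by gcongr)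
        _ = _ := by ring
    have hsq : ‖ι (v t - v s)‖ ^ 2 ≤
        ‖ι‖ ^ 2 * (R * (C * R ^ 3) + 2 * R * K) * (t - s) ^ (γ + 1 / 2) := by
      have h6 : ‖v t - v s‖ ≤ 2 * R := (norm_sub_le _ _).trans (by linarith)
      have h7 : ‖v t - v s‖ ≤ ‖X s t (v s) (v s) (v s)‖ + ‖ρ‖ := by
        have : v t - v s = X s t (v s) (v s) (v s) + ρ := by rw [hρ]; abel
        rw [this]; exact norm_add_le _ _
      have h8 : ‖v t - v s‖ ^ 2 ≤ (R * (C * R ^ 3) + 2 * R * K) * (t - s) ^ (γ + 1 / 2) := by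
        calc ‖v t - v s‖ ^ 2 ≤ ‖v t - v s‖ * (‖X s t (v s) (v s) (v s)‖ + ‖ρ‖) := by
              rw [pow_two]; gcongr
          _ = ‖v t - v s‖ * ‖X s t (v s) (v s) (v s)‖ + ‖v t - v s‖ * ‖ρ‖ := by ring
          _ ≤ (R * (t - s) ^ (1 / 2 : ℝ)) * (C * R ^ 3 * (t - s) ^ γ) +
              2 * R * (K * (t - s) ^ (γ + 1 / 2)) := by gcongr
          _ = _ := by rw [hpp]; ring
      calc ‖ι (v t - v s)‖ ^ 2 ≤ (‖ι‖ * ‖v t - v s‖) ^ 2 := by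
            gcongr; exact ι.le_opNorm _
        _ = ‖ι‖ ^ 2 * ‖v t - v s‖ ^ 2 := by ring
        _ ≤ ‖ι‖ ^ 2 * ((R * (C * R ^ 3) + 2 * R * K) * (t - s) ^ (γ + 1 / 2)) := by gcongr
        _ = _ := by ring
    rw [e3]
    refine (abs_add_le _ _).trans ?_
    rw [abs_mul, abs_two, abs_of_nonneg (by positivity : 0 ≤ ‖ι (v t - v s)‖ ^ 2)]
    nlinarith
  have := sewing_bound (θ := γ + 1 / 2) (by linarith) le_rfl hinc (fun s t _ _ _ => by
    rw [zero_mul, add_zero, add_comm]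
    refine le_trans (le_of_eq ?_) (abs_add_le _ _)
    congr 1; ring) le_rfl hb0 le_rfl
  simp only [mul_zero, zero_mul] at this
  have h0 := sub_eq_zero.1 (abs_eq_zero.1 (le_antisymm this (abs_nonneg _)))
  exact (pow_left_inj₀ (norm_nonneg _) (norm_nonneg _) two_ne_zero).1 h0

end YoungLimits

/-! ### Galerkin approximations in an abstract description of `H^α` -/

/-- A strongly continuous family of isometries is jointly continuous. -/
theorem continuous_uncurry_of_isometry {E : Type*} [NormedAddCommGroup E] [NormedSpace ℝ E]
    {V : ℝ → E →L[ℝ] E} (hV : ∀ t f, ‖V t f‖ = ‖f‖)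
    (hc : ∀ f, Continuous fun t => V t f) : Continuous fun p : ℝ × E => V p.1 p.2 := by
  rw [continuous_iff_continuousAt]
  rintro ⟨t, f⟩
  rw [ContinuousAt, tendsto_iff_norm_sub_tendsto_zero]
  have h1 : Tendsto (fun p : ℝ × E => ‖p.2 - f‖ + ‖V p.1 f - V t f‖) (𝓝 (t, f))
      (𝓝 (‖f - f‖ + ‖V t f - V t f‖)) := by
    refine Continuous.tendsto (f := fun p : ℝ × E => ‖p.2 - f‖ + ‖V p.1 f - V t f‖) ?_ _
    have := (hc f).comp (continuous_fst (X := ℝ) (Y := E))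
    exact (continuous_snd.sub continuous_const).norm.add (this.sub continuous_const).norm
  simp only [sub_self, norm_zero, add_zero] at h1
  refine squeeze_zero (fun _ => norm_nonneg _) (fun p => ?_) h1
  have e : V p.1 p.2 - V t f = V p.1 (p.2 - f) + (V p.1 f - V t f) := by
    rw [map_sub]; abel
  rw [e]
  exact (norm_add_le _ _).trans (by rw [hV])

namespace NLSModel

variable {L : Type*} [NormedAddCommGroup L] [InnerProductSpace ℂ L] [NormedSpace ℝ L]

/-- A description of `H^α` as a Banach space `E` with an embedding `ι : E → L` in which the free
evolution is an isometric group `V`, the Galerkin nonlinearities are bounded trilinear maps `G N`,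
and the modulated operators converge to a Young family `X` that is tame with respect to the norm
of `L` and conserves it. -/
structure Lift (M : NLSModel L) (α : ℝ) (w : ℝ → ℝ) (γ : ℝ) (E : Type*) [NormedAddCommGroup E]
    [NormedSpace ℝ E] where
  /-- the inclusion `H^α ⊆ L²` -/
  ι : E →L[ℝ] L
  /-- the free evolution -/
  V : ℝ → E →L[ℝ] E
  /-- the polarised Galerkin nonlinearity `𝒩_N` -/
  G : ℕ → E → E → E → E
  /-- the projector `Π_N` -/
  P : ℕ → E →L[ℝ] E
  /-- the polarised modulated operator `X_{st}` -/
  X : ℝ → ℝ → E → E → E → E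
  norm_ι_le : ∀ f, ‖ι f‖ ≤ ‖f‖
  hNorm_ι : ∀ f, M.hNorm α (ι f) = ‖f‖ₑ
  exists_of_hNorm : ∀ f, M.hNorm α f < ⊤ → ∃ e, ι e = f
  U_ι : ∀ t f, M.U t (ι f) = ι (V t f)
  galerkin_ι : ∀ N f, M.galerkin N (ι f) = ι (G N f f f)
  norm_V : ∀ t f, ‖V t f‖ = ‖f‖
  V_neg : ∀ t f, V (-t) (V t f) = f
  continuous_V : ∀ f, Continuous fun t => V t f
  G_triadditive : ∀ N, IsTriadditive (G N)
  G_bound : ∀ N, ∃ C, 0 ≤ C ∧ ∀ f g h, ‖G N f g h‖ ≤ C * ‖f‖ * ‖g‖ * ‖h‖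
  norm_P_le : ∀ N f, ‖P N f‖ ≤ ‖f‖
  tendsto_P : ∀ f, Tendsto (fun N => P N f) atTop (𝓝 f)
  tame : ∀ T, 0 < T → ∃ C, 0 ≤ C ∧
    IsTameYoungFamily X ((normSeminorm ℝ L).comp ι.toLinearMap) γ C T
  integral_eq : ∀ N s t f, 0 ≤ s → s ≤ t →
    ∫ r in s..t, V (-w r) (G N (V (w r) f) (V (w r) f) (V (w r) f)) =
      P N (X s t (P N f) (P N f) (P N f))
  inner_V : ∀ t f g, inner ℂ (ι (V t f)) (ι (V t g)) = inner ℂ (ι f) (ι g)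
  inner_G : ∀ N f, (inner ℂ (ι f) (ι (G N f f f))).re = 0

namespace Lift

variable {M : NLSModel L} {α γ : ℝ} {w : ℝ → ℝ} {E : Type*} [NormedAddCommGroup E]
  [NormedSpace ℝ E] (D : M.Lift α w γ E)

theorem ι_injective : Function.Injective D.ι := by
  intro f g h
  have := D.hNorm_ι (f - g)
  rw [map_sub, h, sub_self, ← map_zero D.ι, D.hNorm_ι, enorm_zero] at this
  exact sub_eq_zero.1 (enorm_eq_zero.1 this.symm)

theorem V_neg' (t : ℝ) (f : E) : D.V t (D.V (-t) f) = f := by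
  have := D.V_neg (-t) f
  rwa [neg_neg] at this

theorem continuous_uncurry_V : Continuous fun p : ℝ × E => D.V p.1 p.2 :=
  continuous_uncurry_of_isometry D.norm_V D.continuous_V

/-- The integrand `(U^w_r)⁻¹ 𝒩_N(U^w_r f)`, polarised. -/
noncomputable def integrand (w : ℝ → ℝ) (N : ℕ) (r : ℝ) (f g h : E) : E :=
  D.V (-w r) (D.G N (D.V (w r) f) (D.V (w r) g) (D.V (w r) h))

theorem integrand_triadditive (N : ℕ) (r : ℝ) : IsTriadditive (D.integrand w N r) where
  sub₁ _ _ _ _ := by simp only [integrand, map_sub, (D.G_triadditive N).sub₁]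
  sub₂ _ _ _ _ := by simp only [integrand, map_sub, (D.G_triadditive N).sub₂]
  sub₃ _ _ _ _ := by simp only [integrand, map_sub, (D.G_triadditive N).sub₃]

theorem integrand_bound (N : ℕ) : ∃ C, 0 ≤ C ∧ ∀ r f g h,
    ‖D.integrand w N r f g h‖ ≤ C * ‖f‖ * ‖g‖ * ‖h‖ := by
  obtain ⟨C, hC, h⟩ := D.G_bound N
  refine ⟨C, hC, fun r f g k => ?_⟩
  rw [integrand, D.norm_V]
  simpa only [D.norm_V] using h (D.V (w r) f) (D.V (w r) g) (D.V (w r) k)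

theorem continuousOn_integrand (hw : ContinuousOn w (Ici 0)) (N : ℕ) {s : Set ℝ} (hs : s ⊆ Ici 0)
    {v : ℝ → E} (hv : ContinuousOn v s) :
    ContinuousOn (fun r => D.integrand w N r (v r) (v r) (v r)) s := by
  obtain ⟨C, hC, h⟩ := D.G_bound N
  have hw' := hw.mono hs
  have h1 : ContinuousOn (fun r => D.V (w r) (v r)) s :=
    D.continuous_uncurry_V.comp_continuousOn (hw'.prodMk hv)
  exact D.continuous_uncurry_V.comp_continuousOn (hw'.neg.prodMk fun r hr =>
    (D.G_triadditive N).tendsto h (h1 r hr) (h1 r hr) (h1 r hr))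

/-- The Galerkin approximation of `X`. -/
noncomputable def XN (N : ℕ) (s t : ℝ) (f g h : E) : E :=
  D.P N (D.X s t (D.P N f) (D.P N g) (D.P N h))

theorem exists_isYoungFamily {T : ℝ} (hT : 0 < T) : ∃ C, 0 ≤ C ∧
    IsYoungFamily D.X (normSeminorm ℝ E) γ C T := by
  obtain ⟨C, hC, h⟩ := D.tame T hT
  exact ⟨3 * C, by positivity, h.isYoungFamily_norm hC⟩

theorem XN_isYoungFamily {C T : ℝ} (hC : 0 ≤ C) (h : IsYoungFamily D.X (normSeminorm ℝ E) γ C T)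
    (N : ℕ) : IsYoungFamily (D.XN N) (normSeminorm ℝ E) γ C T where
  triadditive s t :=
    { sub₁ := fun _ _ _ _ => by simp only [XN, map_sub, (h.triadditive s t).sub₁]
      sub₂ := fun _ _ _ _ => by simp only [XN, map_sub, (h.triadditive s t).sub₂]
      sub₃ := fun _ _ _ _ => by simp only [XN, map_sub, (h.triadditive s t).sub₃] }
  add_time s u t h1 h2 h3 h4 f g k := by
    simp only [XN, ← map_add, h.add_time s u t h1 h2 h3 h4]
  bound s t h1 h2 h3 f g k := by
    have hp : 0 ≤ (t - s) ^ γ := Real.rpow_nonneg (by linarith) _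
    have := h.bound s t h1 h2 h3 (D.P N f) (D.P N g) (D.P N k)
    simp only [coe_normSeminorm] at this ⊢
    refine (D.norm_P_le _ _).trans (this.trans ?_)
    gcongr <;> apply D.norm_P_le

/-- The truncated operators converge strongly, because the projectors do and `X_{st}` is bounded. -/
theorem tendsto_XN {T : ℝ} (hT : 0 < T) {s t : ℝ} (h1 : 0 ≤ s) (h2 : s ≤ t) (h3 : t ≤ T) (f : E) :
    Tendsto (fun N => D.XN N s t f f f) atTop (𝓝 (D.X s t f f f)) := by
  obtain ⟨C, hC, h⟩ := D.exists_isYoungFamily hT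
  have hX : Tendsto (fun N => D.X s t (D.P N f) (D.P N f) (D.P N f)) atTop
      (𝓝 (D.X s t f f f)) :=
    (h.triadditive s t).tendsto (c := C * (t - s) ^ γ) (h.bound s t h1 h2 h3)
      (D.tendsto_P f) (D.tendsto_P f) (D.tendsto_P f)
  have h4 : Tendsto (fun N => ‖D.X s t (D.P N f) (D.P N f) (D.P N f) - D.X s t f f f‖ +
      ‖D.P N (D.X s t f f f) - D.X s t f f f‖) atTop (𝓝 (0 + 0)) :=
    (tendsto_iff_norm_sub_tendsto_zero.1 hX).add
      (tendsto_iff_norm_sub_tendsto_zero.1 (D.tendsto_P _))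
  rw [add_zero] at h4
  rw [tendsto_iff_norm_sub_tendsto_zero]
  refine squeeze_zero (fun _ => norm_nonneg _) (fun N => ?_) h4
  have e : D.XN N s t f f f - D.X s t f f f =
      D.P N (D.X s t (D.P N f) (D.P N f) (D.P N f) - D.X s t f f f) +
      (D.P N (D.X s t f f f) - D.X s t f f f) := by
    rw [XN, map_sub]; abel
  rw [e]
  exact (norm_add_le _ _).trans (add_le_add_left (D.norm_P_le _ _) _)

/-- The modulated operator conserves the `L²` norm, since each Galerkin approximation does. -/
theorem orth [CompleteSpace E] (hw : ContinuousOn w (Ici 0)) {s t : ℝ} (h1 : 0 ≤ s) (h2 : s ≤ t)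
    (f : E) : (inner ℂ (D.ι f) (D.ι (D.X s t f f f))).re = 0 := by
  -- a continuous additive functional commutes with the integral
  let ℓ₀ : E →+ ℝ :=
    { toFun := fun g => (inner ℂ (D.ι f) (D.ι g)).re
      map_zero' := by simp
      map_add' := fun g h => by simp }
  have hℓ₀ : Continuous ℓ₀ :=
    Complex.continuous_re.comp (continuous_const.inner D.ι.continuous)
  let ℓ : E →L[ℝ] ℝ := ℓ₀.toRealLinearMap hℓ₀
  have hℓ : ∀ g, ℓ g = (inner ℂ (D.ι f) (D.ι g)).re := fun _ => rfl
  have hN : ∀ N, ℓ (D.XN N s t f f f) = 0 := by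
    intro N
    have hint : IntervalIntegrable (fun r => D.integrand w N r f f f) volume s t := by
      refine ContinuousOn.intervalIntegrable ?_
      rw [uIcc_of_le h2]
      exact D.continuousOn_integrand hw N (fun r hr => h1.trans hr.1) continuousOn_const
    have e : D.XN N s t f f f = ∫ r in s..t, D.integrand w N r f f f :=
      (D.integral_eq N s t f h1 h2).symm
    rw [e, ← ContinuousLinearMap.intervalIntegral_comp_comm ℓ hint]
    refine intervalIntegral.integral_zero_ae (Eventually.of_forall fun r _ => ?_)
    rw [hℓ, integrand, ← D.inner_V (w r), D.V_neg', D.inner_G]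
  have hl := (ℓ.continuous.tendsto _).comp
    (D.tendsto_XN (T := t + 1) (by linarith) h1 h2 (by linarith) f)
  simp only [Function.comp_def, hN] at hl
  exact (tendsto_nhds_unique hl tendsto_const_nhds)

theorem continuousOn_of_holderBound {N : Seminorm ℝ E} {a b R : ℝ} {v : ℝ → E}
    (hN : N = normSeminorm ℝ E) (h : HolderBound N a b R v) : ContinuousOn v (Icc a b) := by
  subst hN
  intro t ht
  rw [ContinuousWithinAt, tendsto_iff_norm_sub_tendsto_zero]
  have hl : Tendsto (fun s => R * |s - t| ^ (1 / 2 : ℝ)) (𝓝[Icc a b] t) (𝓝 0) := by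
    have : Continuous fun s : ℝ => R * |s - t| ^ (1 / 2 : ℝ) :=
      continuous_const.mul ((continuous_id.sub continuous_const).abs.rpow_const
        (fun _ => Or.inr (by norm_num)))
    have h1 := (this.tendsto t).mono_left (nhdsWithin_le_nhds (s := Icc a b))
    simpa using h1
  refine squeeze_zero' (Eventually.of_forall fun _ => norm_nonneg _) ?_ hl
  filter_upwards [self_mem_nhdsWithin] with s hs
  rcases le_total s t with hst | hst
  · have := h.holder s t hs.1 hst ht.2
    rw [norm_sub_rev, abs_sub_comm, abs_of_nonneg (by linarith)]
    exact this
  · have := h.holder t s ht.1 hst hs.2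
    rw [abs_of_nonneg (by linarith)]
    exact this

/-- The Galerkin approximations of the Young integral of `v`. -/
noncomputable def approx (w : ℝ → ℝ) (v : ℝ → E) (a : ℝ) (N : ℕ) (t : ℝ) : E :=
  ∫ r in a..t, D.integrand w N r (v r) (v r) (v r)

/-- For fixed `N` the integrand is regular in time, so the Galerkin integrals are Young integrals
of the Galerkin germs for trivial reasons; the constant depends on `N`. -/
theorem hasYoungIncrements_approx (hγ : 1 / 2 < γ) (hγ1 : γ ≤ 1)
    (hw : ContinuousOn w (Ici 0)) (N : ℕ) {a b R : ℝ} (ha : 0 ≤ a) (hab : a ≤ b)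
    {v : ℝ → E} (hv : HolderBound (normSeminorm ℝ E) a b R v) :
    HasYoungIncrements (D.XN N) γ a b v (D.approx w v a N) := by
  obtain ⟨C, hC, hbd⟩ := D.integrand_bound (w := w) N
  have hR := hv.nonneg hab
  have hcv := continuousOn_of_holderBound rfl hv
  have hint : ∀ s t, a ≤ s → s ≤ t → t ≤ b →
      IntervalIntegrable (fun r => D.integrand w N r (v r) (v r) (v r)) volume s t := by
    intro s t h1 h2 h3
    refine ContinuousOn.intervalIntegrable ?_
    rw [uIcc_of_le h2]
    exact D.continuousOn_integrand hw N (fun r hr => ha.trans (h1.trans hr.1))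
      (hcv.mono (Icc_subset_Icc h1 h3))
  refine ⟨3 * C * R ^ 2 * R * (b - a) ^ (1 - γ), by
    have : 0 ≤ (b - a) ^ (1 - γ) := Real.rpow_nonneg (by linarith) _
    positivity, fun s t h1 h2 h3 => ?_⟩
  have hconst : IntervalIntegrable (fun r => D.integrand w N r (v s) (v s) (v s)) volume s t := by
    refine ContinuousOn.intervalIntegrable ?_
    rw [uIcc_of_le h2]
    exact D.continuousOn_integrand hw N (fun r hr => ha.trans (h1.trans hr.1)) continuousOn_const
  have e1 : D.approx w v a N t - D.approx w v a N s =
      ∫ r in s..t, D.integrand w N r (v r) (v r) (v r) :=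
    intervalIntegral.integral_interval_sub_left (hint a t le_rfl (h1.trans h2) h3)
      (hint a s le_rfl h1 (h2.trans h3))
  have e2 : D.XN N s t (v s) (v s) (v s) = ∫ r in s..t, D.integrand w N r (v s) (v s) (v s) :=
    (D.integral_eq N s t (v s) (ha.trans h1) h2).symm
  rw [e1, e2, ← intervalIntegral.integral_sub (hint s t h1 h2 h3) hconst]
  have hp : 0 ≤ (t - s) ^ (1 / 2 : ℝ) := Real.rpow_nonneg (by linarith) _
  have hb : ∀ r ∈ uIoc s t, ‖D.integrand w N r (v r) (v r) (v r) -
      D.integrand w N r (v s) (v s) (v s)‖ ≤ 3 * C * R ^ 2 * (R * (t - s) ^ (1 / 2 : ℝ)) := by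
    intro r hr
    rw [uIoc_of_le h2] at hr
    have h4 := hv.holder s r h1 hr.1.le (hr.2.trans h3)
    refine (D.integrand_triadditive N r).diag_sub_le (N := normSeminorm ℝ E) hC (hbd r)
      (hv.sup r (h1.trans hr.1.le) (hr.2.trans h3)) (hv.sup s h1 (h2.trans h3)) (h4.trans ?_)
    exact mul_le_mul_of_nonneg_left (Real.rpow_le_rpow (by linarith [hr.1]) (by linarith [hr.2])
      (by norm_num)) hR
  refine (intervalIntegral.norm_integral_le_of_norm_le_const hb).trans ?_
  rw [abs_of_nonneg (by linarith : 0 ≤ t - s)]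
  have hpow : (t - s) ^ (1 / 2 : ℝ) * (t - s) ≤ (b - a) ^ (1 - γ) * (t - s) ^ (γ + 1 / 2) := by
    have : (t - s) ^ (1 / 2 : ℝ) * (t - s) = (t - s) ^ (1 - γ) * (t - s) ^ (γ + 1 / 2) := by
      rcases h2.eq_or_lt with h | h
      · rw [h, sub_self, mul_zero, Real.zero_rpow (x := γ + 1 / 2), mul_zero]
        linarith
      · rw [← Real.rpow_add_one (by linarith), ← Real.rpow_add (by linarith)]
        congr 1; ring
    rw [this]
    exact mul_le_mul_of_nonneg_right (Real.rpow_le_rpow (by linarith) (by linarith) (by linarith))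
      (Real.rpow_nonneg (by linarith) _)
  calc 3 * C * R ^ 2 * (R * (t - s) ^ (1 / 2 : ℝ)) * (t - s)
      = 3 * C * R ^ 2 * R * ((t - s) ^ (1 / 2 : ℝ) * (t - s)) := by ring
    _ ≤ 3 * C * R ^ 2 * R * ((b - a) ^ (1 - γ) * (t - s) ^ (γ + 1 / 2)) :=
        mul_le_mul_of_nonneg_left hpow (by positivity)
    _ = _ := by ring

/-- The nonlinear Young integral along a Hölder path exists and is the limit of the Galerkin
integrals. -/
theorem exists_hasYoungIncrements [CompleteSpace E] (hγ : 1 / 2 < γ) (hγ1 : γ ≤ 1)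
    (hw : ContinuousOn w (Ici 0)) {a b R : ℝ} (ha : 0 ≤ a) (hab : a ≤ b)
    {v : ℝ → E} (hv : HolderBound (normSeminorm ℝ E) a b R v) :
    ∃ x, HasYoungIncrements D.X γ a b v x ∧
      ∀ t, a ≤ t → t ≤ b → Tendsto (fun N => D.approx w v a N t) atTop (𝓝 (x t - x a)) := by
  obtain ⟨C, hC, hX⟩ := D.exists_isYoungFamily (T := b + 1) (by linarith)
  have hR := hv.nonneg hab
  have hc := sewingConst_pos (θ := γ + 1 / 2) (by linarith)
  obtain ⟨x, hx, hx'⟩ := exists_hasYoungIncrements_of_tendsto (X := D.X) (Y := D.XN) (v := v)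
    (y := D.approx w v a) (a := a) (b := b) hγ
    (K := sewingConst (γ + 1 / 2) * (9 * C * R ^ 2 * R)) (by positivity)
    (fun s t f h1 h2 h3 => D.tendsto_XN (T := b + 1) (by linarith) (ha.trans h1) h2
      (by linarith) f)
    (fun N s t h1 h2 h3 => by
      have hY := D.XN_isYoungFamily hC hX N
      have := hY.sewing_sub_le hγ hC (κ := 1) (by simp) ha (by linarith : b ≤ b + 1) hR
        zero_le_one hv (HolderBound.zero hR) (by rw [sub_zero]; exact hv)
        (D.hasYoungIncrements_approx hγ hγ1 hw N ha hab hv) (hY.hasYoungIncrements_zero a b)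
        h1 h2 h3
      simpa [(hY.triadditive s t).diag_zero] using this)
  refine ⟨x, hx, fun t h1 h2 => ?_⟩
  have := hx' t h1 h2
  simpa [approx] using this

end Lift

end NLSModel

/-! ### Well-posedness from an abstract description of `H^α` -/

namespace NLSModel

variable {L : Type*} [NormedAddCommGroup L] [InnerProductSpace ℂ L] [NormedSpace ℝ L]

namespace Lift

variable {M : NLSModel L} {α γ : ℝ} {w : ℝ → ℝ} {E : Type*} [NormedAddCommGroup E]
  [NormedSpace ℝ E] (D : M.Lift α w γ E)

/-- The path with prescribed interaction representation `v`. -/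
noncomputable def path (w : ℝ → ℝ) (v : ℝ → E) (t : ℝ) : L := D.ι (D.V (w t) (v t))

theorem pullback_path (v : ℝ → E) (t : ℝ) : M.pullback w (D.path w v) t = D.ι (v t) := by
  rw [pullback, path, D.U_ι, D.V_neg]

theorem tendsto_hNorm {ι : Type*} {l : Filter ι} {f : ι → E} {g : E} :
    Tendsto (fun i => M.hNorm α (D.ι (f i) - D.ι g)) l (𝓝 0) ↔ Tendsto f l (𝓝 g) := by
  simp only [← map_sub, D.hNorm_ι]
  rw [tendsto_iff_edist_tendsto_0]
  simp only [edist_eq_enorm_sub]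

/-- A path in `C([0,T]; H^α)` lifts to `E`, in the interaction representation. -/
theorem exists_path_eq {T : ℝ} {φ : ℝ → L} (hφ : M.IsPathOn α T φ) :
    ∃ v : ℝ → E, EqOn φ (D.path w v) (Icc 0 T) := by
  have : ∀ t, t ∈ Icc 0 T → ∃ e, D.ι e = φ t := fun t ht => D.exists_of_hNorm _ (hφ t ht).1
  choose! e he using this
  exact ⟨fun t => D.V (-w t) (e t), fun t ht => by rw [path, D.V_neg', he t ht]⟩

theorem pullback_eqOn {T : ℝ} {φ : ℝ → L} {v : ℝ → E} (h : EqOn φ (D.path w v) (Icc 0 T)) :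
    EqOn (M.pullback w φ) (fun t => D.ι (v t)) (Icc 0 T) := fun t ht => by
  rw [pullback, h ht]; exact D.pullback_path v t

theorem holderSeminorm_le {T R : ℝ} {v : ℝ → E} (h : HolderBound (normSeminorm ℝ E) 0 T R v)
    {y : ℝ → L} (hy : EqOn y (fun t => D.ι (v t)) (Icc 0 T)) :
    M.holderSeminorm α T y ≤ ENNReal.ofReal R := by
  refine iSup₂_le fun s hs => iSup₂_le fun t ht => ?_
  have h0 : 0 < (t - s) ^ (1 / 2 : ℝ) := Real.rpow_pos_of_pos (by linarith [ht.1]) _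
  have hR := h.nonneg (hs.1.trans hs.2)
  rw [hy hs, hy ⟨hs.1.trans ht.1.le, ht.2⟩, ← map_sub, D.hNorm_ι,
    abs_of_pos (by linarith [ht.1])]
  refine ENNReal.div_le_of_le_mul ?_
  rw [← ENNReal.ofReal_mul hR, ← ofReal_norm]
  exact ENNReal.ofReal_le_ofReal (h.holder s t hs.1 ht.1.le ht.2)

/-- A path with finite Hölder seminorm satisfies a Hölder bound in `E`; boundedness follows from the
value at `0`. -/
theorem exists_holderBound {T : ℝ} {v : ℝ → E} {y : ℝ → L}
    (hy : EqOn y (fun t => D.ι (v t)) (Icc 0 T)) (h : M.holderSeminorm α T y < ⊤) :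
    ∃ R, HolderBound (normSeminorm ℝ E) 0 T R v := by
  set H := (M.holderSeminorm α T y).toReal with hH
  have hH0 : 0 ≤ H := ENNReal.toReal_nonneg
  have hold : ∀ s t, 0 ≤ s → s ≤ t → t ≤ T → ‖v t - v s‖ ≤ H * (t - s) ^ (1 / 2 : ℝ) := by
    intro s t h1 h2 h3
    rcases h2.eq_or_lt with rfl | hlt
    · simp
    have h0 : 0 < (t - s) ^ (1 / 2 : ℝ) := Real.rpow_pos_of_pos (by linarith) _
    have h4 : M.hNorm α (y t - y s) / ENNReal.ofReal (|t - s| ^ (1 / 2 : ℝ)) ≤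
        M.holderSeminorm α T y :=
      le_iSup₂_of_le s ⟨h1, h2.trans h3⟩ (le_iSup₂_of_le t ⟨hlt, h3⟩ le_rfl)
    rw [hy ⟨h1, h2.trans h3⟩, hy ⟨h1.trans h2, h3⟩, ← map_sub, D.hNorm_ι,
      abs_of_pos (by linarith), ENNReal.div_le_iff (by simpa using h0) ENNReal.ofReal_ne_top,
      ← ENNReal.ofReal_toReal h.ne, ← hH, ← ENNReal.ofReal_mul hH0, ← ofReal_norm,
      ENNReal.ofReal_le_ofReal_iff (by positivity)] at h4
    exact h4
  have hp : ∀ t, 0 ≤ t → t ≤ T → ‖v t‖ ≤ ‖v 0‖ + H * T ^ (1 / 2 : ℝ) := by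
    intro t h1 h2
    have e : v t = v 0 + (v t - v 0) := by abel
    rw [e]
    refine (norm_add_le _ _).trans ?_
    have := hold 0 t le_rfl h1 h2
    have h5 : (t - 0) ^ (1 / 2 : ℝ) ≤ T ^ (1 / 2 : ℝ) :=
      Real.rpow_le_rpow (by linarith) (by linarith) (by norm_num)
    nlinarith
  refine ⟨‖v 0‖ + H * T ^ (1 / 2 : ℝ) + H, fun t h1 h2 => ?_, fun s t h1 h2 h3 => ?_⟩
  · exact (hp t h1 h2).trans (by linarith)
  · refine (hold s t h1 h2 h3).trans (mul_le_mul_of_nonneg_right ?_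
      (Real.rpow_nonneg (by linarith) _))
    have := (norm_nonneg _).trans (hp s h1 (h2.trans h3))
    linarith

/-- A path with Hölder interaction representation is continuous, since the evolution is jointly
continuous. -/
theorem isControlledOn {T R : ℝ} (hw : ContinuousOn w (Ici 0)) {v : ℝ → E}
    (h : HolderBound (normSeminorm ℝ E) 0 T R v) : M.IsControlledOn α w T (D.path w v) := by
  refine ⟨fun t ht => ⟨?_, ?_⟩, ?_⟩
  · rw [path, D.hNorm_ι]; exact enorm_lt_top
  · refine D.tendsto_hNorm.2 ?_
    exact D.continuous_uncurry_V.continuousAt.tendsto.comp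
      (((hw.mono fun r hr => hr.1) t ht).tendsto.prodMk_nhds
        ((continuousOn_of_holderBound rfl h) t ht).tendsto)
  · exact (D.holderSeminorm_le h fun t _ => D.pullback_path v t).trans_lt ENNReal.ofReal_lt_top

/-- Limits of Riemann sums are unique, by evaluation on equidistant partitions. -/
theorem hasYoungIntegral_unique {y : ℝ → L} {t : ℝ} (ht : 0 ≤ t) {I I' : E}
    (h : M.HasYoungIntegral α w y t (D.ι I)) (h' : M.HasYoungIntegral α w y t (D.ι I')) :
    I = I' := by
  have key : ∀ ε : ℝ≥0∞, 0 < ε → ‖I - I'‖ₑ ≤ ε + ε := by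
    intro ε hε
    obtain ⟨δ, hδ, h⟩ := h.2 ε hε
    obtain ⟨δ', hδ', h'⟩ := h'.2 ε hε
    obtain ⟨n, hn⟩ := exists_nat_gt (t / min δ δ')
    have hm : 0 < min δ δ' := lt_min hδ hδ'
    have hn0 : (0 : ℝ) < n := lt_of_le_of_lt (by positivity) hn
    have hstep : t / n ≤ min δ δ' := by
      rw [div_lt_iff₀ hm] at hn
      rw [div_le_iff₀ hn0]; linarith
    have hd : 0 ≤ t / n := by positivity
    have hmono : Monotone fun i : ℕ => (i : ℝ) * (t / n) := fun i j hij =>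
      mul_le_mul_of_nonneg_right (by exact_mod_cast hij) hd
    have hend : (n : ℝ) * (t / n) = t := by field_simp
    have hmesh : ∀ i < n, ((i + 1 : ℕ) : ℝ) * (t / n) - (i : ℝ) * (t / n) ≤ min δ δ' := by
      intro i _; push_cast; linarith
    have a1 := h n _ hmono (by simp) hend fun i hi => (hmesh i hi).trans (min_le_left _ _)
    have a2 := h' n _ hmono (by simp) hend fun i hi => (hmesh i hi).trans (min_le_right _ _)
    set σ := ∑ i ∈ Finset.range n, M.X w ((i : ℝ) * (t / n)) (((i + 1 : ℕ) : ℝ) * (t / n))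
      (y ((i : ℝ) * (t / n))) with hσ
    -- the Riemann sum itself lies in `H^α` only if its distance to `ι I` is finite
    rcases eq_or_ne ε ⊤ with rfl | hε'
    · simp
    obtain ⟨e, he⟩ := D.exists_of_hNorm _ (a1.trans_lt hε'.lt_top)
    have a3 : σ - D.ι I' = D.ι (e + (I - I')) := by
      rw [map_add, he, map_sub]; abel
    rw [a3, D.hNorm_ι] at a2
    rw [← he, D.hNorm_ι] at a1
    have : I - I' = (e + (I - I')) - e := by abel
    rw [this]
    exact enorm_sub_le.trans (add_le_add a2 a1)
  have h0 : ‖I - I'‖ₑ = 0 := by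
    refine le_antisymm (le_of_forall_pos_le_add fun ε hε => ?_) zero_le
    rw [zero_add]
    have := key (ε / 2) (ENNReal.half_pos hε.ne')
    rwa [ENNReal.add_halves] at this
  exact sub_eq_zero.1 (enorm_eq_zero.1 h0)

/-- Uniqueness for the Young equation. -/
theorem eqOn_of_solutions (hγ : 1 / 2 < γ) {T R R' : ℝ} (hT : 0 < T) {v u : ℝ → E}
    (hv : HolderBound (normSeminorm ℝ E) 0 T R v) (hu : HolderBound (normSeminorm ℝ E) 0 T R' u)
    (hvv : HasYoungIncrements D.X γ 0 T v v) (huu : HasYoungIncrements D.X γ 0 T u u)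
    (h0 : v 0 = u 0) : EqOn v u (Icc 0 T) := by
  obtain ⟨C, hC, hX⟩ := D.exists_isYoungFamily hT
  obtain ⟨K, -, hK⟩ := hX.exists_lipschitz hγ hC hT.le (max R R')
  have := hK v u hvv huu (hv.mono le_rfl le_rfl (le_max_left _ _))
    (hu.mono le_rfl le_rfl (le_max_right _ _))
  rw [h0, sub_self, norm_zero, mul_zero] at this
  intro t ht
  have h1 := this.sup t ht.1 ht.2
  exact sub_eq_zero.1 (norm_le_zero_iff.1 h1)

/-- Solutions on `[0, T]`, with bounds that are uniform over bounded sets of initial values. -/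
theorem exists_solution [CompleteSpace E] (hγ : 1 / 2 < γ) (hγ1 : γ ≤ 1)
    (hw : ContinuousOn w (Ici 0)) {T R : ℝ} (hT : 0 < T) (hR : 0 ≤ R) :
    ∃ R' : ℝ, ∀ e : E, ‖e‖ ≤ R → ∃ v, v 0 = e ∧
      HasYoungIncrements D.X γ 0 T v v ∧ HolderBound (normSeminorm ℝ E) 0 T R' v := by
  obtain ⟨C, hC, hX⟩ := D.tame T hT
  refine hX.exists_solution hγ hC hT.le (fun a b v R ha hab _ hv => ?_)
    (fun b v R h0 hb hv hvv => ?_) hR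
  · obtain ⟨x, hx, -⟩ := D.exists_hasYoungIncrements hγ hγ1 hw ha hab hv
    exact ⟨x, hx⟩
  · exact hvv.norm_conserved (hX.isYoungFamily_norm hC) hγ (by positivity) D.ι
      (fun s t f h1 h2 _ => D.orth hw h1 h2 f) h0 hb hv

/-- Solutions on `[0, n + 1]` agree where both are defined, and so fit together to a global one. -/
theorem exists_global_solution [CompleteSpace E] (hγ : 1 / 2 < γ) (hγ1 : γ ≤ 1)
    (hw : ContinuousOn w (Ici 0)) (e : E) :
    ∃ v : ℝ → E, v 0 = e ∧ ∀ T, 0 < T → HasYoungIncrements D.X γ 0 T v v ∧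
      ∃ R, HolderBound (normSeminorm ℝ E) 0 T R v := by
  have hex : ∀ n : ℕ, ∃ v, v 0 = e ∧ HasYoungIncrements D.X γ 0 (n + 1 : ℝ) v v ∧
      ∃ R, HolderBound (normSeminorm ℝ E) 0 (n + 1 : ℝ) R v := fun n => by
    obtain ⟨R', h⟩ := D.exists_solution hγ hγ1 hw (T := n + 1) (by positivity) (norm_nonneg e)
    obtain ⟨v, h1, h2, h3⟩ := h e le_rfl
    exact ⟨v, h1, h2, R', h3⟩
  choose V h0 hVV R hV using hex
  have hcoh : ∀ n m, n ≤ m → EqOn (V m) (V n) (Icc 0 (n + 1 : ℝ)) := fun n m hnm => by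
    have hle : (n : ℝ) + 1 ≤ m + 1 := by gcongr
    exact D.eqOn_of_solutions hγ (by positivity) ((hV m).mono le_rfl hle le_rfl) (hV n)
      ((hVV m).mono le_rfl hle) (hVV n) ((h0 m).trans (h0 n).symm)
  let v : ℝ → E := fun t => V ⌈t⌉₊ t
  have hv : ∀ n : ℕ, EqOn (V n) v (Icc 0 n) := fun n t ht =>
    hcoh ⌈t⌉₊ n (Nat.ceil_le.2 ht.2) ⟨ht.1, (Nat.le_ceil t).trans (by linarith)⟩
  refine ⟨v, by simpa [v] using h0 0, fun T hT => ?_⟩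
  have hT' : T ≤ ⌈T⌉₊ := Nat.le_ceil T
  have heq : EqOn (V ⌈T⌉₊) v (Icc 0 T) := (hv _).mono (Icc_subset_Icc_right hT')
  exact ⟨((hVV ⌈T⌉₊).mono le_rfl (by linarith)).congr heq heq, R ⌈T⌉₊,
    ((hV ⌈T⌉₊).mono le_rfl (by linarith) le_rfl).congr heq⟩

variable [CompleteSpace E] [CompleteSpace L]

theorem duhamel_eq (hw : ContinuousOn w (Ici 0)) (N : ℕ) {s t : ℝ} (h1 : 0 ≤ s) (h2 : s ≤ t)
    {φ : ℝ → L} {v : ℝ → E} (hφ : EqOn φ (D.path w v) (Icc s t)) (hv : ContinuousOn v (Icc s t)) :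
    M.duhamel w N φ s t = D.ι (∫ r in s..t, D.integrand w N r (v r) (v r) (v r)) := by
  have hint : IntervalIntegrable (fun r => D.integrand w N r (v r) (v r) (v r)) volume s t := by
    refine ContinuousOn.intervalIntegrable ?_
    rw [uIcc_of_le h2]
    exact D.continuousOn_integrand hw N (fun r hr => h1.trans hr.1) hv
  rw [← ContinuousLinearMap.intervalIntegral_comp_comm D.ι hint, duhamel]
  refine intervalIntegral.integral_congr fun r hr => ?_
  rw [uIcc_of_le h2] at hr
  simp only [hφ hr, path, D.galerkin_ι, D.U_ι, integrand]

/-- For a constant interaction representation the Galerkin integrals are the truncated modulated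
operators. -/
theorem tendsto_duhamel_X (hw : ContinuousOn w (Ici 0)) {s t : ℝ} (h1 : 0 ≤ s) (h2 : s ≤ t)
    (f : E) : ∃ y : ℕ → E, (∀ N, M.duhamel w N (fun r => M.U (w r) (D.ι f)) s t = D.ι (y N)) ∧
      Tendsto y atTop (𝓝 (D.X s t f f f)) := by
  refine ⟨fun N => D.XN N s t f f f, fun N => ?_,
    D.tendsto_XN (T := t + 1) (by linarith) h1 h2 (by linarith) f⟩
  rw [D.duhamel_eq hw N h1 h2 (v := fun _ => f) (fun r _ => by rw [path, D.U_ι]) continuousOn_const]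
  congr 1
  exact D.integral_eq N s t f h1 h2

theorem X_eq (hw : ContinuousOn w (Ici 0)) {s t : ℝ} (h1 : 0 ≤ s) (h2 : s ≤ t) (f : E) :
    M.X w s t (D.ι f) = D.ι (D.X s t f f f) := by
  obtain ⟨y, hy, hl⟩ := D.tendsto_duhamel_X hw h1 h2 f
  unfold NLSModel.X
  refine Tendsto.limUnder_eq ?_
  simp only [hy]
  exact (D.ι.continuous.tendsto _).comp hl

/-- The nonlinear Young integral in the sense of Riemann sums. -/
theorem hasYoungIntegral (hγ : 1 / 2 < γ) (hw : ContinuousOn w (Ici 0)) {t : ℝ}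
    {v x : ℝ → E} (h : HasYoungIncrements D.X γ 0 t v x) {y : ℝ → L}
    (hy : EqOn y (fun t => D.ι (v t)) (Icc 0 t)) :
    M.HasYoungIntegral α w y t (D.ι (x t - x 0)) := by
  refine ⟨by rw [D.hNorm_ι]; exact enorm_lt_top, fun ε hε => ?_⟩
  obtain ⟨K, hK, h⟩ := h
  have hl : Tendsto (fun δ : ℝ => ENNReal.ofReal (K * δ ^ (γ - 1 / 2) * t)) (𝓝[>] 0) (𝓝 0) := by
    have h1 : Tendsto (fun δ : ℝ => K * δ ^ (γ - 1 / 2) * t) (𝓝[>] 0) (𝓝 0) := by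
      have h2 : Tendsto (fun δ : ℝ => δ ^ (γ - 1 / 2)) (𝓝[>] 0) (𝓝 (0 ^ (γ - 1 / 2))) :=
        ((Real.continuousAt_rpow_const 0 (γ - 1 / 2) (Or.inr (by linarith))).tendsto).mono_left
          nhdsWithin_le_nhds
      rw [Real.zero_rpow (by linarith)] at h2
      simpa using (h2.const_mul K).mul_const t
    simpa [Function.comp_def] using (ENNReal.continuous_ofReal.tendsto _).comp h1
  obtain ⟨δ, hδ, hδ0⟩ := ((hl.eventually (ge_mem_nhds hε)).and self_mem_nhdsWithin).exists
  refine ⟨δ, hδ0, fun n τ hτ h0 hn hmesh => ?_⟩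
  have e : ∑ i ∈ Finset.range n, M.X w (τ i) (τ (i + 1)) (y (τ i)) =
      D.ι (∑ i ∈ Finset.range n, D.X (τ i) (τ (i + 1)) (v (τ i)) (v (τ i)) (v (τ i))) := by
    rw [map_sum]
    refine Finset.sum_congr rfl fun i hi => ?_
    have h3 : 0 ≤ τ i := h0 ▸ hτ (Nat.zero_le i)
    rw [hy ⟨h3, hn ▸ hτ (Finset.mem_range.1 hi).le⟩, D.X_eq hw h3 (hτ (Nat.le_succ i))]
  rw [e, ← map_sub, D.hNorm_ι, ← ofReal_norm]
  refine le_trans (ENNReal.ofReal_le_ofReal ?_) hδ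
  simpa using riemannSum_sub_le hγ hK h hτ h0 hn hmesh

/-- A solution of the Young equation is a mild solution, the Galerkin integrals converging to the
Young integral. -/
theorem isMildSolutionOn (hγ : 1 / 2 < γ) (hγ1 : γ ≤ 1) (hw : ContinuousOn w (Ici 0)) {T R : ℝ}
    {v : ℝ → E} (hv : HolderBound (normSeminorm ℝ E) 0 T R v)
    (h : HasYoungIncrements D.X γ 0 T v v) :
    M.IsMildSolutionOn α w T (D.ι (v 0)) (D.path w v) := by
  refine ⟨(D.isControlledOn hw hv).1, fun t ht => ⟨D.ι (v t - v 0), ?_, ?_, ?_⟩⟩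
  · rw [D.hNorm_ι]; exact enorm_lt_top
  · have hv' := hv.mono le_rfl ht.2 le_rfl
    obtain ⟨x, hx, hl⟩ := D.exists_hasYoungIncrements hγ hγ1 hw le_rfl ht.1 hv'
    have e : x t - x 0 = v t - v 0 := hx.sub_eq hγ (h.mono le_rfl ht.2) ht.1 le_rfl
    have hl := hl t ht.1 le_rfl
    rw [e] at hl
    have hd : ∀ N, M.duhamel w N (D.path w v) 0 t = D.ι (D.approx w v 0 N t) := fun N =>
      D.duhamel_eq hw N le_rfl ht.1 (fun _ _ => rfl) (continuousOn_of_holderBound rfl hv')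
    simp only [hd]
    exact D.tendsto_hNorm.2 hl
  · rw [← map_add, D.U_ι, path]; congr 2; abel

theorem isYoungSolutionOn (hγ : 1 / 2 < γ) (hw : ContinuousOn w (Ici 0)) {T : ℝ}
    {v : ℝ → E} (h : HasYoungIncrements D.X γ 0 T v v) :
    M.IsYoungSolutionOn α w T (D.ι (v 0)) (D.path w v) := by
  intro t ht
  refine ⟨D.ι (v t - v 0), D.hasYoungIntegral hγ hw (h.mono le_rfl ht.2)
    fun t _ => D.pullback_path v t, ?_⟩
  rw [D.pullback_path, ← map_add]; congr 1; abel

/-- A controlled path that is a mild solution or solves the Young equation has the increments of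
its own nonlinear Young integral. -/
theorem hasYoungIncrements_of_solution (hγ : 1 / 2 < γ) (hγ1 : γ ≤ 1) (hw : ContinuousOn w (Ici 0))
    {T R : ℝ} (hT : 0 ≤ T) {v : ℝ → E} {e₀ : E} (hv : HolderBound (normSeminorm ℝ E) 0 T R v)
    {φ : ℝ → L} (hφ : EqOn φ (D.path w v) (Icc 0 T))
    (h : M.IsMildSolutionOn α w T (D.ι e₀) φ ∨ M.IsYoungSolutionOn α w T (D.ι e₀) φ) :
    v 0 = e₀ ∧ HasYoungIncrements D.X γ 0 T v v := by
  obtain ⟨x, hx, hl⟩ := D.exists_hasYoungIncrements hγ hγ1 hw le_rfl hT hv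
  suffices H : ∀ t ∈ Icc 0 T, v t = e₀ + (x t - x 0) by
    have h0 : v 0 = e₀ := by simpa using H 0 ⟨le_rfl, hT⟩
    refine ⟨h0, ?_⟩
    obtain ⟨K, hK, hx⟩ := hx
    refine ⟨K, hK, fun s t h1 h2 h3 => ?_⟩
    have := hx s t h1 h2 h3
    have e : v t - v s = x t - x s := by
      rw [H t ⟨h1.trans h2, h3⟩, H s ⟨h1, h2.trans h3⟩]; abel
    rwa [e]
  intro t ht
  rcases h with h | h
  · obtain ⟨Q, hQ, hlim, hQt⟩ := h.2 t ht
    obtain ⟨q, rfl⟩ := D.exists_of_hNorm _ hQ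
    have hd : ∀ N, M.duhamel w N φ 0 t = D.ι (D.approx w v 0 N t) := fun N =>
      D.duhamel_eq hw N le_rfl ht.1 (hφ.mono (Icc_subset_Icc_right ht.2))
        ((continuousOn_of_holderBound rfl hv).mono (Icc_subset_Icc_right ht.2))
    simp only [hd] at hlim
    have hq : q = x t - x 0 := tendsto_nhds_unique (D.tendsto_hNorm.1 hlim) (hl t ht.1 ht.2)
    rw [hφ ht, path, ← map_add, D.U_ι] at hQt
    have := congrArg (D.V (-w t)) (D.ι_injective hQt)
    rwa [D.V_neg, D.V_neg, hq] at this
  · obtain ⟨I, hI, hIt⟩ := h t ht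
    obtain ⟨i, rfl⟩ := D.exists_of_hNorm _ hI.1
    have hpb := D.pullback_eqOn hφ
    have hi : i = x t - x 0 := D.hasYoungIntegral_unique ht.1 hI
      (D.hasYoungIntegral hγ hw (hx.mono le_rfl ht.2)
        (hpb.mono (Icc_subset_Icc_right ht.2)))
    rw [hpb ht, ← map_add] at hIt
    rw [← hi]
    exact D.ι_injective hIt

/-- Well-posedness whenever `H^α` has a description as in `NLSModel.Lift`. The solution map is given
by the global solutions in the interaction representation; its Lipschitz constant on a ball comes
from the uniform bounds of `exists_solution`. -/
theorem globallyWellPosed (D : M.Lift α w γ E) (hγ : 1 / 2 < γ) (hγ1 : γ ≤ 1)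
    (hw : ContinuousOn w (Ici 0)) : M.GloballyWellPosed α w := by
  refine ⟨fun f hf s t h1 h2 => ?_, ?_⟩
  · obtain ⟨e, rfl⟩ := D.exists_of_hNorm f hf
    obtain ⟨y, hy, hl⟩ := D.tendsto_duhamel_X hw h1 h2 e
    simp only [hy, D.X_eq hw h1 h2]
    exact D.tendsto_hNorm.2 hl
  have hex : ∀ f, ∃ v : ℝ → E, M.hNorm α f < ⊤ → D.ι (v 0) = f ∧
      ∀ T, 0 < T → HasYoungIncrements D.X γ 0 T v v ∧
        ∃ R, HolderBound (normSeminorm ℝ E) 0 T R v := by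
    intro f
    by_cases hf : M.hNorm α f < ⊤
    · obtain ⟨e, rfl⟩ := D.exists_of_hNorm f hf
      obtain ⟨v, h0, hv⟩ := D.exists_global_solution hγ hγ1 hw e
      exact ⟨v, fun _ => ⟨by rw [h0], hv⟩⟩
    · exact ⟨0, fun h => (hf h).elim⟩
  choose v hv using hex
  refine ⟨fun f => D.path w (v f), fun f hf T hT => ?_, fun f hf T hT φ hφ hsol t ht => ?_,
    fun T hT R => ?_⟩
  · obtain ⟨h0, h⟩ := hv f hf
    obtain ⟨hvv, R, hR⟩ := h T hT
    have h1 := D.isMildSolutionOn hγ hγ1 hw hR hvv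
    have h2 := D.isYoungSolutionOn hγ hw hvv
    rw [h0] at h1 h2
    exact ⟨D.isControlledOn hw hR, h1, h2⟩
  · obtain ⟨h0, h⟩ := hv f hf
    obtain ⟨hvv, R, hR⟩ := h T hT
    obtain ⟨u, hu⟩ := D.exists_path_eq (w := w) hφ.1
    obtain ⟨R', hR'⟩ := D.exists_holderBound (D.pullback_eqOn hu) hφ.2
    rw [← h0] at hsol
    obtain ⟨hu0, huu⟩ := D.hasYoungIncrements_of_solution hγ hγ1 hw hT.le hR' hu hsol
    rw [hu ht]
    simp only [path, D.eqOn_of_solutions hγ hT hR' hR huu hvv hu0 ht]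
  · obtain ⟨C, hC, hX⟩ := D.exists_isYoungFamily hT
    obtain ⟨R', hR'⟩ := D.exists_solution hγ hγ1 hw hT R.coe_nonneg
    obtain ⟨K, hK0, hK⟩ := hX.exists_lipschitz hγ hC hT.le R'
    have hbd : ∀ f, M.hNorm α f ≤ R → M.hNorm α f < ⊤ ∧
        HolderBound (normSeminorm ℝ E) 0 T R' (v f) := by
      intro f hf
      have hf' := hf.trans_lt ENNReal.coe_lt_top
      refine ⟨hf', ?_⟩
      obtain ⟨h0, h⟩ := hv f hf'
      obtain ⟨hvv, R'', hR''⟩ := h T hT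
      have hn : ‖v f 0‖ ≤ R := by
        rw [← h0, D.hNorm_ι, enorm_le_coe] at hf
        exact_mod_cast hf
      obtain ⟨u, hu0, huu, hu⟩ := hR' _ hn
      exact hu.congr (D.eqOn_of_solutions hγ hT hu hR'' huu hvv hu0)
    refine ⟨2 * K.toNNReal, fun f g hf hg => ?_⟩
    obtain ⟨hf', hfb⟩ := hbd f hf
    obtain ⟨hg', hgb⟩ := hbd g hg
    obtain ⟨hf0, hfs⟩ := hv f hf'
    obtain ⟨hg0, hgs⟩ := hv g hg'
    have hd := hK _ _ (hfs T hT).1 (hgs T hT).1 hfb hgb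
    have hpb : ∀ t, M.pullback w (D.path w (v f) - D.path w (v g)) t = D.ι ((v f - v g) t) := by
      intro t
      have : (D.path w (v f) - D.path w (v g)) t = D.path w (v f - v g) t := by
        simp only [Pi.sub_apply, path, map_sub]
      rw [← D.pullback_path, pullback, pullback, this]
    have hrhs : M.hNorm α (f - g) = ‖v f 0 - v g 0‖ₑ := by
      rw [← D.hNorm_ι, map_sub, hf0, hg0]
    have hofReal : ENNReal.ofReal (K * ‖v f 0 - v g 0‖) = K.toNNReal * ‖v f 0 - v g 0‖ₑ := by
      rw [ENNReal.ofReal_mul hK0, ofReal_norm, ENNReal.ofReal]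
    have h1 : M.holderSeminorm α T (M.pullback w (D.path w (v f) - D.path w (v g))) ≤
        K.toNNReal * ‖v f 0 - v g 0‖ₑ :=
      hofReal ▸ D.holderSeminorm_le hd fun t _ => hpb t
    have h2 : (⨆ t ∈ Icc 0 T, M.hNorm α (M.pullback w (D.path w (v f) - D.path w (v g)) t)) ≤
        K.toNNReal * ‖v f 0 - v g 0‖ₑ := by
      refine iSup₂_le fun t ht => ?_
      rw [hpb, D.hNorm_ι, ← hofReal, ← ofReal_norm]
      exact ENNReal.ofReal_le_ofReal (hd.sup t ht.1 ht.2)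
    rw [hrhs, controlledNorm]
    refine (add_le_add h2 h1).trans (le_of_eq ?_)
    push_cast; ring

end Lift

end NLSModel

/-! ### The quadrilinear estimate -/

section Quadrilinear

variable {G : Type*} [AddCommGroup G] [MeasurableSpace G] [MeasurableAdd₂ G] [MeasurableNeg G]

/-- The decay `(1 + |Φ|)^{-ρ}` of the oscillatory integrals, in terms of the resonance function
`Φ = ξ² - ξ₁² + ξ₂² - ξ₃² = 2 (ξ - ξ₁) (ξ - ξ₃)`, in the coordinates `ξ`, `a = ξ - ξ₁`,
`b = ξ - ξ₃`. -/
noncomputable def resonanceWeight {Y : Type*} (κ : Y → ℝ) (ρ : ℝ) (z : Y × Y × Y) : ℝ :=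
  (1 + |2 * κ z.2.1 * κ z.2.2|) ^ (-ρ)

theorem resonanceWeight_pos {Y : Type*} (κ : Y → ℝ) (ρ : ℝ) (z : Y × Y × Y) :
    0 < resonanceWeight κ ρ z :=
  Real.rpow_pos_of_pos (by positivity) _

/-- The `L²` norm of a nonnegative function. -/
noncomputable def lintegralTwo {Y : Type*} [MeasurableSpace Y] (μ : Measure Y) (f : Y → ℝ≥0∞) :
    ℝ≥0∞ :=
  (∫⁻ x, f x ^ (2 : ℝ) ∂μ) ^ (1 / 2 : ℝ)

theorem lintegral_triple {Y : Type*} [MeasurableSpace Y] (μ : Measure Y) [SFinite μ]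
    {f : Y × Y × Y → ℝ≥0∞} (hf : Measurable f) :
    ∫⁻ z, f z ∂μ.prod (μ.prod μ) = ∫⁻ x, ∫⁻ a, ∫⁻ b, f (x, a, b) ∂μ ∂μ ∂μ := by
  rw [lintegral_prod _ hf.aemeasurable]
  refine lintegral_congr fun x => ?_
  rw [lintegral_prod _ (by fun_prop)]

theorem lintegral_triple_swap {Y : Type*} [MeasurableSpace Y] (μ : Measure Y) [SFinite μ]
    {f : Y × Y × Y → ℝ≥0∞} (hf : Measurable f) :
    ∫⁻ z, f (z.1, z.2.2, z.2.1) ∂μ.prod (μ.prod μ) = ∫⁻ z, f z ∂μ.prod (μ.prod μ) := by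
  rw [lintegral_triple μ (by fun_prop), lintegral_triple μ hf]
  exact lintegral_congr fun x => lintegral_lintegral_swap (by fun_prop)

theorem sq_lintegralTwo {Y : Type*} [MeasurableSpace Y] (μ : Measure Y) (f : Y → ℝ≥0∞) :
    lintegralTwo μ f ^ (2 : ℝ) = ∫⁻ x, f x ^ (2 : ℝ) ∂μ := by
  rw [lintegralTwo, ← ENNReal.rpow_mul]; norm_num

/-- The Cauchy–Schwarz inequality. -/
theorem lintegral_mul_le_lintegralTwo {Y : Type*} [MeasurableSpace Y] (μ : Measure Y)
    {f g : Y → ℝ≥0∞} (hf : Measurable f) (hg : Measurable g) {A B : ℝ≥0∞}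
    (hA : ∫⁻ x, f x ^ (2 : ℝ) ∂μ = A ^ (2 : ℝ)) (hB : ∫⁻ x, g x ^ (2 : ℝ) ∂μ = B ^ (2 : ℝ)) :
    ∫⁻ x, f x * g x ∂μ ≤ A * B := by
  have := ENNReal.lintegral_mul_le_Lp_mul_Lq μ Real.HolderConjugate.two_two hf.aemeasurable
    hg.aemeasurable
  rw [hA, hB, ← ENNReal.rpow_mul, ← ENNReal.rpow_mul] at this
  norm_num at this
  exact this

variable (μ : Measure G) [SigmaFinite μ] [μ.IsAddLeftInvariant] [μ.IsNegInvariant]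

/-- Bound for the part of the interaction where one of the frequency differences is confined to a
set of finite measure. -/
theorem lintegral_quad_left_le {f₀ f₁ f₂ f₃ p : G → ℝ≥0∞} (h₀ : Measurable f₀) (h₁ : Measurable f₁)
    (h₂ : Measurable f₂) (h₃ : Measurable f₃) (hp : Measurable p) :
    ∫⁻ z : G × G × G, f₀ z.1 * f₁ (z.1 - z.2.1) * f₂ (z.1 - z.2.1 - z.2.2) * f₃ (z.1 - z.2.2) *
      p z.2.1 ^ (2 : ℝ) ∂μ.prod (μ.prod μ) ≤
    (∫⁻ x, p x ^ (2 : ℝ) ∂μ) * (lintegralTwo μ f₀ * lintegralTwo μ f₁ * lintegralTwo μ f₂ *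
      lintegralTwo μ f₃) := by
  have e1 : ∫⁻ z : G × G × G, (f₀ z.1 * p z.2.1 * f₃ (z.1 - z.2.2)) ^ (2 : ℝ) ∂μ.prod (μ.prod μ) =
      (lintegralTwo μ f₀ * lintegralTwo μ p * lintegralTwo μ f₃) ^ (2 : ℝ) := by
    rw [lintegral_triple μ (by fun_prop)]
    simp only [ENNReal.mul_rpow_of_nonneg _ _ (by norm_num : (0 : ℝ) ≤ 2), sq_lintegralTwo]
    have : ∀ x a, ∫⁻ b, f₀ x ^ (2 : ℝ) * p a ^ (2 : ℝ) * f₃ (x - b) ^ (2 : ℝ) ∂μ =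
        f₀ x ^ (2 : ℝ) * (p a ^ (2 : ℝ) * ∫⁻ y, f₃ y ^ (2 : ℝ) ∂μ) := by
      intro x a
      rw [lintegral_const_mul _ (by fun_prop),
        lintegral_sub_left_eq_self (fun y => f₃ y ^ (2 : ℝ)) x, mul_assoc]
    simp only [this]
    have : ∀ x, ∫⁻ a, f₀ x ^ (2 : ℝ) * (p a ^ (2 : ℝ) * ∫⁻ y, f₃ y ^ (2 : ℝ) ∂μ) ∂μ =
        f₀ x ^ (2 : ℝ) * ((∫⁻ a, p a ^ (2 : ℝ) ∂μ) * ∫⁻ y, f₃ y ^ (2 : ℝ) ∂μ) := by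
      intro x
      rw [lintegral_const_mul _ (by fun_prop), lintegral_mul_const _ (by fun_prop)]
    simp only [this]
    rw [lintegral_mul_const _ (by fun_prop), mul_assoc]
  have e2 : ∫⁻ z : G × G × G, (p z.2.1 * f₁ (z.1 - z.2.1) * f₂ (z.1 - z.2.1 - z.2.2)) ^ (2 : ℝ)
      ∂μ.prod (μ.prod μ) =
      (lintegralTwo μ p * lintegralTwo μ f₁ * lintegralTwo μ f₂) ^ (2 : ℝ) := by
    rw [lintegral_triple μ (by fun_prop)]
    simp only [ENNReal.mul_rpow_of_nonneg _ _ (by norm_num : (0 : ℝ) ≤ 2), sq_lintegralTwo]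
    have : ∀ x a, ∫⁻ b, p a ^ (2 : ℝ) * f₁ (x - a) ^ (2 : ℝ) * f₂ (x - a - b) ^ (2 : ℝ) ∂μ =
        p a ^ (2 : ℝ) * f₁ (x - a) ^ (2 : ℝ) * ∫⁻ y, f₂ y ^ (2 : ℝ) ∂μ := by
      intro x a
      rw [lintegral_const_mul _ (by fun_prop),
        lintegral_sub_left_eq_self (fun y => f₂ y ^ (2 : ℝ)) (x - a)]
    simp only [this]
    rw [lintegral_lintegral_swap (by fun_prop)]
    have : ∀ a, ∫⁻ x, p a ^ (2 : ℝ) * f₁ (x - a) ^ (2 : ℝ) * ∫⁻ y, f₂ y ^ (2 : ℝ) ∂μ ∂μ =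
        p a ^ (2 : ℝ) * ((∫⁻ y, f₁ y ^ (2 : ℝ) ∂μ) * ∫⁻ y, f₂ y ^ (2 : ℝ) ∂μ) := by
      intro a
      rw [lintegral_mul_const _ (by fun_prop), lintegral_const_mul _ (by fun_prop),
        lintegral_sub_right_eq_self (fun y => f₁ y ^ (2 : ℝ)) a, mul_assoc]
    simp only [this]
    rw [lintegral_mul_const _ (by fun_prop), mul_assoc]
  have := lintegral_mul_le_lintegralTwo (μ.prod (μ.prod μ)) (by fun_prop) (by fun_prop) e1 e2
  calc _ = ∫⁻ z : G × G × G, (f₀ z.1 * p z.2.1 * f₃ (z.1 - z.2.2)) *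
        (p z.2.1 * f₁ (z.1 - z.2.1) * f₂ (z.1 - z.2.1 - z.2.2)) ∂μ.prod (μ.prod μ) := by
        refine lintegral_congr fun z => ?_
        rw [ENNReal.rpow_two]; ring
    _ ≤ _ := this
    _ = lintegralTwo μ p ^ (2 : ℝ) * (lintegralTwo μ f₀ * lintegralTwo μ f₁ * lintegralTwo μ f₂ *
      lintegralTwo μ f₃) := by rw [ENNReal.rpow_two]; ring
    _ = _ := by rw [sq_lintegralTwo]

theorem lintegral_quad_right_le {f₀ f₁ f₂ f₃ p : G → ℝ≥0∞} (h₀ : Measurable f₀)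
    (h₁ : Measurable f₁) (h₂ : Measurable f₂) (h₃ : Measurable f₃) (hp : Measurable p) :
    ∫⁻ z : G × G × G, f₀ z.1 * f₁ (z.1 - z.2.1) * f₂ (z.1 - z.2.1 - z.2.2) * f₃ (z.1 - z.2.2) *
      p z.2.2 ^ (2 : ℝ) ∂μ.prod (μ.prod μ) ≤
    (∫⁻ x, p x ^ (2 : ℝ) ∂μ) * (lintegralTwo μ f₀ * lintegralTwo μ f₁ * lintegralTwo μ f₂ *
      lintegralTwo μ f₃) := by
  rw [← lintegral_triple_swap μ (by fun_prop)]
  refine le_trans (le_of_eq ?_) ((lintegral_quad_left_le μ h₀ h₃ h₂ h₁ hp).trans (le_of_eq ?_))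
  · refine lintegral_congr fun z => ?_
    rw [sub_right_comm z.1 z.2.2 z.2.1]; ring
  · ring

/-- Bound for the nonresonant part of the interaction, where the decay of the oscillatory integral
is square summable in both frequency differences. -/
theorem lintegral_quad_both_le {f₀ f₁ f₂ f₃ m : G → ℝ≥0∞} (h₀ : Measurable f₀)
    (h₁ : Measurable f₁) (h₂ : Measurable f₂) (h₃ : Measurable f₃) (hm : Measurable m) :
    ∫⁻ z : G × G × G, f₀ z.1 * f₁ (z.1 - z.2.1) * f₂ (z.1 - z.2.1 - z.2.2) * f₃ (z.1 - z.2.2) *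
      (m z.2.1 * m z.2.2) ∂μ.prod (μ.prod μ) ≤
    (∫⁻ x, m x ^ (2 : ℝ) ∂μ) * (lintegralTwo μ f₀ * lintegralTwo μ f₁ * lintegralTwo μ f₂ *
      lintegralTwo μ f₃) := by
  have e1 : ∫⁻ z : G × G × G, (f₀ z.1 * m z.2.1 * m z.2.2) ^ (2 : ℝ) ∂μ.prod (μ.prod μ) =
      (lintegralTwo μ f₀ * lintegralTwo μ m * lintegralTwo μ m) ^ (2 : ℝ) := by
    rw [lintegral_triple μ (by fun_prop)]
    simp only [ENNReal.mul_rpow_of_nonneg _ _ (by norm_num : (0 : ℝ) ≤ 2), sq_lintegralTwo]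
    have : ∀ x, ∫⁻ a, ∫⁻ b, f₀ x ^ (2 : ℝ) * m a ^ (2 : ℝ) * m b ^ (2 : ℝ) ∂μ ∂μ =
        f₀ x ^ (2 : ℝ) * ((∫⁻ a, m a ^ (2 : ℝ) ∂μ) * ∫⁻ b, m b ^ (2 : ℝ) ∂μ) := by
      intro x
      have h : ∀ a, ∫⁻ b, f₀ x ^ (2 : ℝ) * m a ^ (2 : ℝ) * m b ^ (2 : ℝ) ∂μ =
          f₀ x ^ (2 : ℝ) * m a ^ (2 : ℝ) * ∫⁻ b, m b ^ (2 : ℝ) ∂μ := fun a => by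
        rw [lintegral_const_mul _ (by fun_prop)]
      simp only [h]
      rw [lintegral_mul_const _ (by fun_prop), lintegral_const_mul _ (by fun_prop), mul_assoc]
    simp only [this]
    rw [lintegral_mul_const _ (by fun_prop), mul_assoc]
  have e2 : ∫⁻ z : G × G × G, (f₁ (z.1 - z.2.1) * f₂ (z.1 - z.2.1 - z.2.2) * f₃ (z.1 - z.2.2)) ^
      (2 : ℝ) ∂μ.prod (μ.prod μ) =
      (lintegralTwo μ f₁ * lintegralTwo μ f₂ * lintegralTwo μ f₃) ^ (2 : ℝ) := by
    rw [lintegral_triple μ (by fun_prop)]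
    simp only [ENNReal.mul_rpow_of_nonneg _ _ (by norm_num : (0 : ℝ) ≤ 2), sq_lintegralTwo]
    -- substitute `y = x - b`, and integrate in the order `x`, `a`, `y`
    have h1 : ∀ x a,
        ∫⁻ b, f₁ (x - a) ^ (2 : ℝ) * f₂ (x - a - b) ^ (2 : ℝ) * f₃ (x - b) ^ (2 : ℝ) ∂μ =
        f₁ (x - a) ^ (2 : ℝ) * ∫⁻ y, f₂ (y - a) ^ (2 : ℝ) * f₃ y ^ (2 : ℝ) ∂μ := by
      intro x a
      rw [← lintegral_sub_left_eq_self (fun y => f₂ (y - a) ^ (2 : ℝ) * f₃ y ^ (2 : ℝ)) x,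
        ← lintegral_const_mul _ (by fun_prop)]
      refine lintegral_congr fun b => ?_
      rw [sub_right_comm x a b, mul_assoc]
    simp only [h1]
    rw [lintegral_lintegral_swap (by fun_prop)]
    have h2 : ∀ a, ∫⁻ x, f₁ (x - a) ^ (2 : ℝ) * ∫⁻ y, f₂ (y - a) ^ (2 : ℝ) * f₃ y ^ (2 : ℝ) ∂μ ∂μ =
        (∫⁻ x, f₁ x ^ (2 : ℝ) ∂μ) * ∫⁻ y, f₂ (y - a) ^ (2 : ℝ) * f₃ y ^ (2 : ℝ) ∂μ := by
      intro a
      rw [lintegral_mul_const _ (by fun_prop),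
        lintegral_sub_right_eq_self (fun y => f₁ y ^ (2 : ℝ)) a]
    simp only [h2]
    rw [lintegral_const_mul _ (by fun_prop), lintegral_lintegral_swap (by fun_prop)]
    have h3 : ∀ y, ∫⁻ a, f₂ (y - a) ^ (2 : ℝ) * f₃ y ^ (2 : ℝ) ∂μ =
        (∫⁻ x, f₂ x ^ (2 : ℝ) ∂μ) * f₃ y ^ (2 : ℝ) := by
      intro y
      rw [lintegral_mul_const _ (by fun_prop),
        lintegral_sub_left_eq_self (fun x => f₂ x ^ (2 : ℝ)) y]
    simp only [h3]
    rw [lintegral_const_mul _ (by fun_prop), mul_assoc]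
  have := lintegral_mul_le_lintegralTwo (μ.prod (μ.prod μ)) (by fun_prop) (by fun_prop) e1 e2
  calc _ = ∫⁻ z : G × G × G, (f₀ z.1 * m z.2.1 * m z.2.2) *
        (f₁ (z.1 - z.2.1) * f₂ (z.1 - z.2.1 - z.2.2) * f₃ (z.1 - z.2.2)) ∂μ.prod (μ.prod μ) := by
        refine lintegral_congr fun z => ?_
        ring
    _ ≤ _ := this
    _ = lintegralTwo μ m ^ (2 : ℝ) * (lintegralTwo μ f₀ * lintegralTwo μ f₁ * lintegralTwo μ f₂ *
      lintegralTwo μ f₃) := by rw [ENNReal.rpow_two]; ring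
    _ = _ := by rw [sq_lintegralTwo]

/-- `κ : G → ℝ` gives the frequency of the characters of a domain with dual group `(G, μ)`: bounded
sets of frequencies have finite measure, and `|κ|^{-ρ}` is square integrable at infinity. -/
structure IsFrequencyMap (κ : G → ℝ) (ρ : ℝ) : Prop where
  measurable : Measurable κ
  map_sub : ∀ x y, κ (x - y) = κ x - κ y
  measure_lt_top : ∀ r : ℝ, μ {x | |κ x| ≤ r} < ⊤
  tail : ∫⁻ x in {x | 1 ≤ |κ x|}, ENNReal.ofReal (|κ x| ^ (-ρ)) ^ (2 : ℝ) ∂μ < ⊤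

variable {μ} in
/-- The quadrilinear `L²` estimate behind the boundedness of the modulated operator. -/
theorem IsFrequencyMap.exists_quad_bound {κ : G → ℝ} {ρ : ℝ} (hκ : IsFrequencyMap μ κ ρ)
    (hρ : 0 < ρ) : ∃ C : ℝ≥0∞, C < ⊤ ∧ ∀ f₀ f₁ f₂ f₃ : G → ℝ≥0∞, Measurable f₀ → Measurable f₁ →
      Measurable f₂ → Measurable f₃ →
      ∫⁻ z : G × G × G, f₀ z.1 * f₁ (z.1 - z.2.1) * f₂ (z.1 - z.2.1 - z.2.2) * f₃ (z.1 - z.2.2) *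
        ENNReal.ofReal (resonanceWeight κ ρ z) ∂μ.prod (μ.prod μ) ≤
      C * (lintegralTwo μ f₀ * lintegralTwo μ f₁ * lintegralTwo μ f₂ * lintegralTwo μ f₃) := by
  have hκm := hκ.measurable
  have hS : MeasurableSet {x | |κ x| ≤ 1} := measurableSet_le (by fun_prop) measurable_const
  have hS' : MeasurableSet {x | 1 ≤ |κ x|} := measurableSet_le measurable_const (by fun_prop)
  set p : G → ℝ≥0∞ := {x | |κ x| ≤ 1}.indicator 1 with hp
  set m : G → ℝ≥0∞ := {x | 1 ≤ |κ x|}.indicator fun x => ENNReal.ofReal (|κ x| ^ (-ρ)) with hm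
  have hpm : Measurable p := measurable_one.indicator hS
  have hmm : Measurable m := Measurable.indicator (by fun_prop) hS'
  have hp2 : ∫⁻ x, p x ^ (2 : ℝ) ∂μ < ⊤ := by
    have : ∀ x, p x ^ (2 : ℝ) = {x | |κ x| ≤ 1}.indicator 1 x := fun x => by
      by_cases h : |κ x| ≤ 1 <;> simp [hp, indicator, h]
    simp only [this]
    rw [lintegral_indicator_one hS]
    exact hκ.measure_lt_top 1
  have hm2 : ∫⁻ x, m x ^ (2 : ℝ) ∂μ < ⊤ := by
    have : ∀ x, m x ^ (2 : ℝ) = {x | 1 ≤ |κ x|}.indicator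
        (fun x => ENNReal.ofReal (|κ x| ^ (-ρ)) ^ (2 : ℝ)) x := fun x => by
      by_cases h : 1 ≤ |κ x| <;> simp [hm, indicator, h]
    simp only [this]
    rw [lintegral_indicator hS']
    exact hκ.tail
  refine ⟨(∫⁻ x, p x ^ (2 : ℝ) ∂μ) + (∫⁻ x, p x ^ (2 : ℝ) ∂μ) + ∫⁻ x, m x ^ (2 : ℝ) ∂μ,
    ENNReal.add_lt_top.2 ⟨ENNReal.add_lt_top.2 ⟨hp2, hp2⟩, hm2⟩, fun f₀ f₁ f₂ f₃ h₀ h₁ h₂ h₃ => ?_⟩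
  -- the three regions: one of the differences is at most `1`, or both are at least `1`
  have hW : ∀ z, ENNReal.ofReal (resonanceWeight κ ρ z) ≤
      p z.2.1 ^ (2 : ℝ) + p z.2.2 ^ (2 : ℝ) + m z.2.1 * m z.2.2 := by
    intro z
    have hle1 : ENNReal.ofReal (resonanceWeight κ ρ z) ≤ 1 := by
      rw [← ENNReal.ofReal_one]
      refine ENNReal.ofReal_le_ofReal (Real.rpow_le_one_of_one_le_of_nonpos ?_ (by linarith))
      linarith [abs_nonneg (2 * κ z.2.1 * κ z.2.2)]
    by_cases ha : |κ z.2.1| ≤ 1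
    · refine hle1.trans ?_
      have : p z.2.1 = 1 := by simp [hp, ha]
      rw [this, ENNReal.one_rpow, add_assoc]
      exact le_self_add
    by_cases hb : |κ z.2.2| ≤ 1
    · refine hle1.trans ?_
      have : p z.2.2 = 1 := by simp [hp, hb]
      rw [this, ENNReal.one_rpow, add_comm (p z.2.1 ^ (2 : ℝ)), add_assoc]
      exact le_self_add
    push Not at ha hb
    have h1 : m z.2.1 = ENNReal.ofReal (|κ z.2.1| ^ (-ρ)) := by simp [hm, ha.le]
    have h2 : m z.2.2 = ENNReal.ofReal (|κ z.2.2| ^ (-ρ)) := by simp [hm, hb.le]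
    refine le_trans ?_ le_add_self
    rw [h1, h2, ← ENNReal.ofReal_mul (by positivity),
      ← Real.mul_rpow (by positivity) (by positivity)]
    refine ENNReal.ofReal_le_ofReal
      (Real.rpow_le_rpow_of_nonpos (by positivity) ?_ (by linarith))
    rw [abs_mul, abs_mul, abs_two]
    nlinarith [mul_pos (zero_lt_one.trans ha) (zero_lt_one.trans hb)]
  calc _ ≤ ∫⁻ z : G × G × G,
        (f₀ z.1 * f₁ (z.1 - z.2.1) * f₂ (z.1 - z.2.1 - z.2.2) * f₃ (z.1 - z.2.2) *
          p z.2.1 ^ (2 : ℝ) +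
        f₀ z.1 * f₁ (z.1 - z.2.1) * f₂ (z.1 - z.2.1 - z.2.2) * f₃ (z.1 - z.2.2) *
          p z.2.2 ^ (2 : ℝ)) +
        f₀ z.1 * f₁ (z.1 - z.2.1) * f₂ (z.1 - z.2.1 - z.2.2) * f₃ (z.1 - z.2.2) *
          (m z.2.1 * m z.2.2) ∂μ.prod (μ.prod μ) := by
        refine lintegral_mono fun z => ?_
        rw [← mul_add, ← mul_add]
        exact mul_le_mul_right (hW z) _
    _ ≤ _ := by
        rw [lintegral_add_left (by fun_prop), lintegral_add_left (by fun_prop), add_mul, add_mul]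
        exact add_le_add (add_le_add (lintegral_quad_left_le μ h₀ h₁ h₂ h₃ hpm)
          (lintegral_quad_right_le μ h₀ h₁ h₂ h₃ hpm)) (lintegral_quad_both_le μ h₀ h₁ h₂ h₃ hmm)

end Quadrilinear

/-! ### Multipliers on `L²` -/

section Multipliers

variable {G : Type*} [MeasurableSpace G] {μ : Measure G}

/-- A bounded measurable function. -/
structure IsMultiplier (C : ℝ) (m : G → ℂ) : Prop where
  measurable : Measurable m
  bound : ∀ x, ‖m x‖ ≤ C

theorem IsMultiplier.memLp {C : ℝ} {m : G → ℂ} (h : IsMultiplier C m) (f : Lp ℂ 2 μ) :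
    MemLp (fun x => m x * f x) 2 μ :=
  (Lp.memLp f).of_le_mul (c := C)
    (h.measurable.aestronglyMeasurable.mul (Lp.aestronglyMeasurable f))
    (Eventually.of_forall fun x => by
      rw [norm_mul]; exact mul_le_mul_of_nonneg_right (h.bound x) (norm_nonneg _))

/-- Multiplication by a bounded measurable function on `L²` (and `0` for other functions). -/
noncomputable def mulOp (μ : Measure G) (m : G → ℂ) : Lp ℂ 2 μ →L[ℂ] Lp ℂ 2 μ :=
  open Classical in
  if h : ∃ C, IsMultiplier C m then
    LinearMap.mkContinuous
      { toFun := fun f => (h.choose_spec.memLp f).toLp _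
        map_add' := fun f g => by
          ext1
          filter_upwards [(h.choose_spec.memLp (f + g)).coeFn_toLp, Lp.coeFn_add f g,
            Lp.coeFn_add ((h.choose_spec.memLp f).toLp _) ((h.choose_spec.memLp g).toLp _),
            (h.choose_spec.memLp f).coeFn_toLp, (h.choose_spec.memLp g).coeFn_toLp]
            with x h1 h2 h3 h4 h5
          rw [h1, h3, Pi.add_apply, h4, h5, h2, Pi.add_apply, mul_add]
        map_smul' := fun c f => by
          ext1
          filter_upwards [(h.choose_spec.memLp (c • f)).coeFn_toLp, Lp.coeFn_smul c f,
            Lp.coeFn_smul c ((h.choose_spec.memLp f).toLp _),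
            (h.choose_spec.memLp f).coeFn_toLp] with x h1 h2 h3 h4
          rw [h1, RingHom.id_apply, h3, Pi.smul_apply, h4, h2, Pi.smul_apply, smul_eq_mul,
            smul_eq_mul, mul_left_comm] }
      h.choose fun f => by
        refine Lp.norm_le_mul_norm_of_ae_le_mul ?_
        filter_upwards [(h.choose_spec.memLp f).coeFn_toLp] with x hx
        simp only [LinearMap.coe_mk, AddHom.coe_mk, hx, norm_mul]
        exact mul_le_mul_of_nonneg_right (h.choose_spec.bound x) (norm_nonneg _)
  else 0

theorem IsMultiplier.coeFn {C : ℝ} {m : G → ℂ} (h : IsMultiplier C m) (f : Lp ℂ 2 μ) :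
    mulOp μ m f =ᵐ[μ] fun x => m x * f x := by
  have h' : ∃ C, IsMultiplier C m := ⟨C, h⟩
  rw [mulOp, dif_pos h']
  exact (h'.choose_spec.memLp f).coeFn_toLp

theorem IsMultiplier.norm_mulOp_le {C : ℝ} {m : G → ℂ} (h : IsMultiplier C m) (f : Lp ℂ 2 μ) :
    ‖mulOp μ m f‖ ≤ C * ‖f‖ := by
  refine Lp.norm_le_mul_norm_of_ae_le_mul ?_
  filter_upwards [h.coeFn f] with x hx
  rw [hx, norm_mul]
  exact mul_le_mul_of_nonneg_right (h.bound x) (norm_nonneg _)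

theorem IsMultiplier.mul {C C' : ℝ} {m m' : G → ℂ} (h : IsMultiplier C m)
    (h' : IsMultiplier C' m') : IsMultiplier (C * C') (fun x => m x * m' x) where
  measurable := h.measurable.mul h'.measurable
  bound x := by
    rw [norm_mul]
    exact mul_le_mul (h.bound x) (h'.bound x) (norm_nonneg _) ((norm_nonneg _).trans (h.bound x))

theorem IsMultiplier.conj {C : ℝ} {m : G → ℂ} (h : IsMultiplier C m) :
    IsMultiplier C (fun x => conj (m x)) where
  measurable := Complex.continuous_conj.measurable.comp h.measurable
  bound x := by rw [RCLike.norm_conj]; exact h.bound x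

theorem IsMultiplier.mulOp_mulOp {C C' : ℝ} {m m' : G → ℂ} (h : IsMultiplier C m)
    (h' : IsMultiplier C' m') (f : Lp ℂ 2 μ) :
    mulOp μ m (mulOp μ m' f) = mulOp μ (fun x => m x * m' x) f := by
  ext1
  filter_upwards [h.coeFn (mulOp μ m' f), h'.coeFn f, (h.mul h').coeFn f] with x h1 h2 h3
  rw [h1, h2, h3, mul_assoc]

theorem IsMultiplier.inner_mulOp {C : ℝ} {m : G → ℂ} (h : IsMultiplier C m) (f g : Lp ℂ 2 μ) :
    inner ℂ f (mulOp μ m g) = inner ℂ (mulOp μ (fun x => conj (m x)) f) g := by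
  rw [L2.inner_def, L2.inner_def]
  refine integral_congr_ae ?_
  filter_upwards [h.coeFn g, h.conj.coeFn f] with x h1 h2
  rw [h1, h2]
  simp only [RCLike.inner_apply, map_mul, RingHomCompTriple.comp_apply, RingHom.id_apply]
  ring

/-- If uniformly bounded multipliers converge pointwise, the operators converge strongly. -/
theorem tendsto_mulOp {ι : Type*} {l : Filter ι} [l.IsCountablyGenerated] {C : ℝ} {m : ι → G → ℂ}
    {m' : G → ℂ} (h : ∀ i, IsMultiplier C (m i)) (h' : IsMultiplier C m')
    (hl : ∀ x, Tendsto (fun i => m i x) l (𝓝 (m' x))) (f : Lp ℂ 2 μ) :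
    Tendsto (fun i => mulOp μ (m i) f) l (𝓝 (mulOp μ m' f)) := by
  rw [Lp.tendsto_Lp_iff_tendsto_eLpNorm']
  have e : ∀ i, eLpNorm (⇑(mulOp μ (m i) f) - ⇑(mulOp μ m' f)) 2 μ =
      (∫⁻ x, ‖(m i x - m' x) * f x‖ₑ ^ (2 : ℝ) ∂μ) ^ (1 / 2 : ℝ) := by
    intro i
    rw [eLpNorm_eq_lintegral_rpow_enorm_toReal two_ne_zero ENNReal.ofNat_ne_top]
    simp only [ENNReal.toReal_ofNat]
    congr 1
    refine lintegral_congr_ae ?_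
    filter_upwards [(h i).coeFn f, h'.coeFn f] with x h1 h2
    rw [Pi.sub_apply, h1, h2, sub_mul]
  simp only [e]
  have hfin : ∫⁻ x, (ENNReal.ofReal (2 * C) * ‖f x‖ₑ) ^ (2 : ℝ) ∂μ ≠ ⊤ := by
    simp only [ENNReal.mul_rpow_of_nonneg _ _ (by norm_num : (0 : ℝ) ≤ 2)]
    rw [lintegral_const_mul' _ _ (by finiteness)]
    refine ENNReal.mul_ne_top (by finiteness) ?_
    have := Lp.eLpNorm_ne_top f
    rw [eLpNorm_eq_lintegral_rpow_enorm_toReal two_ne_zero ENNReal.ofNat_ne_top] at this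
    simp only [ENNReal.toReal_ofNat] at this
    intro h0
    rw [h0] at this
    simp at this
  have hlim : Tendsto (fun i => ∫⁻ x, ‖(m i x - m' x) * f x‖ₑ ^ (2 : ℝ) ∂μ) l
      (𝓝 (∫⁻ _, 0 ∂μ)) := by
    refine tendsto_lintegral_filter_of_dominated_convergence
      (fun x => (ENNReal.ofReal (2 * C) * ‖f x‖ₑ) ^ (2 : ℝ)) ?_ ?_ hfin ?_
    · refine Eventually.of_forall fun i => ?_
      have := ((h i).measurable.sub h'.measurable).mul (Lp.stronglyMeasurable f).measurable
      exact (this.enorm.pow_const _)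
    · refine Eventually.of_forall fun i => Eventually.of_forall fun x => ?_
      refine ENNReal.rpow_le_rpow ?_ (by norm_num)
      rw [enorm_mul]
      refine mul_le_mul_left ?_ _
      rw [← ofReal_norm]
      refine ENNReal.ofReal_le_ofReal ((norm_sub_le _ _).trans ?_)
      linarith [(h i).bound x, h'.bound x]
    · refine Eventually.of_forall fun x => ?_
      have h1 : Tendsto (fun i => (m i x - m' x) * f x) l (𝓝 ((m' x - m' x) * f x)) :=
        ((hl x).sub_const _).mul_const _
      rw [sub_self, zero_mul] at h1
      have h2 := (h1.enorm).ennrpow_const 2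
      simpa using h2
  have := hlim.ennrpow_const (1 / 2)
  simpa using this

theorem lintegralTwo_enorm (f : Lp ℂ 2 μ) : lintegralTwo μ (fun x => ‖f x‖ₑ) = ‖f‖ₑ := by
  rw [Lp.enorm_def, eLpNorm_eq_lintegral_rpow_enorm_toReal two_ne_zero ENNReal.ofNat_ne_top,
    lintegralTwo, ENNReal.toReal_ofNat]

theorem isMultiplier_one : IsMultiplier 1 (fun _ : G => (1 : ℂ)) := ⟨measurable_const, by simp⟩

theorem mulOp_one (f : Lp ℂ 2 μ) : mulOp μ (fun _ => 1) f = f := by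
  ext1
  filter_upwards [isMultiplier_one.coeFn f] with x hx
  rw [hx, one_mul]

end Multipliers

/-! ### Trilinear operators given by kernels -/

section QuadForm

variable {G : Type*} [AddCommGroup G]

/-- The product `conj f₀(ξ) f₁(ξ₁) conj f₂(ξ₂) f₃(ξ₃)` with `ξ = ξ₁ - ξ₂ + ξ₃`, in the coordinates
`(ξ, a, b)` with `ξ₁ = ξ - a`, `ξ₃ = ξ - b` and hence `ξ₂ = ξ - a - b`. -/
noncomputable def quadProd (f₀ f₁ f₂ f₃ : G → ℂ) (z : G × G × G) : ℂ :=
  conj (f₀ z.1) * f₁ (z.1 - z.2.1) * conj (f₂ (z.1 - z.2.1 - z.2.2)) * f₃ (z.1 - z.2.2)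

theorem quadProd_mul (m₀ m₁ m₂ m₃ f₀ f₁ f₂ f₃ : G → ℂ) (z : G × G × G) :
    quadProd (fun x => m₀ x * f₀ x) (fun x => m₁ x * f₁ x) (fun x => m₂ x * f₂ x)
      (fun x => m₃ x * f₃ x) z = quadProd m₀ m₁ m₂ m₃ z * quadProd f₀ f₁ f₂ f₃ z := by
  simp only [quadProd, map_mul]; ring

theorem quadProd_add_left (f g f₁ f₂ f₃ : G → ℂ) (z : G × G × G) :
    quadProd (f + g) f₁ f₂ f₃ z = quadProd f f₁ f₂ f₃ z + quadProd g f₁ f₂ f₃ z := by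
  simp only [quadProd, Pi.add_apply, map_add]; ring

theorem enorm_quadProd (f₀ f₁ f₂ f₃ : G → ℂ) (z : G × G × G) : ‖quadProd f₀ f₁ f₂ f₃ z‖ₑ =
    ‖f₀ z.1‖ₑ * ‖f₁ (z.1 - z.2.1)‖ₑ * ‖f₂ (z.1 - z.2.1 - z.2.2)‖ₑ * ‖f₃ (z.1 - z.2.2)‖ₑ := by
  have hc : ∀ x : ℂ, ‖conj x‖ₑ = ‖x‖ₑ := fun x => by
    rw [← ofReal_norm, ← ofReal_norm, RCLike.norm_conj]
  simp only [quadProd, enorm_mul, hc]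

variable [MeasurableSpace G]

/-- The quadrilinear form with kernel `k`. -/
noncomputable def quadForm (μ : Measure G) (k : G × G × G → ℂ) (f₀ f₁ f₂ f₃ : G → ℂ) : ℂ :=
  ∫ z, k z * quadProd f₀ f₁ f₂ f₃ z ∂μ.prod (μ.prod μ)

/-- A measurable kernel that decays like `(1 + |Φ|)^{-ρ}` in the resonance function `Φ`. -/
structure IsKernel (κ : G → ℝ) (ρ C : ℝ) (k : G × G × G → ℂ) : Prop where
  measurable : Measurable k
  bound : ∀ z, ‖k z‖ ≤ C * resonanceWeight κ ρ z

theorem IsKernel.nonneg {κ : G → ℝ} {ρ C : ℝ} {k : G × G × G → ℂ} (h : IsKernel κ ρ C k) :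
    0 ≤ C := by
  by_contra hC
  push Not at hC
  have h1 := h.bound 0
  have h2 := resonanceWeight_pos κ ρ (0 : G × G × G)
  have := norm_nonneg (k 0)
  nlinarith

theorem IsKernel.enorm_le {κ : G → ℝ} {ρ C : ℝ} {k : G × G × G → ℂ} (hk : IsKernel κ ρ C k)
    (z : G × G × G) : ‖k z‖ₑ ≤ ENNReal.ofReal C * ENNReal.ofReal (resonanceWeight κ ρ z) := by
  rw [← ENNReal.ofReal_mul hk.nonneg, ← ofReal_norm]
  exact ENNReal.ofReal_le_ofReal (hk.bound z)

variable [MeasurableAdd₂ G] [MeasurableNeg G]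

theorem measurable_quadProd {f₀ f₁ f₂ f₃ : G → ℂ} (h₀ : Measurable f₀) (h₁ : Measurable f₁)
    (h₂ : Measurable f₂) (h₃ : Measurable f₃) : Measurable (quadProd f₀ f₁ f₂ f₃) := by
  have hc := Complex.continuous_conj.measurable
  unfold quadProd
  fun_prop

variable {μ : Measure G} [SigmaFinite μ] [μ.IsAddLeftInvariant] [μ.IsNegInvariant]

/-- A property that holds almost everywhere on `G` holds for all four arguments of `quadProd`,
almost everywhere. -/
theorem ae_quad {P : G → Prop} (h : ∀ᵐ x ∂μ, P x) : ∀ᵐ z ∂μ.prod (μ.prod μ),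
    P z.1 ∧ P (z.1 - z.2.1) ∧ P (z.1 - z.2.1 - z.2.2) ∧ P (z.1 - z.2.2) := by
  have key : ∀ φ : G × G × G → G, Measurable φ →
      (∀ g : G → ℝ≥0∞, Measurable g → ∫⁻ x, g x ∂μ = 0 →
        ∫⁻ x, ∫⁻ a, ∫⁻ b, g (φ (x, a, b)) ∂μ ∂μ ∂μ = 0) →
      ∀ᵐ z ∂μ.prod (μ.prod μ), P (φ z) := by
    intro φ hφ hg
    have hq : Measure.QuasiMeasurePreserving φ (μ.prod (μ.prod μ)) μ := by
      refine ⟨hφ, Measure.AbsolutelyContinuous.mk fun s hs h0 => ?_⟩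
      rw [Measure.map_apply hφ hs, ← lintegral_indicator_one (hφ hs),
        lintegral_triple μ (measurable_one.indicator (hφ hs))]
      exact hg (s.indicator 1) (measurable_one.indicator hs)
        (by rw [lintegral_indicator_one hs, h0])
    exact hq.ae h
  have k0 := key (fun z => z.1) (by fun_prop) fun g hg h0 => by
    have : ∀ x, ∫⁻ _a, ∫⁻ _b, g x ∂μ ∂μ = g x * (μ univ * μ univ) := fun x => by
      rw [lintegral_const, lintegral_const, mul_assoc]
    simp only [this]
    rw [lintegral_mul_const _ hg, h0, zero_mul]
  have k1 := key (fun z => z.1 - z.2.1) (by fun_prop) fun g hg h0 => by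
    have : ∀ x, ∫⁻ a, ∫⁻ _b, g (x - a) ∂μ ∂μ = 0 := fun x => by
      simp only [lintegral_const]
      rw [lintegral_mul_const _ (by fun_prop), lintegral_sub_left_eq_self g x, h0, zero_mul]
    simp only [this, lintegral_zero]
  have k2 := key (fun z => z.1 - z.2.1 - z.2.2) (by fun_prop) fun g hg h0 => by
    simp only [lintegral_sub_left_eq_self g, h0, lintegral_zero]
  have k3 := key (fun z => z.1 - z.2.2) (by fun_prop) fun g hg h0 => by
    simp only [lintegral_sub_left_eq_self g, h0, lintegral_zero]
  filter_upwards [k0, k1, k2, k3] with z h0 h1 h2 h3 using ⟨h0, h1, h2, h3⟩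

theorem quadProd_congr {f₀ f₁ f₂ f₃ g₀ g₁ g₂ g₃ : G → ℂ} (h₀ : f₀ =ᵐ[μ] g₀) (h₁ : f₁ =ᵐ[μ] g₁)
    (h₂ : f₂ =ᵐ[μ] g₂) (h₃ : f₃ =ᵐ[μ] g₃) :
    quadProd f₀ f₁ f₂ f₃ =ᵐ[μ.prod (μ.prod μ)] quadProd g₀ g₁ g₂ g₃ := by
  filter_upwards [ae_quad h₀, ae_quad h₁, ae_quad h₂, ae_quad h₃] with z e0 e1 e2 e3
  rw [quadProd, quadProd, e0.1, e1.2.1, e2.2.2.1, e3.2.2.2]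

theorem quadForm_congr (k : G × G × G → ℂ) {f₀ f₁ f₂ f₃ g₀ g₁ g₂ g₃ : G → ℂ} (h₀ : f₀ =ᵐ[μ] g₀)
    (h₁ : f₁ =ᵐ[μ] g₁) (h₂ : f₂ =ᵐ[μ] g₂) (h₃ : f₃ =ᵐ[μ] g₃) :
    quadForm μ k f₀ f₁ f₂ f₃ = quadForm μ k g₀ g₁ g₂ g₃ := by
  refine integral_congr_ae ?_
  filter_upwards [quadProd_congr h₀ h₁ h₂ h₃] with z hz
  rw [hz]

/-- Multipliers acting on the arguments of the form can be moved into the kernel. -/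
theorem quadForm_mulOp (k : G × G × G → ℂ) {C₀ C₁ C₂ C₃ : ℝ} {m₀ m₁ m₂ m₃ : G → ℂ}
    (h₀ : IsMultiplier C₀ m₀) (h₁ : IsMultiplier C₁ m₁) (h₂ : IsMultiplier C₂ m₂)
    (h₃ : IsMultiplier C₃ m₃) (f₀ f₁ f₂ f₃ : Lp ℂ 2 μ) :
    quadForm μ k (mulOp μ m₀ f₀) (mulOp μ m₁ f₁) (mulOp μ m₂ f₂) (mulOp μ m₃ f₃) =
      quadForm μ (fun z => k z * quadProd m₀ m₁ m₂ m₃ z) f₀ f₁ f₂ f₃ := by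
  rw [quadForm_congr k (h₀.coeFn f₀) (h₁.coeFn f₁) (h₂.coeFn f₂) (h₃.coeFn f₃)]
  refine integral_congr_ae (Eventually.of_forall fun z => ?_)
  simp only [quadProd_mul, mul_assoc]

/-- The quadrilinear estimate for elements of `L²`. -/
theorem IsFrequencyMap.exists_quad_const {κ : G → ℝ} {ρ : ℝ} (hκ : IsFrequencyMap μ κ ρ)
    (hρ : 0 < ρ) : ∃ C : ℝ, 0 ≤ C ∧ ∀ f₀ f₁ f₂ f₃ : Lp ℂ 2 μ,
      ∫⁻ z, ‖quadProd f₀ f₁ f₂ f₃ z‖ₑ * ENNReal.ofReal (resonanceWeight κ ρ z) ∂μ.prod (μ.prod μ) ≤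
      ENNReal.ofReal (C * (‖f₀‖ * ‖f₁‖ * ‖f₂‖ * ‖f₃‖)) := by
  obtain ⟨C, hC, h⟩ := hκ.exists_quad_bound hρ
  refine ⟨C.toReal, ENNReal.toReal_nonneg, fun f₀ f₁ f₂ f₃ => ?_⟩
  have hm : ∀ f : Lp ℂ 2 μ, Measurable fun x => ‖f x‖ₑ := fun f =>
    (Lp.stronglyMeasurable f).measurable.enorm
  have := h _ _ _ _ (hm f₀) (hm f₁) (hm f₂) (hm f₃)
  simp only [lintegralTwo_enorm] at this
  simp only [enorm_quadProd]
  refine this.trans (le_of_eq ?_)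
  rw [ENNReal.ofReal_mul ENNReal.toReal_nonneg, ENNReal.ofReal_toReal hC.ne,
    ENNReal.ofReal_mul (by positivity), ENNReal.ofReal_mul (by positivity),
    ENNReal.ofReal_mul (by positivity)]
  simp only [ofReal_norm]

theorem IsKernel.integrable {κ : G → ℝ} {ρ C : ℝ} {k : G × G × G → ℂ} (hk : IsKernel κ ρ C k)
    (hκ : IsFrequencyMap μ κ ρ) (hρ : 0 < ρ) (f₀ f₁ f₂ f₃ : Lp ℂ 2 μ) :
    Integrable (fun z => k z * quadProd f₀ f₁ f₂ f₃ z) (μ.prod (μ.prod μ)) := by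
  obtain ⟨C₀, hC₀, h⟩ := hκ.exists_quad_const hρ
  have hm : ∀ f : Lp ℂ 2 μ, Measurable f := fun f => (Lp.stronglyMeasurable f).measurable
  refine ⟨(hk.measurable.mul (measurable_quadProd (hm f₀) (hm f₁) (hm f₂)
    (hm f₃))).aestronglyMeasurable, ?_⟩
  calc ∫⁻ z, ‖k z * quadProd f₀ f₁ f₂ f₃ z‖ₑ ∂μ.prod (μ.prod μ)
      ≤ ∫⁻ z, ENNReal.ofReal C * (‖quadProd f₀ f₁ f₂ f₃ z‖ₑ *
          ENNReal.ofReal (resonanceWeight κ ρ z)) ∂μ.prod (μ.prod μ) := by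
        refine lintegral_mono fun z => ?_
        rw [enorm_mul, mul_comm (‖quadProd f₀ f₁ f₂ f₃ z‖ₑ), ← mul_assoc]
        exact mul_le_mul_left (hk.enorm_le z) _
    _ = ENNReal.ofReal C * ∫⁻ z, ‖quadProd f₀ f₁ f₂ f₃ z‖ₑ *
          ENNReal.ofReal (resonanceWeight κ ρ z) ∂μ.prod (μ.prod μ) :=
        lintegral_const_mul' _ _ ENNReal.ofReal_ne_top
    _ < ⊤ := ENNReal.mul_lt_top ENNReal.ofReal_lt_top
        ((h f₀ f₁ f₂ f₃).trans_lt ENNReal.ofReal_lt_top)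

/-- Forms given by kernels are bounded on `L²`, linearly in the constant of the kernel. -/
theorem IsFrequencyMap.exists_quadForm_bound {κ : G → ℝ} {ρ : ℝ} (hκ : IsFrequencyMap μ κ ρ)
    (hρ : 0 < ρ) : ∃ C₀ : ℝ, 0 ≤ C₀ ∧ ∀ C k, IsKernel κ ρ C k → ∀ f₀ f₁ f₂ f₃ : Lp ℂ 2 μ,
      ‖quadForm μ k f₀ f₁ f₂ f₃‖ ≤ C₀ * C * (‖f₀‖ * ‖f₁‖ * ‖f₂‖ * ‖f₃‖) := by
  obtain ⟨C₀, hC₀, h⟩ := hκ.exists_quad_const hρ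
  refine ⟨C₀, hC₀, fun C k hk f₀ f₁ f₂ f₃ => ?_⟩
  have hC := hk.nonneg
  rw [← ENNReal.ofReal_le_ofReal_iff (by positivity), ofReal_norm]
  refine (enorm_integral_le_lintegral_enorm _).trans ?_
  calc ∫⁻ z, ‖k z * quadProd f₀ f₁ f₂ f₃ z‖ₑ ∂μ.prod (μ.prod μ)
      ≤ ∫⁻ z, ENNReal.ofReal C * (‖quadProd f₀ f₁ f₂ f₃ z‖ₑ *
          ENNReal.ofReal (resonanceWeight κ ρ z)) ∂μ.prod (μ.prod μ) := by
        refine lintegral_mono fun z => ?_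
        rw [enorm_mul, mul_comm (‖quadProd f₀ f₁ f₂ f₃ z‖ₑ), ← mul_assoc]
        exact mul_le_mul_left (hk.enorm_le z) _
    _ = ENNReal.ofReal C * ∫⁻ z, ‖quadProd f₀ f₁ f₂ f₃ z‖ₑ *
          ENNReal.ofReal (resonanceWeight κ ρ z) ∂μ.prod (μ.prod μ) :=
        lintegral_const_mul' _ _ ENNReal.ofReal_ne_top
    _ ≤ ENNReal.ofReal C * ENNReal.ofReal (C₀ * (‖f₀‖ * ‖f₁‖ * ‖f₂‖ * ‖f₃‖)) :=
        mul_le_mul_right (h f₀ f₁ f₂ f₃) _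
    _ = _ := by rw [← ENNReal.ofReal_mul hC]; congr 1; ring

/-- The trilinear operator on `L²` represented by the form with kernel `k`, if there is one. -/
noncomputable def triOp (μ : Measure G) (k : G × G × G → ℂ) (f₁ f₂ f₃ : Lp ℂ 2 μ) : Lp ℂ 2 μ :=
  open Classical in
  if h : ∃ A : Lp ℂ 2 μ, ∀ u, inner ℂ u A = quadForm μ k u f₁ f₂ f₃ then h.choose else 0

/-- The form of a kernel is represented by an operator, by the Riesz representation theorem. -/
theorem IsKernel.inner_triOp {κ : G → ℝ} {ρ C : ℝ} {k : G × G × G → ℂ} (hk : IsKernel κ ρ C k)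
    (hκ : IsFrequencyMap μ κ ρ) (hρ : 0 < ρ) (u f₁ f₂ f₃ : Lp ℂ 2 μ) :
    inner ℂ u (triOp μ k f₁ f₂ f₃) = quadForm μ k u f₁ f₂ f₃ := by
  suffices h : ∃ A : Lp ℂ 2 μ, ∀ u, inner ℂ u A = quadForm μ k u f₁ f₂ f₃ by
    rw [triOp, dif_pos h]; exact h.choose_spec u
  obtain ⟨C₀, -, hC₀⟩ := hκ.exists_quadForm_bound hρ
  let ℓ : Lp ℂ 2 μ →L[ℂ] ℂ := LinearMap.mkContinuous
    { toFun := fun u => conj (quadForm μ k u f₁ f₂ f₃)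
      map_add' := fun u v => by
        rw [← map_add, quadForm_congr k (Lp.coeFn_add u v) (ae_eq_refl _) (ae_eq_refl _)
          (ae_eq_refl _)]
        congr 1
        rw [quadForm, quadForm, quadForm, ← integral_add (hk.integrable hκ hρ u f₁ f₂ f₃)
          (hk.integrable hκ hρ v f₁ f₂ f₃)]
        simp only [quadProd_add_left, mul_add]
      map_smul' := fun c u => by
        rw [quadForm_congr k (Lp.coeFn_smul c u) (ae_eq_refl _) (ae_eq_refl _)
          (ae_eq_refl _), RingHom.id_apply, smul_eq_mul]
        have : quadForm μ k (c • ⇑u) f₁ f₂ f₃ = conj c * quadForm μ k u f₁ f₂ f₃ := by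
          rw [quadForm, quadForm, ← integral_const_mul]
          refine integral_congr_ae (Eventually.of_forall fun z => ?_)
          simp only [quadProd, Pi.smul_apply, smul_eq_mul, map_mul]; ring
        rw [this, map_mul, Complex.conj_conj] }
    (C₀ * C * (‖f₁‖ * ‖f₂‖ * ‖f₃‖)) fun u => by
      simp only [LinearMap.coe_mk, AddHom.coe_mk, RCLike.norm_conj]
      refine (hC₀ C k hk u f₁ f₂ f₃).trans (le_of_eq (by ring))
  refine ⟨(InnerProductSpace.toDual ℂ _).symm ℓ, fun u => ?_⟩
  rw [← inner_conj_symm, InnerProductSpace.toDual_symm_apply]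
  exact Complex.conj_conj _

theorem IsKernel.triOp_triadditive {κ : G → ℝ} {ρ C : ℝ} {k : G × G × G → ℂ}
    (hk : IsKernel κ ρ C k) (hκ : IsFrequencyMap μ κ ρ) (hρ : 0 < ρ) :
    IsTriadditive (triOp μ k) where
  sub₁ f f' g h := by
    refine ext_inner_left ℂ fun u => ?_
    rw [inner_sub_right, hk.inner_triOp hκ hρ, hk.inner_triOp hκ hρ, hk.inner_triOp hκ hρ,
      quadForm_congr k (ae_eq_refl _) (Lp.coeFn_sub f f') (ae_eq_refl _) (ae_eq_refl _),
      quadForm, quadForm, quadForm,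
      ← integral_sub (hk.integrable hκ hρ u f g h) (hk.integrable hκ hρ u f' g h)]
    refine integral_congr_ae (Eventually.of_forall fun z => ?_)
    simp only [quadProd, Pi.sub_apply]; ring
  sub₂ f g g' h := by
    refine ext_inner_left ℂ fun u => ?_
    rw [inner_sub_right, hk.inner_triOp hκ hρ, hk.inner_triOp hκ hρ, hk.inner_triOp hκ hρ,
      quadForm_congr k (ae_eq_refl _) (ae_eq_refl _) (Lp.coeFn_sub g g') (ae_eq_refl _),
      quadForm, quadForm, quadForm,
      ← integral_sub (hk.integrable hκ hρ u f g h) (hk.integrable hκ hρ u f g' h)]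
    refine integral_congr_ae (Eventually.of_forall fun z => ?_)
    simp only [quadProd, Pi.sub_apply, map_sub]; ring
  sub₃ f g h h' := by
    refine ext_inner_left ℂ fun u => ?_
    rw [inner_sub_right, hk.inner_triOp hκ hρ, hk.inner_triOp hκ hρ, hk.inner_triOp hκ hρ,
      quadForm_congr k (ae_eq_refl _) (ae_eq_refl _) (ae_eq_refl _) (Lp.coeFn_sub h h'),
      quadForm, quadForm, quadForm,
      ← integral_sub (hk.integrable hκ hρ u f g h) (hk.integrable hκ hρ u f g h')]
    refine integral_congr_ae (Eventually.of_forall fun z => ?_)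
    simp only [quadProd, Pi.sub_apply]; ring

end QuadForm

/-- A vector is bounded by any bound for its inner products with `‖u‖` divided out. -/
theorem norm_le_of_forall_inner_le {H : Type*} [NormedAddCommGroup H] [InnerProductSpace ℂ H]
    {A : H} {B : ℝ} (hB : 0 ≤ B) (h : ∀ u, ‖inner ℂ u A‖ ≤ B * ‖u‖) : ‖A‖ ≤ B := by
  have h1 := h A
  have h2 : ‖inner ℂ A A‖ = ‖A‖ * ‖A‖ := by
    rw [inner_self_eq_norm_sq_to_K]; simp [pow_two]
  rw [h2] at h1
  rcases (norm_nonneg A).eq_or_lt with h0 | h0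
  · rw [← h0]; exact hB
  · exact le_of_mul_le_mul_right h1 h0

/-! ### Oscillatory integrals and symbols -/

section Symbols

/-- The oscillatory integral `∫_s^t e^{i x w_r} dr`. -/
noncomputable def oscIntegral (w : ℝ → ℝ) (s t x : ℝ) : ℂ :=
  ∫ r in s..t, Complex.exp (Complex.I * x * w r)

theorem oscIntegral_congr {w w' : ℝ → ℝ} {s t : ℝ} (h : EqOn w w' (uIcc s t)) (x : ℝ) :
    oscIntegral w s t x = oscIntegral w' s t x :=
  intervalIntegral.integral_congr fun r hr => by simp only [h hr]

/-- A path on `[0, ∞)`, extended by its initial value. -/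
noncomputable def extendPath (w : ℝ → ℝ) (r : ℝ) : ℝ := w (max r 0)

theorem continuous_extendPath {w : ℝ → ℝ} (hw : ContinuousOn w (Ici 0)) :
    Continuous (extendPath w) :=
  hw.comp_continuous (by fun_prop) fun r => le_max_right r 0

theorem eqOn_extendPath (w : ℝ → ℝ) {s t : ℝ} (h1 : 0 ≤ s) (h2 : s ≤ t) :
    EqOn w (extendPath w) (uIcc s t) := fun r hr => by
  rw [uIcc_of_le h2] at hr
  rw [extendPath, max_eq_left (h1.trans hr.1)]

theorem continuous_oscIntegral {w : ℝ → ℝ} (hw : ContinuousOn w (Ici 0)) {s t : ℝ} (h1 : 0 ≤ s)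
    (h2 : s ≤ t) : Continuous (oscIntegral w s t) := by
  have : oscIntegral w s t = oscIntegral (extendPath w) s t :=
    funext fun x => oscIntegral_congr (eqOn_extendPath w h1 h2) x
  rw [this]
  have hc := continuous_extendPath hw
  exact intervalIntegral.continuous_parametric_intervalIntegral_of_continuous
    (f := fun x r => Complex.exp (Complex.I * (x : ℝ) * extendPath w r))
    (by unfold Function.uncurry; fun_prop) continuous_const

theorem oscIntegral_add {w : ℝ → ℝ} (hw : ContinuousOn w (Ici 0)) {s u t : ℝ} (h1 : 0 ≤ s)
    (h2 : s ≤ u) (h3 : u ≤ t) (x : ℝ) :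
    oscIntegral w s u x + oscIntegral w u t x = oscIntegral w s t x := by
  rw [oscIntegral_congr (eqOn_extendPath w h1 h2), oscIntegral_congr
    (eqOn_extendPath w (h1.trans h2) h3), oscIntegral_congr (eqOn_extendPath w h1 (h2.trans h3))]
  have hc := continuous_extendPath hw
  have : Continuous fun r : ℝ => Complex.exp (Complex.I * x * extendPath w r) := by fun_prop
  exact intervalIntegral.integral_add_adjacent_intervals (this.intervalIntegrable _ _)
    (this.intervalIntegrable _ _)

theorem IsIrregular.exists_oscIntegral_bound {ρ γ : ℝ} {w : ℝ → ℝ} (hw : IsIrregular ρ γ w) {T : ℝ}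
    (hT : 0 < T) : ∃ C : ℝ, 0 ≤ C ∧ ∀ s t x, 0 ≤ s → s ≤ t → t ≤ T →
      ‖oscIntegral w s t x‖ ≤ C * (t - s) ^ γ * (1 + |x|) ^ (-ρ) := by
  obtain ⟨C, hC⟩ := hw.bound T hT
  refine ⟨max C 0, le_max_right _ _, fun s t x h1 h2 h3 => ?_⟩
  have hx : 0 < (1 + |x|) ^ ρ := Real.rpow_pos_of_pos (by positivity) _
  have hp : 0 ≤ (t - s) ^ γ := Real.rpow_nonneg (by linarith) _
  rw [Real.rpow_neg (by positivity), ← div_eq_mul_inv, le_div_iff₀ hx]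
  rcases h2.eq_or_lt with rfl | hlt
  · rw [oscIntegral, intervalIntegral.integral_same, norm_zero, zero_mul]
    exact mul_nonneg (le_max_right _ _) hp
  · have := hC x s t h1 hlt h3
    rw [abs_of_pos (by linarith : 0 < t - s)] at this
    rw [mul_comm]
    exact this.trans (mul_le_mul_of_nonneg_right (le_max_left _ _) hp)

/-- On bounded time intervals the exponent `γ` of an irregular path may be decreased. -/
theorem IsIrregular.of_le {ρ γ γ' : ℝ} {w : ℝ → ℝ} (hw : IsIrregular ρ γ w) (hγ' : 0 < γ')
    (h : γ' ≤ γ) : IsIrregular ρ γ' w where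
  rho_pos := hw.rho_pos
  gamma_pos := hγ'
  continuousOn := hw.continuousOn
  bound T hT := by
    obtain ⟨C, hC⟩ := hw.bound T hT
    refine ⟨max C 0 * T ^ (γ - γ'), fun a s t h1 h2 h3 => (hC a s t h1 h2 h3).trans ?_⟩
    have h4 : |t - s| = t - s := abs_of_pos (by linarith)
    have e : (t - s) ^ γ = (t - s) ^ (γ - γ') * (t - s) ^ γ' := by
      rw [← Real.rpow_add (by linarith)]; congr 1; ring
    have h5 : (t - s) ^ (γ - γ') ≤ T ^ (γ - γ') :=
      Real.rpow_le_rpow (by linarith) (by linarith) (by linarith)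
    have hp : 0 ≤ (t - s) ^ γ' := Real.rpow_nonneg (by linarith) _
    have hp' : 0 ≤ (t - s) ^ γ := Real.rpow_nonneg (by linarith) _
    rw [h4]
    calc C * (t - s) ^ γ ≤ max C 0 * (t - s) ^ γ :=
          mul_le_mul_of_nonneg_right (le_max_left _ _) hp'
      _ = max C 0 * (t - s) ^ (γ - γ') * (t - s) ^ γ' := by rw [e]; ring
      _ ≤ max C 0 * T ^ (γ - γ') * (t - s) ^ γ' :=
          mul_le_mul_of_nonneg_right (mul_le_mul_of_nonneg_left h5 (le_max_right _ _)) hp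

/-- The symbol of `e^{it∂²}`. -/
noncomputable def freeSymbol (t ξ : ℝ) : ℂ := Complex.exp (-Complex.I * t * ξ ^ 2)

/-- The symbol of `Π_N`. -/
noncomputable def cutoff (N : ℕ) : ℝ → ℂ := indicator {ξ : ℝ | |ξ| ≤ N} 1

/-- The weight `(1 + ξ²)^{α/2}` of `H^α`. -/
noncomputable def sobolevWeight (α ξ : ℝ) : ℝ := (1 + ξ ^ 2) ^ (α / 2)

theorem freeSymbol_eq (t ξ : ℝ) :
    freeSymbol t ξ = Complex.exp ((-(t * ξ ^ 2) : ℝ) * Complex.I) := by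
  rw [freeSymbol]; congr 1; push_cast; ring

theorem norm_freeSymbol (t ξ : ℝ) : ‖freeSymbol t ξ‖ = 1 := by
  rw [freeSymbol_eq, Complex.norm_exp_ofReal_mul_I]

theorem conj_freeSymbol (t ξ : ℝ) : conj (freeSymbol t ξ) = freeSymbol (-t) ξ := by
  rw [freeSymbol_eq, freeSymbol_eq, ← Complex.exp_conj]
  simp

theorem freeSymbol_neg_mul (t ξ : ℝ) : freeSymbol (-t) ξ * freeSymbol t ξ = 1 := by
  rw [freeSymbol_eq, freeSymbol_eq, ← Complex.exp_add]
  simp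

theorem conj_cutoff (N : ℕ) (ξ : ℝ) : conj (cutoff N ξ) = cutoff N ξ := by
  by_cases h : |ξ| ≤ N <;> simp [cutoff, h]

theorem norm_cutoff_le (N : ℕ) (ξ : ℝ) : ‖cutoff N ξ‖ ≤ 1 := by
  by_cases h : |ξ| ≤ N <;> simp [cutoff, h]

theorem cutoff_mul_self (N : ℕ) (ξ : ℝ) : cutoff N ξ * cutoff N ξ = cutoff N ξ := by
  by_cases h : |ξ| ≤ N <;> simp [cutoff, h]

theorem measurable_cutoff (N : ℕ) : Measurable (cutoff N) :=
  measurable_one.indicator (measurableSet_le (by fun_prop) measurable_const)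

theorem tendsto_cutoff (ξ : ℝ) : Tendsto (fun N => cutoff N ξ) atTop (𝓝 1) := by
  refine tendsto_const_nhds.congr' ?_
  obtain ⟨n, hn⟩ := exists_nat_ge |ξ|
  filter_upwards [eventually_ge_atTop n] with N hN
  have : |ξ| ≤ N := hn.trans (by exact_mod_cast hN)
  simp [cutoff, this]

theorem one_le_sobolevWeight {α : ℝ} (hα : 0 ≤ α) (ξ : ℝ) : 1 ≤ sobolevWeight α ξ :=
  Real.one_le_rpow (by nlinarith [sq_nonneg ξ]) (by linarith)

theorem sobolevWeight_pos (α ξ : ℝ) : 0 < sobolevWeight α ξ :=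
  Real.rpow_pos_of_pos (by positivity) _

theorem measurable_sobolevWeight (α : ℝ) : Measurable (sobolevWeight α) := by
  unfold sobolevWeight; fun_prop

/-- The weight at a sum of three frequencies is controlled by the largest of the three weights. -/
theorem sobolevWeight_le {α : ℝ} (hα : 0 ≤ α) {ξ ξ₁ ξ₂ ξ₃ : ℝ} (h : ξ = ξ₁ - ξ₂ + ξ₃) :
    sobolevWeight α ξ ≤ 9 ^ (α / 2) *
      (sobolevWeight α ξ₁ + sobolevWeight α ξ₂ + sobolevWeight α ξ₃) := by
  have p1 := sobolevWeight_pos α ξ₁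
  have p2 := sobolevWeight_pos α ξ₂
  have p3 := sobolevWeight_pos α ξ₃
  have key : ∀ η : ℝ, ξ ^ 2 ≤ 9 * η ^ 2 → sobolevWeight α ξ ≤ 9 ^ (α / 2) * sobolevWeight α η := by
    intro η hη
    rw [sobolevWeight, sobolevWeight, ← Real.mul_rpow (by norm_num) (by positivity)]
    exact Real.rpow_le_rpow (by positivity) (by linarith) (by linarith)
  have hc : (0 : ℝ) ≤ 9 ^ (α / 2) := by positivity
  have hmax : ∀ η : ℝ, |ξ₁| ≤ |η| → |ξ₂| ≤ |η| → |ξ₃| ≤ |η| → ξ ^ 2 ≤ 9 * η ^ 2 := by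
    intro η h1 h2 h3
    have h4 : |ξ| ≤ 3 * |η| := by
      rw [h]
      have a1 := abs_add_le (ξ₁ - ξ₂) ξ₃
      have a2 := abs_sub ξ₁ ξ₂
      linarith
    rw [← sq_abs ξ, ← sq_abs η]
    nlinarith [abs_nonneg ξ]
  rcases le_total |ξ₁| |ξ₂| with h12 | h12
  · rcases le_total |ξ₂| |ξ₃| with h23 | h23
    · exact (key ξ₃ (hmax _ (h12.trans h23) h23 le_rfl)).trans
        (mul_le_mul_of_nonneg_left (by linarith) hc)
    · exact (key ξ₂ (hmax _ h12 le_rfl h23)).trans (mul_le_mul_of_nonneg_left (by linarith) hc)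
  · rcases le_total |ξ₁| |ξ₃| with h13 | h13
    · exact (key ξ₃ (hmax _ h13 (h12.trans h13) le_rfl)).trans
        (mul_le_mul_of_nonneg_left (by linarith) hc)
    · exact (key ξ₁ (hmax _ le_rfl h12 h13)).trans (mul_le_mul_of_nonneg_left (by linarith) hc)

end Symbols

/-! ### The kernels of the modulated and the Galerkin operators -/

section Kernels

variable {G : Type*} {κ : G → ℝ} {α : ℝ}

/-- `1 / (1 + κ²)^{α/2}`, the multiplier identifying `L²` with `H^α`. -/
noncomputable def smoothing (α : ℝ) (κ : G → ℝ) (x : G) : ℂ := ((sobolevWeight α (κ x))⁻¹ : ℝ)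

theorem norm_smoothing_le (hα : 0 ≤ α) (x : G) : ‖smoothing α κ x‖ ≤ 1 := by
  rw [smoothing, Complex.norm_real, Real.norm_of_nonneg (inv_nonneg.2 (sobolevWeight_pos _ _).le)]
  exact inv_le_one_of_one_le₀ (one_le_sobolevWeight hα _)

theorem conj_smoothing (x : G) : conj (smoothing α κ x) = smoothing α κ x := Complex.conj_ofReal _

variable [AddCommGroup G]

/-- The kernel of the modulated operator `X_{st}` on `H^α`, transported to `L²`. It is set to `0`
unless `0 ≤ s ≤ t`, as nothing is known about `w` at negative times. -/
noncomputable def modulatedKernel (α : ℝ) (κ : G → ℝ) (w : ℝ → ℝ) (s t : ℝ) (z : G × G × G) : ℂ :=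
  open Classical in
  if 0 ≤ s ∧ s ≤ t then
    Complex.I * oscIntegral w s t (2 * κ z.2.1 * κ z.2.2) *
      (sobolevWeight α (κ z.1) *
        quadProd (fun _ => 1) (smoothing α κ) (smoothing α κ) (smoothing α κ) z)
  else 0

/-- The kernel of the Galerkin nonlinearity `𝒩_N` on `H^α`, transported to `L²`. -/
noncomputable def galerkinKernel (α : ℝ) (κ : G → ℝ) (N : ℕ) (z : G × G × G) : ℂ :=
  Complex.I * quadProd (cutoff N ∘ κ) (cutoff N ∘ κ) (cutoff N ∘ κ) (cutoff N ∘ κ) z *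
    (sobolevWeight α (κ z.1) *
      quadProd (fun _ => 1) (smoothing α κ) (smoothing α κ) (smoothing α κ) z)

variable [MeasurableSpace G] {μ : Measure G} {ρ : ℝ}

theorem IsFrequencyMap.isMultiplier_smoothing (hκ : IsFrequencyMap μ κ ρ) (hα : 0 ≤ α) :
    IsMultiplier 1 (smoothing α κ) where
  measurable := Complex.measurable_ofReal.comp
    ((measurable_sobolevWeight α).comp hκ.measurable).inv
  bound := norm_smoothing_le hα

theorem IsFrequencyMap.isMultiplier_cutoff (hκ : IsFrequencyMap μ κ ρ) (N : ℕ) :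
    IsMultiplier 1 (cutoff N ∘ κ) where
  measurable := (measurable_cutoff N).comp hκ.measurable
  bound _ := norm_cutoff_le N _

theorem IsFrequencyMap.isMultiplier_freeSymbol (hκ : IsFrequencyMap μ κ ρ) (t : ℝ) :
    IsMultiplier 1 (freeSymbol t ∘ κ) where
  measurable := by
    have := hκ.measurable
    unfold freeSymbol Function.comp
    fun_prop
  bound _ := (norm_freeSymbol t _).le

theorem IsFrequencyMap.eq_sub_add (hκ : IsFrequencyMap μ κ ρ) (z : G × G × G) :
    κ z.1 = κ (z.1 - z.2.1) - κ (z.1 - z.2.1 - z.2.2) + κ (z.1 - z.2.2) := by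
  simp only [hκ.map_sub]; ring

/-- The ratio of the weights in the kernels. -/
theorem IsFrequencyMap.norm_weight_le (hκ : IsFrequencyMap μ κ ρ) (hα : 0 ≤ α) (z : G × G × G) :
    ‖(sobolevWeight α (κ z.1) *
      quadProd (fun _ => 1) (smoothing α κ) (smoothing α κ) (smoothing α κ) z : ℂ)‖
      ≤ 3 * 9 ^ (α / 2) := by
  have h := sobolevWeight_le hα (hκ.eq_sub_add z)
  have h1 := one_le_sobolevWeight hα (κ (z.1 - z.2.1))
  have h2 := one_le_sobolevWeight hα (κ (z.1 - z.2.1 - z.2.2))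
  have h3 := one_le_sobolevWeight hα (κ (z.1 - z.2.2))
  have e : (sobolevWeight α (κ z.1) * quadProd (fun _ => 1) (smoothing α κ)
      (smoothing α κ) (smoothing α κ) z : ℂ) =
      ((sobolevWeight α (κ z.1) * ((sobolevWeight α (κ (z.1 - z.2.1)))⁻¹ *
        (sobolevWeight α (κ (z.1 - z.2.1 - z.2.2)))⁻¹ *
        (sobolevWeight α (κ (z.1 - z.2.2)))⁻¹) : ℝ) : ℂ) := by
    simp only [quadProd, conj_smoothing, map_one, one_mul]
    simp only [smoothing]; push_cast; ring
  rw [e, Complex.norm_real, Real.norm_of_nonneg (by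
    have := sobolevWeight_pos α (κ z.1); positivity)]
  set A := sobolevWeight α (κ (z.1 - z.2.1))
  set B := sobolevWeight α (κ (z.1 - z.2.1 - z.2.2))
  set D := sobolevWeight α (κ (z.1 - z.2.2))
  rw [← mul_inv, ← mul_inv, ← div_eq_mul_inv, div_le_iff₀ (by positivity)]
  have hc : (0 : ℝ) ≤ 9 ^ (α / 2) := by positivity
  have h4 : A + B + D ≤ 3 * (A * B * D) := by
    have a1 : A ≤ A * B := by nlinarith
    have a2 : A * B ≤ A * B * D := by
      nlinarith [mul_nonneg (zero_le_one.trans h1) (zero_le_one.trans h2)]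
    have a3 : B ≤ A * B := by nlinarith
    have a4 : D ≤ A * B * D := by nlinarith
    linarith
  calc _ ≤ 9 ^ (α / 2) * (A + B + D) := h
    _ ≤ 9 ^ (α / 2) * (3 * (A * B * D)) := mul_le_mul_of_nonneg_left h4 hc
    _ = _ := by ring

variable [MeasurableAdd₂ G] [MeasurableNeg G]

theorem IsFrequencyMap.measurable_weight (hκ : IsFrequencyMap μ κ ρ) (hα : 0 ≤ α) :
    Measurable fun z : G × G × G => (sobolevWeight α (κ z.1) *
      quadProd (fun _ => 1) (smoothing α κ) (smoothing α κ)
        (smoothing α κ) z : ℂ) := by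
  have h1 := (hκ.isMultiplier_smoothing hα).measurable
  have h2 := measurable_quadProd (measurable_const (a := (1 : ℂ))) h1 h1 h1
  have h3 := (measurable_sobolevWeight α).comp hκ.measurable
  exact (Complex.measurable_ofReal.comp (h3.comp measurable_fst)).mul h2

theorem IsFrequencyMap.isKernel_modulated (hκ : IsFrequencyMap μ κ ρ) (hα : 0 ≤ α) {w : ℝ → ℝ}
    (hw : ContinuousOn w (Ici 0)) {s t C : ℝ} (h1 : 0 ≤ s) (h2 : s ≤ t) (hC : 0 ≤ C)
    (hosc : ∀ x, ‖oscIntegral w s t x‖ ≤ C * (1 + |x|) ^ (-ρ)) :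
    IsKernel κ ρ (C * (3 * 9 ^ (α / 2))) (modulatedKernel α κ w s t) where
  measurable := by
    have h3 := (continuous_oscIntegral hw h1 h2).measurable
    have h4 := hκ.measurable
    have h5 := hκ.measurable_weight hα
    have : modulatedKernel α κ w s t = fun z =>
        Complex.I * oscIntegral w s t (2 * κ z.2.1 * κ z.2.2) *
      (sobolevWeight α (κ z.1) *
        quadProd (fun _ => 1) (smoothing α κ) (smoothing α κ) (smoothing α κ) z) :=
      funext fun z => if_pos ⟨h1, h2⟩
    rw [this]
    exact ((h3.comp (by fun_prop)).const_mul _).mul h5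
  bound z := by
    rw [modulatedKernel, if_pos ⟨h1, h2⟩, norm_mul, norm_mul, Complex.norm_I, one_mul]
    have h3 := hosc (2 * κ z.2.1 * κ z.2.2)
    have h4 := hκ.norm_weight_le hα z
    have h5 := resonanceWeight_pos κ ρ z
    calc _ ≤ (C * resonanceWeight κ ρ z) * (3 * 9 ^ (α / 2)) :=
          mul_le_mul h3 h4 (norm_nonneg _) (by positivity)
      _ = _ := by ring

/-- The truncations confine the resonance function to `|Φ| ≤ 8 N²`, where the decay factor is
bounded below: the Galerkin kernels fall under the quadrilinear estimate, with a constant depending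
on `N`. -/
theorem IsFrequencyMap.isKernel_galerkin (hκ : IsFrequencyMap μ κ ρ) (hρ : 0 < ρ) (hα : 0 ≤ α)
    (N : ℕ) :
    IsKernel κ ρ ((1 + 8 * (N : ℝ) ^ 2) ^ ρ * (3 * 9 ^ (α / 2))) (galerkinKernel α κ N) where
  measurable := by
    have h1 := (hκ.isMultiplier_cutoff N).measurable
    exact ((measurable_quadProd h1 h1 h1 h1).const_mul _).mul (hκ.measurable_weight hα)
  bound z := by
    rw [galerkinKernel, norm_mul, norm_mul, Complex.norm_I, one_mul]
    have h4 := hκ.norm_weight_le hα z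
    have h5 := resonanceWeight_pos κ ρ z
    have h6 : ‖quadProd (cutoff N ∘ κ) (cutoff N ∘ κ) (cutoff N ∘ κ)
        (cutoff N ∘ κ) z‖ ≤ (1 + 8 * (N : ℝ) ^ 2) ^ ρ * resonanceWeight κ ρ z := by
      by_cases h : |κ z.1| ≤ N ∧ |κ (z.1 - z.2.1)| ≤ N ∧ |κ (z.1 - z.2.2)| ≤ N
      · -- on the support of the product the resonance function is bounded by `8 N²`
        have ha : |κ z.2.1| ≤ 2 * N := by
          have e : κ z.2.1 = κ z.1 - κ (z.1 - z.2.1) := by rw [hκ.map_sub]; ring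
          rw [e]; exact (abs_sub _ _).trans (by linarith [h.1, h.2.1])
        have hb : |κ z.2.2| ≤ 2 * N := by
          have e : κ z.2.2 = κ z.1 - κ (z.1 - z.2.2) := by rw [hκ.map_sub]; ring
          rw [e]; exact (abs_sub _ _).trans (by linarith [h.1, h.2.2])
        have hΦ : |2 * κ z.2.1 * κ z.2.2| ≤ 8 * (N : ℝ) ^ 2 := by
          rw [abs_mul, abs_mul, abs_two]
          nlinarith [abs_nonneg (κ z.2.1), abs_nonneg (κ z.2.2)]
        have h7 : 1 ≤ (1 + 8 * (N : ℝ) ^ 2) ^ ρ * resonanceWeight κ ρ z := by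
          rw [resonanceWeight, Real.rpow_neg (by positivity), ← div_eq_mul_inv,
            one_le_div (Real.rpow_pos_of_pos (by positivity) _)]
          exact Real.rpow_le_rpow (by positivity) (by linarith) hρ.le
        refine le_trans ?_ h7
        simp only [quadProd, norm_mul, RCLike.norm_conj, Function.comp_apply]
        exact mul_le_one₀ (mul_le_one₀ (mul_le_one₀ (norm_cutoff_le _ _) (norm_nonneg _)
          (norm_cutoff_le _ _)) (norm_nonneg _) (norm_cutoff_le _ _)) (norm_nonneg _)
          (norm_cutoff_le _ _)
      · have h8 : quadProd (cutoff N ∘ κ) (cutoff N ∘ κ) (cutoff N ∘ κ)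
            (cutoff N ∘ κ) z = 0 := by
          simp only [quadProd, Function.comp_apply, conj_cutoff]
          simp only [not_and_or, not_le] at h
          rcases h with h | h | h <;> simp [cutoff, not_le.2 h]
        rw [h8, norm_zero]
        positivity
    calc _ ≤ ((1 + 8 * (N : ℝ) ^ 2) ^ ρ * resonanceWeight κ ρ z) * (3 * 9 ^ (α / 2)) :=
          mul_le_mul h6 h4 (norm_nonneg _) (by positivity)
      _ = _ := by ring

end Kernels

/-! ### Tame bounds for the modulated operators -/

section Modulated

variable {G : Type*}

theorem sobolevWeight_mul_smoothing (α : ℝ) (κ : G → ℝ) (x : G) :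
    (sobolevWeight α (κ x) : ℂ) * smoothing α κ x = 1 := by
  rw [smoothing, ← Complex.ofReal_mul, mul_inv_cancel₀ (sobolevWeight_pos _ _).ne',
    Complex.ofReal_one]

variable [AddCommGroup G]

/-- The kernel of the modulated operator `X_{st}` on `L²`. -/
noncomputable def phaseKernel (κ : G → ℝ) (w : ℝ → ℝ) (s t : ℝ) (z : G × G × G) : ℂ :=
  Complex.I * oscIntegral w s t (2 * κ z.2.1 * κ z.2.2)

/-- The kernel obtained from the modulated one by dividing the weight of the output frequency by the
sum of the weights of the input frequencies. -/
noncomputable def balancedKernel (α : ℝ) (κ : G → ℝ) (w : ℝ → ℝ) (s t : ℝ) (z : G × G × G) : ℂ :=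
  phaseKernel κ w s t z * ((sobolevWeight α (κ z.1) / (sobolevWeight α (κ (z.1 - z.2.1)) +
    sobolevWeight α (κ (z.1 - z.2.1 - z.2.2)) + sobolevWeight α (κ (z.1 - z.2.2))) : ℝ) : ℂ)

theorem modulatedKernel_eq_phase {α : ℝ} {κ : G → ℝ} {w : ℝ → ℝ} {s t : ℝ} (h1 : 0 ≤ s)
    (h2 : s ≤ t) (z : G × G × G) :
    modulatedKernel α κ w s t z = phaseKernel κ w s t z * (sobolevWeight α (κ z.1) *
      quadProd (fun _ => 1) (smoothing α κ) (smoothing α κ) (smoothing α κ) z) :=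
  if_pos ⟨h1, h2⟩

theorem modulatedKernel_of_not {α : ℝ} {κ : G → ℝ} {w : ℝ → ℝ} {s t : ℝ} (h : ¬(0 ≤ s ∧ s ≤ t)) :
    modulatedKernel α κ w s t = 0 :=
  funext fun _ => if_neg h

theorem modulatedKernel_add {α : ℝ} {κ : G → ℝ} {w : ℝ → ℝ} (hw : ContinuousOn w (Ici 0))
    {s u t : ℝ} (h1 : 0 ≤ s) (h2 : s ≤ u) (h3 : u ≤ t) (z : G × G × G) :
    modulatedKernel α κ w s u z + modulatedKernel α κ w u t z = modulatedKernel α κ w s t z := by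
  rw [modulatedKernel_eq_phase h1 h2, modulatedKernel_eq_phase (h1.trans h2) h3,
    modulatedKernel_eq_phase h1 (h2.trans h3), phaseKernel, phaseKernel, phaseKernel,
    ← oscIntegral_add hw h1 h2 h3]
  ring

/-- Undoing the identification of `L²` with `H^α` turns the kernel into that on `L²`. -/
theorem modulatedKernel_mul_smoothing {α : ℝ} {κ : G → ℝ} {w : ℝ → ℝ} {s t : ℝ} (h1 : 0 ≤ s)
    (h2 : s ≤ t) (z : G × G × G) :
    modulatedKernel α κ w s t z *
        quadProd (smoothing α κ) (fun _ => 1) (fun _ => 1) (fun _ => 1) z =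
      phaseKernel κ w s t z *
        quadProd (fun _ => 1) (smoothing α κ) (smoothing α κ) (smoothing α κ) z := by
  have := sobolevWeight_mul_smoothing α κ z.1
  rw [modulatedKernel_eq_phase h1 h2]
  simp only [quadProd, conj_smoothing, map_one]
  linear_combination (phaseKernel κ w s t z * (1 * smoothing α κ (z.1 - z.2.1) *
    smoothing α κ (z.1 - z.2.1 - z.2.2) * smoothing α κ (z.1 - z.2.2))) * this

/-- The Leibniz rule for the weight: the derivatives fall on one of the three factors. -/
theorem modulatedKernel_eq_balanced {α : ℝ} {κ : G → ℝ} {w : ℝ → ℝ} {s t : ℝ} (h1 : 0 ≤ s)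
    (h2 : s ≤ t) (z : G × G × G) :
    modulatedKernel α κ w s t z = balancedKernel α κ w s t z *
      (quadProd (fun _ => 1) (fun _ => 1) (smoothing α κ) (smoothing α κ) z +
       quadProd (fun _ => 1) (smoothing α κ) (fun _ => 1) (smoothing α κ) z +
       quadProd (fun _ => 1) (smoothing α κ) (smoothing α κ) (fun _ => 1) z) := by
  rw [modulatedKernel_eq_phase h1 h2, balancedKernel]
  simp only [quadProd, conj_smoothing, map_one]
  simp only [smoothing]
  have p1 := sobolevWeight_pos α (κ (z.1 - z.2.1))
  have p2 := sobolevWeight_pos α (κ (z.1 - z.2.1 - z.2.2))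
  have p3 := sobolevWeight_pos α (κ (z.1 - z.2.2))
  set A := sobolevWeight α (κ (z.1 - z.2.1))
  set B := sobolevWeight α (κ (z.1 - z.2.1 - z.2.2))
  set D := sobolevWeight α (κ (z.1 - z.2.2))
  have e : sobolevWeight α (κ z.1) * (A⁻¹ * B⁻¹ * D⁻¹) = sobolevWeight α (κ z.1) / (A + B + D) *
      (B⁻¹ * D⁻¹ + A⁻¹ * D⁻¹ + A⁻¹ * B⁻¹) := by
    field_simp
  have e' := congrArg (fun x : ℝ => (x : ℂ)) e
  push_cast at e' ⊢
  linear_combination phaseKernel κ w s t z * e'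

variable [MeasurableSpace G] {μ : Measure G} {κ : G → ℝ} {α ρ γ : ℝ} {w : ℝ → ℝ}

theorem IsFrequencyMap.isKernel_phase (hκ : IsFrequencyMap μ κ ρ) (hw : ContinuousOn w (Ici 0))
    {s t C : ℝ} (h1 : 0 ≤ s) (h2 : s ≤ t)
    (hosc : ∀ x, ‖oscIntegral w s t x‖ ≤ C * (1 + |x|) ^ (-ρ)) :
    IsKernel κ ρ C (phaseKernel κ w s t) where
  measurable := by
    have h3 := (continuous_oscIntegral hw h1 h2).measurable
    have h4 := hκ.measurable
    exact (h3.comp (by fun_prop)).const_mul _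
  bound z := by
    rw [phaseKernel, norm_mul, Complex.norm_I, one_mul]
    exact hosc _

theorem IsFrequencyMap.inner_mulOp_smoothing (hκ : IsFrequencyMap μ κ ρ) (hα : 0 ≤ α)
    (u f : Lp ℂ 2 μ) :
    inner ℂ u (mulOp μ (smoothing α κ) f) = inner ℂ (mulOp μ (smoothing α κ) u) f := by
  rw [(hκ.isMultiplier_smoothing hα).inner_mulOp]
  simp only [conj_smoothing]

variable [MeasurableAdd₂ G] [MeasurableNeg G]

theorem IsFrequencyMap.isKernel_balanced (hκ : IsFrequencyMap μ κ ρ) (hα : 0 ≤ α)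
    (hw : ContinuousOn w (Ici 0)) {s t C : ℝ} (h1 : 0 ≤ s) (h2 : s ≤ t)
    (hosc : ∀ x, ‖oscIntegral w s t x‖ ≤ C * (1 + |x|) ^ (-ρ)) :
    IsKernel κ ρ (C * 9 ^ (α / 2)) (balancedKernel α κ w s t) where
  measurable := by
    have h3 := (hκ.isKernel_phase hw h1 h2 hosc).measurable
    have h4 := (measurable_sobolevWeight α).comp hκ.measurable
    have h5 : ∀ φ : G × G × G → G, Measurable φ →
        Measurable fun z => sobolevWeight α (κ (φ z)) := fun φ hφ => h4.comp hφ
    exact h3.mul (Complex.measurable_ofReal.comp ((h5 _ (by fun_prop)).div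
      (((h5 _ (by fun_prop)).add (h5 _ (by fun_prop))).add (h5 _ (by fun_prop)))))
  bound z := by
    have h3 := (hκ.isKernel_phase hw h1 h2 hosc).bound z
    have hC := (hκ.isKernel_phase hw h1 h2 hosc).nonneg
    have h4 := resonanceWeight_pos κ ρ z
    have p0 := sobolevWeight_pos α (κ z.1)
    have p1 := sobolevWeight_pos α (κ (z.1 - z.2.1))
    have p2 := sobolevWeight_pos α (κ (z.1 - z.2.1 - z.2.2))
    have p3 := sobolevWeight_pos α (κ (z.1 - z.2.2))
    rw [balancedKernel, norm_mul, Complex.norm_real, Real.norm_of_nonneg (by positivity)]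
    calc _ ≤ (C * resonanceWeight κ ρ z) * 9 ^ (α / 2) := by
          refine mul_le_mul h3 ?_ (by positivity) (by positivity)
          rw [div_le_iff₀ (by positivity)]
          exact sobolevWeight_le hα (hκ.eq_sub_add z)
      _ = _ := by ring

theorem IsFrequencyMap.exists_isKernel_modulated (hκ : IsFrequencyMap μ κ ρ) (hα : 0 ≤ α)
    (hw : IsIrregular ρ γ w) (s t : ℝ) : ∃ C, IsKernel κ ρ C (modulatedKernel α κ w s t) := by
  by_cases h : 0 ≤ s ∧ s ≤ t
  · obtain ⟨C, hC, hosc⟩ := hw.exists_oscIntegral_bound (by linarith [h.1, h.2] : 0 < t + 1)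
    have hp : 0 ≤ (t - s) ^ γ := Real.rpow_nonneg (by linarith [h.2]) _
    exact ⟨_, hκ.isKernel_modulated hα hw.continuousOn h.1 h.2 (by positivity)
      fun x => hosc s t x h.1 h.2 (by linarith)⟩
  · rw [modulatedKernel_of_not h]
    exact ⟨0, measurable_const, fun z => by simp⟩

variable [SigmaFinite μ] [μ.IsAddLeftInvariant] [μ.IsNegInvariant]

/-- Restricted to `H^α`, the modulated operator on `L²` is the one on `H^α`. -/
theorem IsFrequencyMap.inner_mulOp_triOp_modulated (hκ : IsFrequencyMap μ κ ρ) (hρ : 0 < ρ)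
    (hα : 0 ≤ α) (hw : IsIrregular ρ γ w) {s t : ℝ} (h1 : 0 ≤ s) (h2 : s ≤ t)
    (u f g h : Lp ℂ 2 μ) :
    inner ℂ u (mulOp μ (smoothing α κ) (triOp μ (modulatedKernel α κ w s t) f g h)) =
      quadForm μ (phaseKernel κ w s t) u (mulOp μ (smoothing α κ) f)
        (mulOp μ (smoothing α κ) g) (mulOp μ (smoothing α κ) h) := by
  obtain ⟨C, hC⟩ := hκ.exists_isKernel_modulated hα hw s t
  have hs := hκ.isMultiplier_smoothing hα
  have e1 := quadForm_mulOp (modulatedKernel α κ w s t) hs isMultiplier_one isMultiplier_one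
    isMultiplier_one u f g h
  have e2 := quadForm_mulOp (phaseKernel κ w s t) isMultiplier_one hs hs hs u f g h
  simp only [mulOp_one] at e1 e2
  rw [hκ.inner_mulOp_smoothing hα, hC.inner_triOp hκ hρ, e1, e2]
  simp only [modulatedKernel_mul_smoothing h1 h2]

/-- The decomposition of `modulatedKernel_eq_balanced` on the level of forms. -/
theorem IsFrequencyMap.quadForm_modulated (hκ : IsFrequencyMap μ κ ρ) (hρ : 0 < ρ)
    (hα : 0 ≤ α) (hw : ContinuousOn w (Ici 0)) {s t C : ℝ} (h1 : 0 ≤ s) (h2 : s ≤ t)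
    (hosc : ∀ x, ‖oscIntegral w s t x‖ ≤ C * (1 + |x|) ^ (-ρ)) (u f g h : Lp ℂ 2 μ) :
    quadForm μ (modulatedKernel α κ w s t) u f g h =
      quadForm μ (balancedKernel α κ w s t) u f (mulOp μ (smoothing α κ) g)
        (mulOp μ (smoothing α κ) h) +
      quadForm μ (balancedKernel α κ w s t) u (mulOp μ (smoothing α κ) f) g
        (mulOp μ (smoothing α κ) h) +
      quadForm μ (balancedKernel α κ w s t) u (mulOp μ (smoothing α κ) f)
        (mulOp μ (smoothing α κ) g) h := by
  have hs := hκ.isMultiplier_smoothing hα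
  have hk := hκ.isKernel_balanced hα hw h1 h2 hosc
  have h3 := hk.integrable hκ hρ u f (mulOp μ (smoothing α κ) g) (mulOp μ (smoothing α κ) h)
  have h4 := hk.integrable hκ hρ u (mulOp μ (smoothing α κ) f) g (mulOp μ (smoothing α κ) h)
  have h5 := hk.integrable hκ hρ u (mulOp μ (smoothing α κ) f) (mulOp μ (smoothing α κ) g) h
  rw [quadForm, quadForm, quadForm, quadForm, ← integral_add h3 h4]
  refine Eq.trans (integral_congr_ae ?_) (integral_add (h3.add h4) h5)
  filter_upwards [ae_quad (hs.coeFn f), ae_quad (hs.coeFn g), ae_quad (hs.coeFn h)]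
    with z hf hg hh
  rw [modulatedKernel_eq_balanced h1 h2]
  simp only [quadProd, hf.2.1, hg.2.2.1, hh.2.2.2, map_mul, map_one]
  ring

/-- The modulated operators form a tame Young family: they are bounded on `L²`, and linear in the
`H^α` norm. -/
theorem IsFrequencyMap.exists_triOp_modulated_bound (hκ : IsFrequencyMap μ κ ρ) (hρ : 0 < ρ)
    (hα : 0 ≤ α) (hw : IsIrregular ρ γ w) {T : ℝ} (hT : 0 < T) : ∃ C, 0 ≤ C ∧
    ∀ s t, 0 ≤ s → s ≤ t → t ≤ T → ∀ f g h : Lp ℂ 2 μ,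
      ‖mulOp μ (smoothing α κ) (triOp μ (modulatedKernel α κ w s t) f g h)‖ ≤
        C * (t - s) ^ γ * (‖mulOp μ (smoothing α κ) f‖ * ‖mulOp μ (smoothing α κ) g‖ *
          ‖mulOp μ (smoothing α κ) h‖) ∧
      ‖triOp μ (modulatedKernel α κ w s t) f g h‖ ≤ C * (t - s) ^ γ *
        (‖f‖ * ‖mulOp μ (smoothing α κ) g‖ * ‖mulOp μ (smoothing α κ) h‖ +
        ‖mulOp μ (smoothing α κ) f‖ * ‖g‖ * ‖mulOp μ (smoothing α κ) h‖ +
        ‖mulOp μ (smoothing α κ) f‖ * ‖mulOp μ (smoothing α κ) g‖ * ‖h‖) := by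
  obtain ⟨C₁, hC₁, hosc⟩ := hw.exists_oscIntegral_bound hT
  obtain ⟨C₀, hC₀, hquad⟩ := hκ.exists_quadForm_bound hρ
  have h9 : (1 : ℝ) ≤ 9 ^ (α / 2) := Real.one_le_rpow (by norm_num) (by linarith)
  refine ⟨C₀ * C₁ * 9 ^ (α / 2), by positivity, fun s t h1 h2 h3 f g h => ?_⟩
  have hp : 0 ≤ (t - s) ^ γ := Real.rpow_nonneg (by linarith) _
  have hosc' := fun x => hosc s t x h1 h2 h3
  set F := ‖mulOp μ (smoothing α κ) f‖
  set F' := ‖mulOp μ (smoothing α κ) g‖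
  set F'' := ‖mulOp μ (smoothing α κ) h‖
  constructor
  · refine norm_le_of_forall_inner_le (by positivity) fun u => ?_
    rw [hκ.inner_mulOp_triOp_modulated hρ hα hw h1 h2]
    refine (hquad _ _ (hκ.isKernel_phase hw.continuousOn h1 h2 hosc') _ _ _ _).trans ?_
    calc _ = C₀ * C₁ * 1 * (t - s) ^ γ * (F * F' * F'') * ‖u‖ := by ring
      _ ≤ _ := by gcongr
  · obtain ⟨C, hC⟩ := hκ.exists_isKernel_modulated hα hw s t
    refine norm_le_of_forall_inner_le (by positivity) fun u => ?_
    rw [hC.inner_triOp hκ hρ, hκ.quadForm_modulated hρ hα hw.continuousOn h1 h2 hosc']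
    have hk := hκ.isKernel_balanced hα hw.continuousOn h1 h2 hosc'
    refine (norm_add₃_le.trans (add_le_add (add_le_add (hquad _ _ hk _ _ _ _)
      (hquad _ _ hk _ _ _ _)) (hquad _ _ hk _ _ _ _))).trans (le_of_eq ?_)
    ring

end Modulated

/-! ### The Galerkin nonlinearities -/

section Galerkin

/-- Integrating an oscillating factor in time first. -/
theorem intervalIntegral_integral_exp_mul {Z : Type*} [MeasurableSpace Z] {μ : Measure Z}
    [SFinite μ] {H : Z → ℂ} (hH : Integrable H μ) {Φ : Z → ℝ} (hΦ : Measurable Φ) {v : ℝ → ℝ}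
    (hv : Measurable v) (s t : ℝ) :
    ∫ r in s..t, ∫ z, Complex.exp (Complex.I * Φ z * v r) * H z ∂μ =
      ∫ z, oscIntegral v s t (Φ z) * H z ∂μ := by
  rw [intervalIntegral_integral_swap]
  · simp only [oscIntegral, intervalIntegral.integral_mul_const]
  · have : IsFiniteMeasure (volume.restrict (uIoc s t)) :=
      inferInstanceAs (IsFiniteMeasure (volume.restrict (Ioc (min s t) (max s t))))
    have hH' := hH.comp_snd (volume.restrict (uIoc s t))
    refine hH'.norm.mono' (AEStronglyMeasurable.mul (Measurable.aestronglyMeasurable ?_)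
      hH'.aestronglyMeasurable) (Eventually.of_forall fun p => ?_)
    · fun_prop
    · have e : Complex.I * Φ p.2 * v p.1 = (Φ p.2 * v p.1 : ℝ) * Complex.I := by push_cast; ring
      change ‖Complex.exp (Complex.I * Φ p.2 * v p.1) * H p.2‖ ≤ ‖H p.2‖
      rw [e, norm_mul, Complex.norm_exp_ofReal_mul_I, one_mul]

/-- A bounded trilinear map, conjugated with a strongly continuous isometric group along a
continuous path, depends continuously on time. -/
theorem IsTriadditive.continuousOn_conjugate {E : Type*} [NormedAddCommGroup E] [NormedSpace ℝ E]
    {B : E → E → E → E} (hB : IsTriadditive B) {c : ℝ}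
    (hc : ∀ f g h, ‖B f g h‖ ≤ c * ‖f‖ * ‖g‖ * ‖h‖) {V : ℝ → E →L[ℝ] E}
    (hV : ∀ t f, ‖V t f‖ = ‖f‖) (hV' : ∀ f, Continuous fun t => V t f) {w : ℝ → ℝ} {S : Set ℝ}
    (hw : ContinuousOn w S) (f : E) :
    ContinuousOn (fun r => V (-w r) (B (V (w r) f) (V (w r) f) (V (w r) f))) S := by
  have h1 : ContinuousOn (fun r => V (w r) f) S := (hV' f).comp_continuousOn hw
  exact (continuous_uncurry_of_isometry hV hV').comp_continuousOn (hw.neg.prodMk fun r hr =>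
    hB.tendsto hc (h1 r hr) (h1 r hr) (h1 r hr))

variable {G : Type*} [AddCommGroup G] {κ : G → ℝ} {α ρ γ : ℝ} {w : ℝ → ℝ}

theorem modulatedKernel_mul_cutoff {s t : ℝ} (h1 : 0 ≤ s) (h2 : s ≤ t) (N : ℕ) (z : G × G × G) :
    modulatedKernel α κ w s t z *
        quadProd (cutoff N ∘ κ) (cutoff N ∘ κ) (cutoff N ∘ κ) (cutoff N ∘ κ) z =
      oscIntegral w s t (2 * κ z.2.1 * κ z.2.2) * galerkinKernel α κ N z := by
  rw [modulatedKernel_eq_phase h1 h2, galerkinKernel, phaseKernel]; ring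

theorem galerkinKernel_mul_smoothing (N : ℕ) (z : G × G × G) :
    galerkinKernel α κ N z * quadProd (smoothing α κ) (fun _ => 1) (fun _ => 1) (fun _ => 1) z =
      Complex.I * quadProd (cutoff N ∘ κ) (fun x => (cutoff N ∘ κ) x * smoothing α κ x)
        (fun x => (cutoff N ∘ κ) x * smoothing α κ x)
        (fun x => (cutoff N ∘ κ) x * smoothing α κ x) z := by
  have := sobolevWeight_mul_smoothing α κ z.1
  rw [galerkinKernel]
  simp only [quadProd, conj_smoothing, map_one, map_mul]
  linear_combination (Complex.I * conj ((cutoff N ∘ κ) z.1) * (cutoff N ∘ κ) (z.1 - z.2.1) *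
    conj ((cutoff N ∘ κ) (z.1 - z.2.1 - z.2.2)) * (cutoff N ∘ κ) (z.1 - z.2.2) *
    smoothing α κ (z.1 - z.2.1) *
    smoothing α κ (z.1 - z.2.1 - z.2.2) * smoothing α κ (z.1 - z.2.2)) * this

variable [MeasurableSpace G] {μ : Measure G}

/-- The resonance function `ξ² - ξ₁² + ξ₂² - ξ₃² = 2 (ξ - ξ₁) (ξ - ξ₃)`. -/
theorem IsFrequencyMap.quadProd_freeSymbol (hκ : IsFrequencyMap μ κ ρ) (t : ℝ) (z : G × G × G) :
    quadProd (freeSymbol t ∘ κ) (freeSymbol t ∘ κ) (freeSymbol t ∘ κ) (freeSymbol t ∘ κ) z =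
      Complex.exp (Complex.I * (2 * κ z.2.1 * κ z.2.2 : ℝ) * t) := by
  simp only [quadProd, Function.comp_apply, conj_freeSymbol]
  simp only [freeSymbol, hκ.map_sub, ← Complex.exp_add]
  congr 1
  push_cast
  ring

theorem IsFrequencyMap.inner_mulOp_cutoff (hκ : IsFrequencyMap μ κ ρ) (N : ℕ)
    (u f : Lp ℂ 2 μ) :
    inner ℂ u (mulOp μ (cutoff N ∘ κ) f) = inner ℂ (mulOp μ (cutoff N ∘ κ) u) f := by
  rw [(hκ.isMultiplier_cutoff N).inner_mulOp]
  simp only [Function.comp_apply, conj_cutoff]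
  rfl

theorem IsFrequencyMap.mulOp_cutoff_mulOp_cutoff (hκ : IsFrequencyMap μ κ ρ) (N : ℕ)
    (f : Lp ℂ 2 μ) : mulOp μ (cutoff N ∘ κ) (mulOp μ (cutoff N ∘ κ) f) =
      mulOp μ (cutoff N ∘ κ) f := by
  rw [(hκ.isMultiplier_cutoff N).mulOp_mulOp (hκ.isMultiplier_cutoff N)]
  simp only [Function.comp_apply, cutoff_mul_self]
  rfl

theorem IsFrequencyMap.inner_mulOp_freeSymbol (hκ : IsFrequencyMap μ κ ρ) (t : ℝ)
    (u f : Lp ℂ 2 μ) : inner ℂ u (mulOp μ (freeSymbol (-t) ∘ κ) f) =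
      inner ℂ (mulOp μ (freeSymbol t ∘ κ) u) f := by
  rw [(hκ.isMultiplier_freeSymbol (-t)).inner_mulOp]
  simp only [Function.comp_apply, conj_freeSymbol, neg_neg]
  rfl

theorem IsFrequencyMap.mulOp_freeSymbol_neg (hκ : IsFrequencyMap μ κ ρ) (t : ℝ) (f : Lp ℂ 2 μ) :
    mulOp μ (freeSymbol (-t) ∘ κ) (mulOp μ (freeSymbol t ∘ κ) f) = f := by
  rw [(hκ.isMultiplier_freeSymbol (-t)).mulOp_mulOp (hκ.isMultiplier_freeSymbol t)]
  simp only [Function.comp_apply, freeSymbol_neg_mul, mulOp_one]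

theorem IsFrequencyMap.inner_mulOp_freeSymbol_mulOp_freeSymbol (hκ : IsFrequencyMap μ κ ρ) (t : ℝ)
    (u f : Lp ℂ 2 μ) :
    inner ℂ (mulOp μ (freeSymbol t ∘ κ) u) (mulOp μ (freeSymbol t ∘ κ) f) = inner ℂ u f := by
  rw [← hκ.inner_mulOp_freeSymbol, hκ.mulOp_freeSymbol_neg]

theorem IsFrequencyMap.norm_mulOp_freeSymbol (hκ : IsFrequencyMap μ κ ρ) (t : ℝ)
    (f : Lp ℂ 2 μ) : ‖mulOp μ (freeSymbol t ∘ κ) f‖ = ‖f‖ := by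
  have h1 : ∀ t (f : Lp ℂ 2 μ), ‖mulOp μ (freeSymbol t ∘ κ) f‖ ≤ ‖f‖ := fun t f => by
    have := (hκ.isMultiplier_freeSymbol t).norm_mulOp_le f
    rwa [one_mul] at this
  refine (h1 t f).antisymm ?_
  have := h1 (-t) (mulOp μ (freeSymbol t ∘ κ) f)
  rwa [hκ.mulOp_freeSymbol_neg] at this

theorem IsFrequencyMap.continuous_mulOp_freeSymbol (hκ : IsFrequencyMap μ κ ρ) (f : Lp ℂ 2 μ) :
    Continuous fun t => mulOp μ (freeSymbol t ∘ κ) f := by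
  rw [continuous_iff_continuousAt]
  intro t
  refine tendsto_mulOp hκ.isMultiplier_freeSymbol (hκ.isMultiplier_freeSymbol t) (fun x => ?_) f
  have : Continuous fun t : ℝ => freeSymbol t (κ x) := by
    unfold freeSymbol; fun_prop
  exact this.tendsto t

theorem IsFrequencyMap.tendsto_mulOp_cutoff (hκ : IsFrequencyMap μ κ ρ) (f : Lp ℂ 2 μ) :
    Tendsto (fun N => mulOp μ (cutoff N ∘ κ) f) atTop (𝓝 f) := by
  have := tendsto_mulOp hκ.isMultiplier_cutoff isMultiplier_one
    (fun x => tendsto_cutoff (κ x)) f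
  rwa [mulOp_one] at this

variable [MeasurableAdd₂ G] [MeasurableNeg G] [SigmaFinite μ] [μ.IsAddLeftInvariant]
  [μ.IsNegInvariant]

theorem IsFrequencyMap.triOp_galerkin_bound (hκ : IsFrequencyMap μ κ ρ) (hρ : 0 < ρ)
    (hα : 0 ≤ α) (N : ℕ) : ∃ C, 0 ≤ C ∧ ∀ f g h : Lp ℂ 2 μ,
      ‖triOp μ (galerkinKernel α κ N) f g h‖ ≤ C * ‖f‖ * ‖g‖ * ‖h‖ := by
  obtain ⟨C₀, hC₀, hquad⟩ := hκ.exists_quadForm_bound hρ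
  have hk := hκ.isKernel_galerkin hρ hα N
  have hC := hk.nonneg
  refine ⟨_, mul_nonneg hC₀ hC, fun f g h => norm_le_of_forall_inner_le ?_ fun u => ?_⟩
  · positivity
  · rw [hk.inner_triOp hκ hρ]
    exact (hquad _ _ hk u f g h).trans (le_of_eq (by ring))

/-- The Galerkin nonlinearity on `H^α` is the one on `L²`. -/
theorem IsFrequencyMap.inner_mulOp_triOp_galerkin (hκ : IsFrequencyMap μ κ ρ) (hρ : 0 < ρ)
    (hα : 0 ≤ α) (N : ℕ) (u f : Lp ℂ 2 μ) :
    inner ℂ u (mulOp μ (smoothing α κ) (triOp μ (galerkinKernel α κ N) f f f)) =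
      quadForm μ (fun _ => Complex.I) (mulOp μ (cutoff N ∘ κ) u)
        (mulOp μ (cutoff N ∘ κ) (mulOp μ (smoothing α κ) f))
        (mulOp μ (cutoff N ∘ κ) (mulOp μ (smoothing α κ) f))
        (mulOp μ (cutoff N ∘ κ) (mulOp μ (smoothing α κ) f)) := by
  have hs := hκ.isMultiplier_smoothing hα
  have hc := hκ.isMultiplier_cutoff N
  have e1 := quadForm_mulOp (galerkinKernel α κ N) hs isMultiplier_one isMultiplier_one
    isMultiplier_one u f f f
  have e2 := quadForm_mulOp (fun _ => Complex.I) hc (hc.mul hs) (hc.mul hs) (hc.mul hs) u f f f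
  simp only [mulOp_one] at e1
  rw [hκ.inner_mulOp_smoothing hα, (hκ.isKernel_galerkin hρ hα N).inner_triOp hκ hρ, e1,
    hc.mulOp_mulOp hs, e2]
  simp only [galerkinKernel_mul_smoothing]

/-- The free evolution contributes the phase `e^{i Φ w_r}` to the Galerkin form, and integration in
time turns it into the oscillatory integral of the modulated form. -/
theorem IsFrequencyMap.integral_quadForm_galerkin (hκ : IsFrequencyMap μ κ ρ) (hρ : 0 < ρ)
    (hα : 0 ≤ α) (hw : ContinuousOn w (Ici 0)) (N : ℕ) {s t : ℝ} (h1 : 0 ≤ s) (h2 : s ≤ t)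
    (u f : Lp ℂ 2 μ) :
    ∫ r in s..t, quadForm μ (galerkinKernel α κ N) (mulOp μ (freeSymbol (w r) ∘ κ) u)
      (mulOp μ (freeSymbol (w r) ∘ κ) f) (mulOp μ (freeSymbol (w r) ∘ κ) f)
      (mulOp μ (freeSymbol (w r) ∘ κ) f) =
    quadForm μ (modulatedKernel α κ w s t) (mulOp μ (cutoff N ∘ κ) u)
      (mulOp μ (cutoff N ∘ κ) f) (mulOp μ (cutoff N ∘ κ) f) (mulOp μ (cutoff N ∘ κ) f) := by
  have hint := (hκ.isKernel_galerkin hρ hα N).integrable hκ hρ u f f f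
  have hc := hκ.isMultiplier_cutoff N
  have hκm := hκ.measurable
  have e1 : ∀ r ∈ uIcc s t, quadForm μ (galerkinKernel α κ N) (mulOp μ (freeSymbol (w r) ∘ κ) u)
      (mulOp μ (freeSymbol (w r) ∘ κ) f) (mulOp μ (freeSymbol (w r) ∘ κ) f)
      (mulOp μ (freeSymbol (w r) ∘ κ) f) = ∫ z, Complex.exp (Complex.I *
        (2 * κ z.2.1 * κ z.2.2 : ℝ) * extendPath w r) *
        (galerkinKernel α κ N z * quadProd u f f f z) ∂μ.prod (μ.prod μ) := by
    intro r hr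
    have hm := hκ.isMultiplier_freeSymbol (w r)
    rw [quadForm_mulOp _ hm hm hm hm, quadForm]
    refine integral_congr_ae (Eventually.of_forall fun z => ?_)
    simp only [hκ.quadProd_freeSymbol, ← eqOn_extendPath w h1 h2 hr]
    ring
  rw [intervalIntegral.integral_congr e1, intervalIntegral_integral_exp_mul hint (by fun_prop)
    (continuous_extendPath hw).measurable, quadForm_mulOp _ hc hc hc hc, quadForm]
  refine integral_congr_ae (Eventually.of_forall fun z => ?_)
  simp only [modulatedKernel_mul_cutoff h1 h2, oscIntegral_congr (eqOn_extendPath w h1 h2)]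
  ring

/-- The truncated modulated operator is the time integral of the conjugated Galerkin
nonlinearities. -/
theorem IsFrequencyMap.integral_triOp_galerkin (hκ : IsFrequencyMap μ κ ρ) (hρ : 0 < ρ)
    (hα : 0 ≤ α) (hw : IsIrregular ρ γ w) (N : ℕ) {s t : ℝ} (h1 : 0 ≤ s) (h2 : s ≤ t)
    (f : Lp ℂ 2 μ) :
    ∫ r in s..t, mulOp μ (freeSymbol (-w r) ∘ κ) (triOp μ (galerkinKernel α κ N)
        (mulOp μ (freeSymbol (w r) ∘ κ) f) (mulOp μ (freeSymbol (w r) ∘ κ) f)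
        (mulOp μ (freeSymbol (w r) ∘ κ) f)) =
      mulOp μ (cutoff N ∘ κ) (triOp μ (modulatedKernel α κ w s t) (mulOp μ (cutoff N ∘ κ) f)
        (mulOp μ (cutoff N ∘ κ) f) (mulOp μ (cutoff N ∘ κ) f)) := by
  have hk := hκ.isKernel_galerkin hρ hα N
  obtain ⟨C, hC⟩ := hκ.exists_isKernel_modulated hα hw s t
  obtain ⟨C', hC', hG⟩ := hκ.triOp_galerkin_bound hρ hα N
  have hw0 : ContinuousOn w (uIcc s t) := by
    rw [uIcc_of_le h2]
    exact hw.continuousOn.mono fun r hr => h1.trans hr.1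
  have hcont := (hk.triOp_triadditive hκ hρ).continuousOn_conjugate hG
    (V := fun t => (mulOp μ (freeSymbol t ∘ κ)).restrictScalars ℝ)
    hκ.norm_mulOp_freeSymbol hκ.continuous_mulOp_freeSymbol hw0 f
  simp only [ContinuousLinearMap.coe_restrictScalars'] at hcont
  refine ext_inner_left ℂ fun u => ?_
  rw [hκ.inner_mulOp_cutoff, hC.inner_triOp hκ hρ,
    ← hκ.integral_quadForm_galerkin hρ hα hw.continuousOn N h1 h2]
  refine Eq.trans (ContinuousLinearMap.intervalIntegral_comp_comm (innerSL ℂ u)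
    hcont.intervalIntegrable).symm ?_
  simp only [innerSL_apply_apply, hκ.inner_mulOp_freeSymbol, hk.inner_triOp hκ hρ]

end Galerkin

/-! ### From a Fourier transform to well-posedness -/

theorem IsMultiplier.mulOp_comm {G : Type*} [MeasurableSpace G] {μ : Measure G} {C C' : ℝ}
    {m m' : G → ℂ} (h : IsMultiplier C m) (h' : IsMultiplier C' m') (f : Lp ℂ 2 μ) :
    mulOp μ m (mulOp μ m' f) = mulOp μ m' (mulOp μ m f) := by
  rw [h.mulOp_mulOp h', h'.mulOp_mulOp h]
  simp only [mul_comm]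

section Spectral

variable {Y : Type*} [MeasurableSpace Y] {ν : Measure Y} {G : Type*} [AddCommGroup G]
  [MeasurableSpace G] {μ : Measure G}

/-- A unitary Fourier transform `F` that diagonalises the multipliers of the model, `κ` being the
frequency of a character, and under which the cubic nonlinearity becomes a convolution, in the sense
of quadratic forms on functions of bounded frequency. -/
structure NLSModel.IsSpectral (M : NLSModel (Lp ℂ 2 ν)) (F : Lp ℂ 2 ν ≃ₗᵢ[ℂ] Lp ℂ 2 μ)
    (κ : G → ℝ) : Prop where
  hNorm_eq : ∀ α f, M.hNorm α f = eLpNorm (fun x => (sobolevWeight α (κ x) : ℂ) * F f x) 2 μ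
  mult_eq : ∀ C m, IsMultiplier C (m ∘ κ) → ∀ f, F (M.mult m f) = mulOp μ (m ∘ κ) (F f)
  inner_nonlin : ∀ N h f, mulOp μ (cutoff N ∘ κ) h = h → mulOp μ (cutoff N ∘ κ) f = f →
    inner ℂ (F.symm h) (M.nonlin (F.symm f)) = quadForm μ (fun _ => Complex.I) h f f f
  re_inner_nonlin : ∀ f, (inner ℂ f (M.nonlin f)).re = 0

namespace NLSModel.IsSpectral

variable {M : NLSModel (Lp ℂ 2 ν)} {F : Lp ℂ 2 ν ≃ₗᵢ[ℂ] Lp ℂ 2 μ} {κ : G → ℝ} {α ρ γ : ℝ}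
  {w : ℝ → ℝ}

theorem U_eq (hM : M.IsSpectral F κ) (hκ : IsFrequencyMap μ κ ρ) (t : ℝ) (f : Lp ℂ 2 ν) :
    F (M.U t f) = mulOp μ (freeSymbol t ∘ κ) (F f) :=
  hM.mult_eq 1 (freeSymbol t) (hκ.isMultiplier_freeSymbol t) f

theorem proj_eq (hM : M.IsSpectral F κ) (hκ : IsFrequencyMap μ κ ρ) (N : ℕ) (f : Lp ℂ 2 ν) :
    F (M.proj N f) = mulOp μ (cutoff N ∘ κ) (F f) :=
  hM.mult_eq 1 (cutoff N) (hκ.isMultiplier_cutoff N) f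

theorem hNorm_symm (hM : M.IsSpectral F κ) (hκ : IsFrequencyMap μ κ ρ) (hα : 0 ≤ α)
    (f : Lp ℂ 2 μ) : M.hNorm α (F.symm (mulOp μ (smoothing α κ) f)) = ‖f‖ₑ := by
  rw [hM.hNorm_eq, F.apply_symm_apply, Lp.enorm_def]
  refine eLpNorm_congr_ae ?_
  filter_upwards [(hκ.isMultiplier_smoothing hα).coeFn f] with x hx
  rw [hx, ← mul_assoc, sobolevWeight_mul_smoothing, one_mul]

/-- The elements of finite `H^α` norm are the images of `L²` under smoothing. -/
theorem exists_of_hNorm (hM : M.IsSpectral F κ) (hκ : IsFrequencyMap μ κ ρ) (hα : 0 ≤ α)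
    {f : Lp ℂ 2 ν} (hf : M.hNorm α f < ⊤) : ∃ e, F.symm (mulOp μ (smoothing α κ) e) = f := by
  rw [hM.hNorm_eq] at hf
  have h : MemLp (fun x => (sobolevWeight α (κ x) : ℂ) * F f x) 2 μ :=
    ⟨(Complex.measurable_ofReal.comp ((measurable_sobolevWeight α).comp
      hκ.measurable)).aestronglyMeasurable.mul (Lp.aestronglyMeasurable _), hf⟩
  refine ⟨h.toLp _, F.injective ?_⟩
  rw [F.apply_symm_apply]
  ext1
  filter_upwards [(hκ.isMultiplier_smoothing hα).coeFn (h.toLp _), h.coeFn_toLp] with x h1 h2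
  rw [h1, h2, ← mul_assoc, mul_comm (smoothing α κ x), sobolevWeight_mul_smoothing, one_mul]

theorem U_symm (hM : M.IsSpectral F κ) (hκ : IsFrequencyMap μ κ ρ) (hα : 0 ≤ α) (t : ℝ)
    (f : Lp ℂ 2 μ) : M.U t (F.symm (mulOp μ (smoothing α κ) f)) =
      F.symm (mulOp μ (smoothing α κ) (mulOp μ (freeSymbol t ∘ κ) f)) := by
  refine F.injective ?_
  rw [hM.U_eq hκ, F.apply_symm_apply, F.apply_symm_apply,
    (hκ.isMultiplier_smoothing hα).mulOp_comm (hκ.isMultiplier_freeSymbol t)]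

theorem re_inner_galerkin (hM : M.IsSpectral F κ) (hκ : IsFrequencyMap μ κ ρ) (N : ℕ)
    (f : Lp ℂ 2 ν) : (inner ℂ f (M.galerkin N f)).re = 0 := by
  rw [galerkin, ← F.inner_map_map, hM.proj_eq hκ, hκ.inner_mulOp_cutoff, ← hM.proj_eq hκ,
    F.inner_map_map]
  exact hM.re_inner_nonlin _

variable [MeasurableAdd₂ G] [MeasurableNeg G] [SigmaFinite μ] [μ.IsAddLeftInvariant]
  [μ.IsNegInvariant]

/-- The Galerkin nonlinearity of the model is the operator with the Galerkin kernel. -/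
theorem galerkin_symm (hM : M.IsSpectral F κ) (hκ : IsFrequencyMap μ κ ρ) (hρ : 0 < ρ)
    (hα : 0 ≤ α) (N : ℕ) (f : Lp ℂ 2 μ) : M.galerkin N (F.symm (mulOp μ (smoothing α κ) f)) =
      F.symm (mulOp μ (smoothing α κ) (triOp μ (galerkinKernel α κ N) f f f)) := by
  refine F.injective (ext_inner_left ℂ fun u => ?_)
  have hp : M.proj N (F.symm (mulOp μ (smoothing α κ) f)) =
      F.symm (mulOp μ (cutoff N ∘ κ) (mulOp μ (smoothing α κ) f)) := by
    refine F.injective ?_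
    rw [hM.proj_eq hκ, F.apply_symm_apply, F.apply_symm_apply]
  rw [galerkin, hM.proj_eq hκ, hp, F.apply_symm_apply, hκ.inner_mulOp_triOp_galerkin hρ hα,
    hκ.inner_mulOp_cutoff, ← hM.inner_nonlin N _ _ (hκ.mulOp_cutoff_mulOp_cutoff N _)
      (hκ.mulOp_cutoff_mulOp_cutoff N _), F.symm.inner_map_eq_flip]
  rfl

/-- The space `H^α`, described through the Fourier transform. -/
noncomputable def lift (hM : M.IsSpectral F κ) (hκ : IsFrequencyMap μ κ ρ) (hρ : 0 < ρ)
    (hα : 0 ≤ α) (hw : IsIrregular ρ γ w) : M.Lift α w γ (Lp ℂ 2 μ) where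
  ι := (F.symm.toContinuousLinearEquiv.toContinuousLinearMap.comp
    (mulOp μ (smoothing α κ))).restrictScalars ℝ
  V t := (mulOp μ (freeSymbol t ∘ κ)).restrictScalars ℝ
  G N := triOp μ (galerkinKernel α κ N)
  P N := (mulOp μ (cutoff N ∘ κ)).restrictScalars ℝ
  X s t := triOp μ (modulatedKernel α κ w s t)
  norm_ι_le f := by
    have := (hκ.isMultiplier_smoothing hα).norm_mulOp_le f
    rw [one_mul] at this
    exact (F.symm.norm_map _).trans_le this
  hNorm_ι f := hM.hNorm_symm hκ hα f
  exists_of_hNorm f hf := hM.exists_of_hNorm hκ hα hf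
  U_ι t f := hM.U_symm hκ hα t f
  galerkin_ι N f := hM.galerkin_symm hκ hρ hα N f
  norm_V := hκ.norm_mulOp_freeSymbol
  V_neg := hκ.mulOp_freeSymbol_neg
  continuous_V := hκ.continuous_mulOp_freeSymbol
  G_triadditive N := (hκ.isKernel_galerkin hρ hα N).triOp_triadditive hκ hρ
  G_bound N := hκ.triOp_galerkin_bound hρ hα N
  norm_P_le N f := by
    have := (hκ.isMultiplier_cutoff N).norm_mulOp_le f
    rwa [one_mul] at this
  tendsto_P := hκ.tendsto_mulOp_cutoff
  tame T hT := by
    obtain ⟨C, hC, h⟩ := hκ.exists_triOp_modulated_bound hρ hα hw hT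
    have e : ∀ f : Lp ℂ 2 μ, ((normSeminorm ℝ (Lp ℂ 2 ν)).comp
        ((F.symm.toContinuousLinearEquiv.toContinuousLinearMap.comp
          (mulOp μ (smoothing α κ))).restrictScalars ℝ).toLinearMap) f =
        ‖mulOp μ (smoothing α κ) f‖ := fun f => F.symm.norm_map _
    refine ⟨C, hC, ?_, ?_, ?_, ?_, ?_⟩
    · intro s t
      obtain ⟨C, hC⟩ := hκ.exists_isKernel_modulated hα hw s t
      exact hC.triOp_triadditive hκ hρ
    · intro s u t h1 h2 h3 _ f g k
      obtain ⟨C₁, hC₁⟩ := hκ.exists_isKernel_modulated hα hw s u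
      obtain ⟨C₂, hC₂⟩ := hκ.exists_isKernel_modulated hα hw u t
      obtain ⟨C₃, hC₃⟩ := hκ.exists_isKernel_modulated hα hw s t
      refine ext_inner_left ℂ fun v => ?_
      rw [inner_add_right, hC₁.inner_triOp hκ hρ, hC₂.inner_triOp hκ hρ, hC₃.inner_triOp hκ hρ,
        quadForm, quadForm, quadForm, ← integral_add (hC₁.integrable hκ hρ v f g k)
          (hC₂.integrable hκ hρ v f g k)]
      refine integral_congr_ae (Eventually.of_forall fun z => ?_)
      simp only [← modulatedKernel_add hw.continuousOn h1 h2 h3, add_mul]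
    · intro f
      rw [e]
      have := (hκ.isMultiplier_smoothing hα).norm_mulOp_le f
      rwa [one_mul] at this
    · intro s t h1 h2 h3 f g k
      simp only [e]
      exact (h s t h1 h2 h3 f g k).1
    · intro s t h1 h2 h3 f g k
      simp only [e]
      exact (h s t h1 h2 h3 f g k).2
  integral_eq N s t f h1 h2 := hκ.integral_triOp_galerkin hρ hα hw N h1 h2 f
  inner_V t f g := by
    have h := hκ.inner_mulOp_freeSymbol_mulOp_freeSymbol t (mulOp μ (smoothing α κ) f)
      (mulOp μ (smoothing α κ) g)
    rw [(hκ.isMultiplier_freeSymbol t).mulOp_comm (hκ.isMultiplier_smoothing hα),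
      (hκ.isMultiplier_freeSymbol t).mulOp_comm (hκ.isMultiplier_smoothing hα),
      ← F.symm.inner_map_map, ← F.symm.inner_map_map (mulOp μ (smoothing α κ) f)] at h
    exact h
  inner_G N f := by
    have h := hM.re_inner_galerkin hκ N (F.symm (mulOp μ (smoothing α κ) f))
    rw [hM.galerkin_symm hκ hρ hα] at h
    exact h

/-- Well-posedness for every model with a Fourier transform. For `γ > 1` irregularity is first
weakened to the exponent `1`. -/
theorem globallyWellPosed (hM : M.IsSpectral F κ) (hκ : IsFrequencyMap μ κ ρ) (hρ : 0 < ρ)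
    (hα : 0 ≤ α) (hγ : 1 / 2 < γ) (hw : IsIrregular ρ γ w) : M.GloballyWellPosed α w :=
  (hM.lift hκ hρ hα (hw.of_le (lt_min (by linarith) one_pos) (min_le_left γ 1))).globallyWellPosed
    (lt_min hγ (by norm_num)) (min_le_right γ 1) hw.continuousOn

end NLSModel.IsSpectral

end Spectral

/-! ### Correlations -/

section Correlation

theorem integrable_conj {X : Type*} [MeasurableSpace X] {ν : Measure X} {f : X → ℂ}
    (hf : Integrable f ν) : Integrable (fun x => conj (f x)) ν :=
  (Complex.conjLIE.toContinuousLinearEquiv : ℂ →L[ℝ] ℂ).integrable_comp hf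

theorem memLp_conj {X : Type*} [MeasurableSpace X] {ν : Measure X} {f : X → ℂ}
    (hf : MemLp f 2 ν) : MemLp (fun x => conj (f x)) 2 ν :=
  (Complex.conjLIE.toContinuousLinearEquiv : ℂ →L[ℝ] ℂ).comp_memLp' hf

variable {G : Type*} [AddCommGroup G] [MeasurableSpace G]

/-- The Fourier transform of `F conj G`, in terms of those of `F` and `G`. -/
noncomputable def correlation (μ : Measure G) (p q : G → ℂ) (a : G) : ℂ :=
  ∫ ξ, p ξ * conj (q (ξ - a)) ∂μ

variable [MeasurableAdd₂ G] {μ : Measure G} [μ.IsAddLeftInvariant]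

theorem memLp_comp_sub {f : G → ℂ} (hf : MemLp f 2 μ) (a : G) : MemLp (fun x => f (x - a)) 2 μ :=
  hf.comp_measurePreserving (measurePreserving_sub_right μ a)

/-- Correlations of square integrable functions are bounded; together with integrability this makes
them square integrable. -/
theorem norm_correlation_le (f g : Lp ℂ 2 μ) (a : G) : ‖correlation μ f g a‖ ≤ ‖f‖ * ‖g‖ := by
  have hg := memLp_comp_sub (Lp.memLp g) a
  have h1 : ‖hg.toLp _‖ = ‖g‖ := by
    rw [Lp.norm_toLp, Lp.norm_def]
    congr 1
    exact eLpNorm_comp_measurePreserving (Lp.aestronglyMeasurable g)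
      (measurePreserving_sub_right μ a)
  have h2 : correlation μ f g a = inner ℂ (hg.toLp _) f := by
    rw [L2.inner_def]
    refine integral_congr_ae ?_
    filter_upwards [hg.coeFn_toLp] with x hx
    rw [hx]; rfl
  rw [h2, mul_comm, ← h1]
  exact norm_inner_le_norm _ _

variable [MeasurableNeg G] [SigmaFinite μ] [μ.IsNegInvariant]

/-- Fubini for the convolution of `p` with the reflection of `q`. -/
theorem integral_correlation {p q : G → ℂ} (hp : Integrable p μ) (hq : Integrable q μ) :
    Integrable (fun a => ∫ ξ, p ξ * q (ξ - a) ∂μ) μ ∧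
      ∫ a, ∫ ξ, p ξ * q (ξ - a) ∂μ ∂μ = (∫ ξ, p ξ ∂μ) * ∫ ξ, q ξ ∂μ := by
  have e : ∀ a, ∫ ξ, p ξ * q (ξ - a) ∂μ =
      convolution p (fun y => q (-y)) (ContinuousLinearMap.mul ℂ ℂ) μ a := fun a => by
    simp only [convolution, neg_sub, ContinuousLinearMap.mul_apply']
  simp only [e]
  refine ⟨hp.integrable_convolution _ hq.comp_neg, ?_⟩
  rw [integral_convolution _ hp hq.comp_neg, integral_neg_eq_self, ContinuousLinearMap.mul_apply']

theorem integrable_correlation {p q : G → ℂ} (hp : Integrable p μ) (hq : Integrable q μ) :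
    Integrable (correlation μ p q) μ :=
  (integral_correlation hp (integrable_conj hq)).1

theorem memLp_correlation {f g : Lp ℂ 2 μ} (hf : Integrable f μ) (hg : Integrable g μ) :
    MemLp (correlation μ f g) 2 μ := by
  have h := integrable_correlation hf hg
  rw [memLp_two_iff_integrable_sq_norm h.aestronglyMeasurable]
  refine (h.norm.const_mul (‖f‖ * ‖g‖)).mono' (h.aestronglyMeasurable.norm.pow 2)
    (Eventually.of_forall fun x => ?_)
  rw [Real.norm_of_nonneg (by positivity), pow_two]
  exact mul_le_mul_of_nonneg_right (norm_correlation_le f g x) (norm_nonneg _)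

/-- The quadrilinear form of the cubic nonlinearity, as an inner product of correlations. -/
theorem quadForm_eq_integral_correlation {h f : Lp ℂ 2 μ}
    (hint : Integrable (quadProd h f f f) (μ.prod (μ.prod μ))) (c : ℂ) :
    quadForm μ (fun _ => c) h f f f =
      c * ∫ a, conj (correlation μ h f a) * correlation μ f f a ∂μ := by
  rw [quadForm, integral_const_mul, integral_prod_symm _ hint,
    integral_prod _ hint.integral_prod_right]
  congr 1
  refine integral_congr_ae (Eventually.of_forall fun a => ?_)
  have hp : Integrable (fun ξ => conj (h ξ) * f (ξ - a)) μ :=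
    (memLp_conj (Lp.memLp h)).integrable_mul (memLp_comp_sub (Lp.memLp f) a)
  have hq : Integrable (fun ξ => f ξ * conj (f (ξ - a))) μ :=
    (Lp.memLp f).integrable_mul (memLp_conj (memLp_comp_sub (Lp.memLp f) a))
  have e := (integral_correlation hp hq).2
  have e1 : conj (correlation μ h f a) = ∫ ξ, conj (h ξ) * f (ξ - a) ∂μ := by
    rw [correlation, ← integral_conj]
    simp only [map_mul, Complex.conj_conj]
  simp only [e1]
  refine Eq.trans ?_ e
  refine integral_congr_ae (Eventually.of_forall fun b =>
    integral_congr_ae (Eventually.of_forall fun ξ => ?_))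
  simp only [quadProd]
  rw [sub_right_comm ξ a b]
  ring

end Correlation

/-! ### The cubic nonlinearity in Fourier variables -/

section Physical

variable {Y : Type*} [MeasurableSpace Y] {ν : Measure Y}

theorem coeFn_cubicNL {f : Lp ℂ 2 ν} {M : ℝ} (hM : ∀ᵐ x ∂ν, ‖f x‖ ≤ M) :
    cubicNL ν f =ᵐ[ν] fun x => Complex.I * (‖f x‖ : ℂ) ^ 2 * f x := by
  have h : MemLp (fun x => Complex.I * (‖f x‖ : ℂ) ^ 2 * f x) 2 ν := by
    refine (Lp.memLp f).of_le_mul (c := M ^ 2) ?_ ?_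
    · have := (Lp.stronglyMeasurable f).measurable
      exact Measurable.aestronglyMeasurable (by fun_prop)
    · filter_upwards [hM] with x hx
      rw [norm_mul, norm_mul, Complex.norm_I, one_mul, norm_pow, Complex.norm_real, norm_norm]
      exact mul_le_mul_of_nonneg_right (pow_le_pow_left₀ (norm_nonneg _) hx 2) (norm_nonneg _)
  rw [cubicNL, dif_pos h]
  exact h.coeFn_toLp

/-- The cubic nonlinearity is orthogonal to its argument, which is conservation of mass. This
includes the functions on which `cubicNL` has the default value `0`. -/
theorem re_inner_cubicNL (f : Lp ℂ 2 ν) : (inner ℂ f (cubicNL ν f)).re = 0 := by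
  rw [cubicNL]
  split_ifs with h
  · have e : inner ℂ f (h.toLp _) = Complex.I * ((∫ x, ‖f x‖ ^ 4 ∂ν : ℝ) : ℂ) := by
      rw [L2.inner_def, ← integral_complex_ofReal, ← integral_const_mul]
      refine integral_congr_ae ?_
      filter_upwards [h.coeFn_toLp] with x hx
      rw [hx, RCLike.inner_apply, mul_assoc, Complex.mul_conj']
      push_cast; ring
    rw [e]
    simp
  · simp

variable {G : Type*} [AddCommGroup G] [MeasurableSpace G] {μ : Measure G}

variable {κ : G → ℝ} {ρ : ℝ}

/-- A square integrable function of bounded frequency is integrable, since bounded sets of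
frequencies have finite measure. -/
theorem IsFrequencyMap.integrable_of_mulOp_cutoff (hκ : IsFrequencyMap μ κ ρ) {N : ℕ}
    {f : Lp ℂ 2 μ} (hf : mulOp μ (cutoff N ∘ κ) f = f) : Integrable f μ := by
  have hS : MeasurableSet {x | |κ x| ≤ N} := by
    have := hκ.measurable
    exact measurableSet_le (by fun_prop) measurable_const
  have : IsFiniteMeasure (μ.restrict {x | |κ x| ≤ N}) :=
    ⟨by rw [Measure.restrict_apply_univ]; exact hκ.measure_lt_top N⟩
  have h1 : IntegrableOn f {x | |κ x| ≤ N} μ :=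
    ((Lp.memLp f).restrict _).integrable (by norm_num)
  refine ((integrable_indicator_iff hS).2 h1).congr ?_
  have h2 := (hκ.isMultiplier_cutoff N).coeFn f
  rw [hf] at h2
  filter_upwards [h2] with x hx
  by_cases h : |κ x| ≤ N
  · exact indicator_of_mem (s := {x | |κ x| ≤ N}) h _
  · rw [indicator_of_notMem (s := {x | |κ x| ≤ N}) h, hx]
    simp [cutoff, h]

/-- The inversion formula `f(x) = ∫ f̂(ξ) e(x, ξ) dμ(ξ)` for integrable `f̂`, for a family `e` of
characters of the frequency group. -/
structure IsInversion (F : Lp ℂ 2 ν ≃ₗᵢ[ℂ] Lp ℂ 2 μ) (e : Y → G → ℂ) : Prop where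
  measurable : ∀ x, Measurable (e x)
  norm_eq : ∀ x ξ, ‖e x ξ‖ = 1
  map_sub : ∀ x ξ η, e x (ξ - η) = e x ξ * conj (e x η)
  symm_eq : ∀ u : Lp ℂ 2 μ, Integrable u μ → F.symm u =ᵐ[ν] fun x => ∫ ξ, u ξ * e x ξ ∂μ

namespace IsInversion

variable {F : Lp ℂ 2 ν ≃ₗᵢ[ℂ] Lp ℂ 2 μ} {e : Y → G → ℂ}

theorem integrable_mul (he : IsInversion F e) {u : G → ℂ} (hu : Integrable u μ) (x : Y) :
    Integrable (fun ξ => u ξ * e x ξ) μ :=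
  hu.mul_bdd (c := 1) (he.measurable x).aestronglyMeasurable
    (Eventually.of_forall fun ξ => (he.norm_eq x ξ).le)

/-- Functions with integrable Fourier transform are bounded. -/
theorem ae_norm_symm_le (he : IsInversion F e) {u : Lp ℂ 2 μ} (hu : Integrable u μ) :
    ∀ᵐ x ∂ν, ‖F.symm u x‖ ≤ ∫ ξ, ‖u ξ‖ ∂μ := by
  filter_upwards [he.symm_eq u hu] with x hx
  rw [hx]
  refine (norm_integral_le_integral_norm _).trans (le_of_eq ?_)
  simp only [norm_mul, he.norm_eq, mul_one]

variable [MeasurableAdd₂ G] [MeasurableNeg G] [SigmaFinite μ] [μ.IsAddLeftInvariant]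
  [μ.IsNegInvariant]

/-- The inverse transform of a correlation is the product `F⁻¹f · conj (F⁻¹g)`. -/
theorem symm_correlation (he : IsInversion F e) {f g : Lp ℂ 2 μ} (hf : Integrable f μ)
    (hg : Integrable g μ) : F.symm ((memLp_correlation hf hg).toLp _) =ᵐ[ν]
      fun x => F.symm f x * conj (F.symm g x) := by
  have h0 := (memLp_correlation hf hg).coeFn_toLp
  have h1 : Integrable ((memLp_correlation hf hg).toLp _) μ :=
    (integrable_correlation hf hg).congr h0.symm
  filter_upwards [he.symm_eq _ h1, he.symm_eq f hf, he.symm_eq g hg] with x e0 e1 e2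
  rw [e0, e1, e2, ← integral_conj, ← (integral_correlation (he.integrable_mul hf x)
    (integrable_conj (he.integrable_mul hg x))).2]
  refine integral_congr_ae ?_
  filter_upwards [h0] with a ha
  rw [ha, correlation, ← integral_mul_const]
  refine integral_congr_ae (Eventually.of_forall fun ξ => ?_)
  have h2 : e x a = e x ξ * conj (e x (ξ - a)) := by rw [← he.map_sub, sub_sub_cancel]
  simp only [map_mul]
  rw [h2]; ring

/-- The cubic nonlinearity in Fourier variables: `⟨h, i |f|² f⟩ = i ⟨h conj f, f conj f⟩`, and both
products have correlations as their transforms, so that Parseval applies. -/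
theorem inner_cubicNL (he : IsInversion F e) {h f : Lp ℂ 2 μ} (hh : Integrable h μ)
    (hf : Integrable f μ) (hint : Integrable (quadProd h f f f) (μ.prod (μ.prod μ))) :
    inner ℂ (F.symm h) (cubicNL ν (F.symm f)) = quadForm μ (fun _ => Complex.I) h f f f := by
  have e1 : inner ℂ (F.symm h) (cubicNL ν (F.symm f)) = Complex.I *
      inner ℂ (F.symm ((memLp_correlation hh hf).toLp _))
        (F.symm ((memLp_correlation hf hf).toLp _)) := by
    rw [L2.inner_def, L2.inner_def, ← integral_const_mul]
    refine integral_congr_ae ?_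
    filter_upwards [coeFn_cubicNL (he.ae_norm_symm_le hf), he.symm_correlation hh hf,
      he.symm_correlation hf hf] with x h1 h2 h3
    rw [h1, h2, h3]
    simp only [RCLike.inner_apply, map_mul, Complex.conj_conj, ← Complex.mul_conj']
    ring
  rw [e1, F.symm.inner_map_map, quadForm_eq_integral_correlation hint, L2.inner_def]
  congr 1
  refine integral_congr_ae ?_
  filter_upwards [(memLp_correlation hh hf).coeFn_toLp, (memLp_correlation hf hf).coeFn_toLp]
    with a h1 h2
  rw [h1, h2, RCLike.inner_apply, mul_comm]

/-- On functions of bounded frequency the truncations in the Galerkin kernel are redundant, so the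
quadrilinear estimate gives absolute convergence. -/
theorem _root_.IsFrequencyMap.integrable_quadProd (hκ : IsFrequencyMap μ κ ρ) (hρ : 0 < ρ) {N : ℕ}
    {h f : Lp ℂ 2 μ} (hh : mulOp μ (cutoff N ∘ κ) h = h) (hf : mulOp μ (cutoff N ∘ κ) f = f) :
    Integrable (quadProd h f f f) (μ.prod (μ.prod μ)) := by
  have h1 := ((hκ.isKernel_galerkin hρ le_rfl N).integrable hκ hρ h f f f).const_mul (-Complex.I)
  refine h1.congr ?_
  have hc := hκ.isMultiplier_cutoff N
  have eh := hc.coeFn h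
  have ef := hc.coeFn f
  rw [hh] at eh
  rw [hf] at ef
  filter_upwards [quadProd_congr eh ef ef ef] with z hz
  rw [quadProd_mul] at hz
  have e1 : galerkinKernel 0 κ N z = Complex.I *
      quadProd (cutoff N ∘ κ) (cutoff N ∘ κ) (cutoff N ∘ κ) (cutoff N ∘ κ) z := by
    simp [galerkinKernel, quadProd, smoothing, sobolevWeight]
  rw [e1, mul_assoc, ← hz]
  linear_combination (-quadProd h f f f z) * Complex.I_mul_I

/-- A model with the cubic nonlinearity satisfies the requirements on the nonlinearity as soon as
the inversion formula holds. -/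
theorem isSpectral (he : IsInversion F e) (hκ : IsFrequencyMap μ κ ρ) (hρ : 0 < ρ)
    {M : NLSModel (Lp ℂ 2 ν)} (hM : M.nonlin = cubicNL ν)
    (hNorm : ∀ α f, M.hNorm α f = eLpNorm (fun x => (sobolevWeight α (κ x) : ℂ) * F f x) 2 μ)
    (hmult : ∀ C m, IsMultiplier C (m ∘ κ) → ∀ f, F (M.mult m f) = mulOp μ (m ∘ κ) (F f)) :
    M.IsSpectral F κ where
  hNorm_eq := hNorm
  mult_eq := hmult
  inner_nonlin N h f hh hf := by
    rw [hM]
    exact he.inner_cubicNL (hκ.integrable_of_mulOp_cutoff hh) (hκ.integrable_of_mulOp_cutoff hf)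
      (hκ.integrable_quadProd hρ hh hf)
  re_inner_nonlin f := by rw [hM]; exact re_inner_cubicNL f

end IsInversion

end Physical

/-! ### The torus -/

section Torus

theorem norm_sq_eq_integral {X : Type*} [MeasurableSpace X] {ν : Measure X} (f : Lp ℂ 2 ν) :
    ‖f‖ ^ 2 = ∫ x, ‖f x‖ ^ 2 ∂ν := by
  have h : (inner ℂ f f : ℂ) = ((∫ x, ‖f x‖ ^ 2 ∂ν : ℝ) : ℂ) := by
    rw [L2.inner_def, ← integral_complex_ofReal]
    refine integral_congr_ae (Eventually.of_forall fun x => ?_)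
    simp only [RCLike.inner_apply, Complex.mul_conj']
    push_cast; rfl
  rw [inner_self_eq_norm_sq_to_K] at h
  refine Complex.ofReal_injective (Eq.trans ?_ h)
  push_cast; rfl

theorem memLp_count_iff {c : ℤ → ℂ} : MemLp c 2 Measure.count ↔ Memℓp c 2 := by
  rw [memLp_two_iff_integrable_sq_norm (measurable_of_countable c).aestronglyMeasurable,
    integrable_count_iff, memℓp_gen_iff (by norm_num)]
  simp

theorem memℓp_fourierCoeff (f : TorusL2) :
    Memℓp (fourierCoeff (f : AddCircle (2 * Real.pi) → ℂ)) 2 := by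
  have := lp.memℓp (fourierBasis.repr f)
  rwa [funext (fourierBasis_repr f)] at this

theorem fourierCoeff_repr_symm (c : lp (fun _ : ℤ => ℂ) 2) (k : ℤ) :
    fourierCoeff ((fourierBasis.repr.symm c : TorusL2) : AddCircle (2 * Real.pi) → ℂ) k = c k := by
  rw [← fourierBasis_repr, LinearIsometryEquiv.apply_symm_apply]

/-- The Fourier coefficients of a function on the torus, as an element of `L²(ℤ)`. -/
noncomputable def torusFourierₗᵢ : TorusL2 →ₗᵢ[ℂ] Lp ℂ 2 (Measure.count : Measure ℤ) where
  toFun f := (memLp_count_iff.2 (memℓp_fourierCoeff f)).toLp _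
  map_add' f g := by
    rw [← MemLp.toLp_add, MemLp.toLp_eq_toLp_iff]
    refine Eventually.of_forall fun k => ?_
    simp only [Pi.add_apply, ← fourierBasis_repr, map_add, lp.coeFn_add]
  map_smul' a f := by
    rw [RingHom.id_apply, ← MemLp.toLp_const_smul, MemLp.toLp_eq_toLp_iff]
    refine Eventually.of_forall fun k => ?_
    simp only [Pi.smul_apply, ← fourierBasis_repr, map_smul, lp.coeFn_smul]
  norm_map' f := by
    have h := (memLp_count_iff.2 (memℓp_fourierCoeff f)).coeFn_toLp
    have hs : Summable fun k => ‖fourierCoeff (f : AddCircle (2 * Real.pi) → ℂ) k‖ ^ 2 :=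
      (hasSum_sq_fourierCoeff f).summable
    refine (sq_eq_sq₀ (norm_nonneg _) (norm_nonneg _)).1 ?_
    change ‖(memLp_count_iff.2 (memℓp_fourierCoeff f)).toLp _‖ ^ 2 = ‖f‖ ^ 2
    rw [norm_sq_eq_integral, norm_sq_eq_integral, ← tsum_sq_fourierCoeff]
    simp only [Measure.ae_count_iff.1 h]
    rw [integral_countable (integrable_count_iff.2 hs.norm)]
    simp

theorem torusFourierₗᵢ_apply (f : TorusL2) (k : ℤ) :
    torusFourierₗᵢ f k = fourierCoeff (f : AddCircle (2 * Real.pi) → ℂ) k :=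
  Measure.ae_count_iff.1 (memLp_count_iff.2 (memℓp_fourierCoeff f)).coeFn_toLp k

/-- Parseval's identity: the Fourier transform on the torus is unitary. -/
noncomputable def torusFourier : TorusL2 ≃ₗᵢ[ℂ] Lp ℂ 2 (Measure.count : Measure ℤ) :=
  LinearIsometryEquiv.ofSurjective torusFourierₗᵢ fun c => by
    refine ⟨fourierBasis.repr.symm
      (⟨fun k => c k, memLp_count_iff.1 (Lp.memLp c)⟩ : lp (fun _ : ℤ => ℂ) 2), ?_⟩
    ext1
    refine Eventually.of_forall fun k => ?_
    rw [torusFourierₗᵢ_apply, fourierCoeff_repr_symm]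

theorem torusFourier_apply (f : TorusL2) (k : ℤ) :
    torusFourier f k = fourierCoeff (f : AddCircle (2 * Real.pi) → ℂ) k :=
  torusFourierₗᵢ_apply f k

/-- A Fourier series with summable coefficients converges uniformly, and its sum is the `L²`
function with these coefficients. -/
theorem isInversion_torus :
    IsInversion torusFourier fun (x : AddCircle (2 * Real.pi)) (k : ℤ) => fourier k x where
  measurable x := measurable_of_countable _
  norm_eq x k := by rw [fourier_apply]; exact Circle.norm_coe _
  map_sub x k l := by rw [sub_eq_add_neg, fourier_add, fourier_neg]
  symm_eq u hu := by
    set f := torusFourier.symm u with hf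
    have hfu : ∀ k, fourierCoeff (f : AddCircle (2 * Real.pi) → ℂ) k = u k := fun k => by
      rw [← torusFourier_apply, hf, LinearIsometryEquiv.apply_symm_apply]
    have hs : Summable fun k => u k := .of_norm (integrable_count_iff.1 hu)
    have hs' : Summable fun k => u k • (fourier k : C(AddCircle (2 * Real.pi), ℂ)) := by
      refine .of_norm ?_
      simp_rw [norm_smul, fourier_norm, mul_one]
      exact hs.norm
    have h1 := hasSum_fourier_series_L2 f
    simp only [hfu] at h1
    have h2 : HasSum (fun k => u k • (fourierLp 2 k : TorusL2)) (ContinuousMap.toLp 2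
        AddCircle.haarAddCircle ℂ (∑' k, u k • (fourier k : C(AddCircle (2 * Real.pi), ℂ)))) := by
      have := (ContinuousMap.toLp (E := ℂ) 2 AddCircle.haarAddCircle ℂ).hasSum hs'.hasSum
      simpa only [map_smul] using this
    rw [h1.unique h2]
    refine (ContinuousMap.coeFn_toLp _ _).trans (Eventually.of_forall fun x => ?_)
    have h3 := (ContinuousMap.evalCLM ℂ x).hasSum hs'.hasSum
    have h4 : Integrable (fun k => u k * fourier k x) (Measure.count : Measure ℤ) := by
      rw [integrable_count_iff]
      exact h3.summable.norm
    simp only [integral_countable h4]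
    refine h3.tsum_eq.symm.trans (tsum_congr fun k => ?_)
    simp

theorem isFrequencyMap_torus {ρ : ℝ} (hρ : 1 / 2 < ρ) :
    IsFrequencyMap (Measure.count : Measure ℤ) (fun k => (k : ℝ)) ρ where
  measurable := measurable_of_countable _
  map_sub := Int.cast_sub
  measure_lt_top r := by
    refine Measure.count_apply_lt_top.2 ((Set.finite_Icc (-⌈r⌉) ⌈r⌉).subset fun k hk => ?_)
    have := abs_le.1 (show |(k : ℝ)| ≤ r from hk)
    have h := Int.le_ceil r
    constructor
    · have : (-⌈r⌉ : ℝ) ≤ k := by linarith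
      exact_mod_cast this
    · have : (k : ℝ) ≤ ⌈r⌉ := by linarith
      exact_mod_cast this
  tail := by
    refine (setLIntegral_le_lintegral _ _).trans_lt ?_
    have h : Summable fun k : ℤ => |(k : ℝ)| ^ (-(2 * ρ)) :=
      Real.summable_abs_int_rpow (by linarith)
    rw [lintegral_count]
    have e : ∀ k : ℤ, ENNReal.ofReal (|(k : ℝ)| ^ (-ρ)) ^ (2 : ℝ) =
        ENNReal.ofReal (|(k : ℝ)| ^ (-(2 * ρ))) := fun k => by
      rw [ENNReal.ofReal_rpow_of_nonneg (by positivity) (by norm_num),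
        ← Real.rpow_mul (abs_nonneg _)]
      congr 2; ring
    simp only [e]
    exact h.tsum_ofReal_lt_top

theorem isSpectral_torus {ρ : ℝ} (hρ : 1 / 2 < ρ) :
    torusNLS.IsSpectral torusFourier fun k => (k : ℝ) := by
  refine isInversion_torus.isSpectral (isFrequencyMap_torus hρ) (by linarith) rfl ?_ ?_
  · intro α f
    change torusHNorm α f = _
    simp only [torusHNorm, torusFourier_apply, sobolevWeight]
  · intro C m hm f
    have h : Memℓp (fun k : ℤ => m k * fourierCoeff (f : AddCircle (2 * Real.pi) → ℂ) k) 2 := by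
      have := hm.memLp (torusFourier f)
      simp only [torusFourier_apply] at this
      exact memLp_count_iff.1 this
    ext1
    refine Eventually.of_forall fun k => ?_
    rw [Measure.ae_count_iff.1 (hm.coeFn (torusFourier f)) k, torusFourier_apply]
    change fourierCoeff (torusMult m f : AddCircle (2 * Real.pi) → ℂ) k =
      m k * torusFourier f k
    rw [torusMult, dif_pos h, fourierCoeff_repr_symm, torusFourier_apply]

end Torus

/-! ### The real line -/

section Line

/-- The Fourier transform on `L²(ℝ)`, with the characters `e^{2πixξ}`. -/
noncomputable abbrev lineFourier : LineL2 ≃ₗᵢ[ℂ] LineL2 := Lp.fourierTransformₗᵢ ℝ ℂ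

/-- The characters of the line. -/
noncomputable def lineChar (x ξ : ℝ) : ℂ := Complex.exp ((2 * Real.pi * (x * ξ) : ℝ) * Complex.I)

theorem continuous_lineChar : Continuous fun p : ℝ × ℝ => lineChar p.1 p.2 := by
  unfold lineChar; fun_prop

theorem norm_lineChar (x ξ : ℝ) : ‖lineChar x ξ‖ = 1 := Complex.norm_exp_ofReal_mul_I _

theorem lineChar_sub (x ξ η : ℝ) : lineChar x (ξ - η) = lineChar x ξ * conj (lineChar x η) := by
  rw [lineChar, lineChar, lineChar, ← Complex.exp_conj, ← Complex.exp_add]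
  congr 1
  simp only [map_mul, Complex.conj_ofReal, Complex.conj_I]
  push_cast; ring

theorem continuous_integral_lineChar {u : ℝ → ℂ} (hu : Integrable u) :
    Continuous fun x => ∫ ξ, u ξ * lineChar x ξ := by
  refine continuous_of_dominated (bound := fun ξ => ‖u ξ‖) (fun x => ?_) (fun x => ?_) hu.norm ?_
  · exact hu.aestronglyMeasurable.mul
      (continuous_lineChar.comp (by fun_prop : Continuous fun ξ : ℝ => (x, ξ))).aestronglyMeasurable
  · exact Eventually.of_forall fun ξ => by rw [norm_mul, norm_lineChar, mul_one]
  · exact Eventually.of_forall fun ξ => continuous_const.mul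
      (continuous_lineChar.comp (by fun_prop : Continuous fun x : ℝ => (x, ξ)))

/-- The `L²` Fourier transform is defined by duality with Schwartz functions, where the inversion
formula for integrable functions reduces to Fubini's theorem. -/
theorem isInversion_line : IsInversion lineFourier lineChar where
  measurable x :=
    (continuous_lineChar.comp (by fun_prop : Continuous fun ξ : ℝ => (x, ξ))).measurable
  norm_eq := norm_lineChar
  map_sub := lineChar_sub
  symm_eq u hu := by
    refine ae_eq_of_integral_contDiff_smul_eq
      ((Lp.memLp _).locallyIntegrable (by norm_num))
      (continuous_integral_lineChar hu).locallyIntegrable fun g hg hg' => ?_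
    have hg₁ : HasCompactSupport (Complex.ofRealCLM ∘ g) := hg'.comp_left rfl
    have hg₂ : ContDiff ℝ (⊤ : ℕ∞) (Complex.ofRealCLM ∘ g) := Complex.ofRealCLM.contDiff.comp hg
    set φ : SchwartzMap ℝ ℂ := hg₁.toSchwartzMap hg₂ with hφ
    have hφg : ∀ x, φ x = (g x : ℂ) := fun x => rfl
    have h1 : ∫ x, g x • lineFourier.symm u x = ∫ ξ, (𝓕⁻ φ) ξ • u ξ := by
      have h2 := DFunLike.congr_fun (Lp.fourierInv_toTemperedDistribution_eq u) φ
      rw [TemperedDistribution.fourierInv_apply, Lp.toTemperedDistribution_apply,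
        Lp.toTemperedDistribution_apply] at h2
      rw [h2]
      refine integral_congr_ae (Eventually.of_forall fun x => ?_)
      simp only [hφg, Complex.real_smul, smul_eq_mul]
      rfl
    have h3 : ∀ ξ, (𝓕⁻ φ) ξ = ∫ x, φ x * lineChar x ξ := fun ξ => by
      rw [SchwartzMap.fourierInv_coe, Real.fourierInv_eq']
      refine integral_congr_ae (Eventually.of_forall fun x => ?_)
      simp only [lineChar, smul_eq_mul, RCLike.inner_apply, conj_trivial]
      rw [mul_comm, mul_comm ξ x]
    rw [h1]
    have h4 : Integrable (Function.uncurry fun x ξ => φ x * u ξ * lineChar x ξ)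
        (volume.prod volume) :=
      (φ.integrable.mul_prod hu).mul_bdd (c := 1) continuous_lineChar.aestronglyMeasurable
        (Eventually.of_forall fun p => (norm_lineChar _ _).le)
    have h5 := integral_integral_swap h4
    refine Eq.trans ?_ (h5.symm.trans ?_)
    · refine integral_congr_ae (Eventually.of_forall fun ξ => ?_)
      simp only [h3, smul_eq_mul]
      rw [← integral_mul_const]
      refine integral_congr_ae (Eventually.of_forall fun x => ?_)
      simp only; ring
    · refine integral_congr_ae (Eventually.of_forall fun x => ?_)
      simp only [Complex.real_smul]
      rw [← integral_const_mul]
      refine integral_congr_ae (Eventually.of_forall fun ξ => ?_)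
      simp only [hφg]; ring

theorem abs_le_abs_two_pi_mul (ξ : ℝ) : |ξ| ≤ |2 * Real.pi * ξ| := by
  rw [abs_mul, abs_of_pos Real.two_pi_pos]
  have := Real.pi_gt_three
  nlinarith [abs_nonneg ξ]

theorem isFrequencyMap_line {ρ : ℝ} (hρ : 1 / 2 < ρ) :
    IsFrequencyMap (volume : Measure ℝ) (fun ξ => 2 * Real.pi * ξ) ρ where
  measurable := by fun_prop
  map_sub x y := by ring
  measure_lt_top r := by
    refine (measure_mono (t := Icc (-r) r) fun ξ hξ => ?_).trans_lt measure_Icc_lt_top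
    exact abs_le.1 ((abs_le_abs_two_pi_mul ξ).trans hξ)
  tail := by
    have hint : Integrable fun ξ : ℝ => (1 / 2 : ℝ) ^ (-(2 * ρ)) * (1 + ‖ξ‖) ^ (-(2 * ρ)) :=
      (integrable_one_add_norm (by simp; linarith)).const_mul _
    refine lt_of_le_of_lt ?_ hint.lintegral_lt_top
    refine (setLIntegral_mono' (measurableSet_le measurable_const (by fun_prop))
      fun ξ hξ => ?_).trans (setLIntegral_le_lintegral _ _)
    rw [ENNReal.ofReal_rpow_of_nonneg (by positivity) (by norm_num), ← Real.rpow_mul (abs_nonneg _),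
      ← Real.mul_rpow (by norm_num) (by positivity)]
    refine ENNReal.ofReal_le_ofReal ?_
    have e : -ρ * 2 = -(2 * ρ) := by ring
    rw [e]
    refine Real.rpow_le_rpow_of_nonpos (by positivity) ?_ (by linarith)
    have h1 : 1 ≤ |2 * Real.pi * ξ| := hξ
    have h2 := abs_le_abs_two_pi_mul ξ
    rw [Real.norm_eq_abs]
    linarith

theorem isSpectral_line {ρ : ℝ} (hρ : 1 / 2 < ρ) :
    lineNLS.IsSpectral lineFourier fun ξ => 2 * Real.pi * ξ := by
  refine isInversion_line.isSpectral (isFrequencyMap_line hρ) (by linarith) rfl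
    (fun α f => rfl) fun C m hm f => ?_
  have h : MemLp (fun ξ : ℝ => m (2 * Real.pi * ξ) * (𝓕 f : LineL2) ξ) 2 volume :=
    hm.memLp (lineFourier f)
  have e : lineNLS.mult m f = 𝓕⁻ (h.toLp _ : LineL2) := dif_pos h
  rw [e]
  refine (lineFourier.apply_symm_apply _).trans ?_
  ext1
  filter_upwards [h.coeFn_toLp, hm.coeFn (lineFourier f)] with ξ h1 h2
  rw [h1, h2]
  rfl

end Line

theorem mainTheorem1 (ρ γ : ℝ) (hρ : 1 / 2 < ρ) (hγ : 1 / 2 < γ) (w : ℝ → ℝ)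
    (hw : IsIrregular ρ γ w) (α : ℝ) (hα : 0 ≤ α) :
    torusNLS.GloballyWellPosed α w ∧ lineNLS.GloballyWellPosed α w :=
  ⟨(isSpectral_torus hρ).globallyWellPosed (isFrequencyMap_torus hρ) hw.rho_pos hα hγ hw,
    (isSpectral_line hρ).globallyWellPosed (isFrequencyMap_line hρ) hw.rho_pos hα hγ hw⟩
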